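/- **Terms and flows.** Consider first-order terms over a signature with infinitely many variables, a distinguished binary symbol $\bullet$ (infix, associated to the right), distinguished constants $\star,\mathtt l,\mathtt r$ with $\mathtt l\neq\mathtt r$, a finite alphabet $\Sigma$ of constants with $\star\notin\Sigma$, a set $\mathtt Q$ of state constants and an infinite set $\mathtt P$ of position constants. A *flow* $t\leftharpoonup u$ is a pair of terms with the same variables, up to bijective renaming of variables. Choosing representatives without common variables, the product $(u\leftharpoonup v)(t\leftharpoonup w)$ is defined if $v,t$ are unifiable, and is then $\theta u\leftharpoonup\theta w$ for a most general unifier $\theta$ of $v,t$. *Wirings* are finite formal $\mathbb C$-linear combinations of flows, multiplied by bilinear extension of this partial product (undefined products count as $0$), with unit $x\leftharpoonup x$; a wiring $F$ is *nilpotent* if $F^k=0$ for some $k\in\mathbb N$. A wiring is *concrete* if it is a finite sum of distinct flows with coefficients $1$. A concrete wiring $\sum_i u_i\leftharpoonup t_i$ is *isometric* if for $i\ne j$ the terms $u_i,u_j$ are not unifiable after their variables are renamed apart, and neither are $t_i,t_j$. **Words.** For a word $W=\mathtt c_1\dots\mathtt c_n$ over $\Sigma$ ($n\ge 0$) and distinct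 $\mathtt p_0,\dots,\mathtt p_n\in\mathtt P$, put $\mathtt c_0=\star$ and, reading indices modulo $n+1$, $$W(\mathtt p_0,\dots,\mathtt p_n)=\sum_{i=0}^{n}\Big[\big(A_i\leftharpoonup B_{i+1}\big)+\big(B_{i+1}\leftharpoonup A_i\big)\Big],\qquad A_i=(\mathtt c_i\bullet\mathtt r\bullet x)\bullet(\mathtt p_i\bullet y),\quad B_i=(\mathtt c_i\bullet\mathtt l\bullet x)\bullet(\mathtt p_i\bullet y).$$ **Observations.** An *$\mathfrak S$-observation* is a concrete wiring $\varphi$ each of whose flows has the form $$(\mathtt c'\bullet\mathtt d'\bullet\mathtt q')\bullet(x_1\bullet\cdots\bullet x_m\bullet y)\;\leftharpoonup\;(\mathtt c\bullet\mathtt d\bullet\mathtt q)\bullet(x_{\sigma(1)}\bullet\cdots\bullet x_{\sigma(m)}\bullet y)$$ (that is, $(\mathtt c'\bullet\mathtt d'\bullet\mathtt q'\leftharpoonup\mathtt c\bullet\mathtt d\bullet\mathtt q)\otimes[\sigma]$) with $\mathtt c,\mathtt c'\in\Sigma\cup\{\star\}$, $\mathtt d,\mathtt d'\in\{\mathtt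 l,\mathtt r\}$, $\mathtt q,\mathtt q'\in\mathtt Q$ and $\sigma$ a permutation of $\{1,\dots,m\}$, $m\ge0$. Its language is $$\mathcal L(\varphi)=\{W \text{ word over }\Sigma : \varphi\,W(\mathtt p_0,\dots,\mathtt p_n)\text{ is nilpotent for all distinct }\mathtt p_0,\dots,\mathtt p_n\in\mathtt P\}.$$ **Theorem.** For every $\mathfrak S$-observation $\varphi$, the language $\mathcal L(\varphi)$ is in $\mathrm{NLogspace}$: it is decided by a nondeterministic Turing machine with a read-only input tape and finitely many work tapes that halts along every computation and visits $O(\log n)$ work tape cells on inputs of length $n$. If moreover $\varphi$ is isometric, then $\mathcal L(\varphi)$ is in $\mathrm{Logspace}$: it is decided by a deterministic such machine. -/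

import Mathlib

/-!
The unification algebra, words and observations, and the classes `Logspace` and `NLogspace`.
First-order terms over a signature `L` are Mathlib's `L.Term ℕ`, with variables indexed by `ℕ`.
-/

namespace UnifLog

universe u v w

open FirstOrder

section Unification

variable {L : FirstOrder.Language.{u, v}}

/-- `θ` is a unifier of `t` and `s`. -/
def IsUnifier (θ : ℕ → L.Term ℕ) (t s : L.Term ℕ) : Prop :=
  t.subst θ = s.subst θ

/-- `θ` is a most general unifier: every unifier is an instance `σθ` of it. -/
def IsMGU (θ : ℕ → L.Term ℕ) (t s : L.Term ℕ) : Prop :=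
  IsUnifier θ t s ∧
    ∀ ψ : ℕ → L.Term ℕ, IsUnifier ψ t s → ∃ σ : ℕ → L.Term ℕ, ∀ x, ψ x = (θ x).subst σ

/-- Two terms are matchable if they are unifiable after their variables have been renamed apart. -/
def Matchable (t s : L.Term ℕ) : Prop :=
  ∃ α β : Equiv.Perm ℕ,
    Disjoint (t.relabel α).varFinset (s.relabel β).varFinset ∧
      ∃ θ : ℕ → L.Term ℕ, IsUnifier θ (t.relabel α) (s.relabel β)

theorem varFinset_subst (t : L.Term ℕ) (θ : ℕ → L.Term ℕ) :
    (t.subst θ).varFinset = t.varFinset.biUnion (fun x => (θ x).varFinset) := by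
  induction t with
  | var x => simp [Language.Term.subst, Language.Term.varFinset]
  | func f ts ih =>
    ext y
    simp only [Language.Term.subst, Language.Term.varFinset, Finset.mem_biUnion, ih]
    constructor
    · rintro ⟨i, hi, x, hx, hy⟩
      exact ⟨x, ⟨i, hi, hx⟩, hy⟩
    · rintro ⟨x, ⟨i, hi, hx⟩, hy⟩
      exact ⟨i, hi, x, hx, hy⟩

end Unification

section Flows

variable (L : FirstOrder.Language.{u, v})

/-- A representative `tgt ↼ src` of a flow. -/
structure PreFlow where
  tgt : L.Term ℕ
  src : L.Term ℕ
  vars_eq : tgt.varFinset = src.varFinset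

/-- Equality up to a (bijective) renaming of the variables. -/
instance PreFlow.setoid : Setoid (PreFlow L) where
  r a b := ∃ α : Equiv.Perm ℕ, a.tgt.relabel α = b.tgt ∧ a.src.relabel α = b.src
  iseqv :=
    { refl := fun a => ⟨Equiv.refl ℕ, by simp⟩
      symm := by
        rintro a b ⟨α, h₁, h₂⟩
        refine ⟨α.symm, ?_, ?_⟩
        · rw [← h₁]; simp
        · rw [← h₂]; simp
      trans := by
        rintro a b c ⟨α, h₁, h₂⟩ ⟨β, h₃, h₄⟩
        refine ⟨α.trans β, ?_, ?_⟩
        · rw [← h₃, ← h₁]; simp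
        · rw [← h₄, ← h₂]; simp }

/-- Flows, considered up to renaming. -/
def Flow : Type u := Quotient (PreFlow.setoid L)

variable {L}

/-- The renaming class of `a`. -/
def PreFlow.toFlow (a : PreFlow L) : Flow L := Quotient.mk (PreFlow.setoid L) a

/-- The representative `θu ↼ θw` of the product of `u ↼ v` and `t ↼ w`, for `θ` a unifier of
`v` and `t`. -/
def PreFlow.resolve (a b : PreFlow L) (θ : ℕ → L.Term ℕ) (h : IsUnifier θ a.src b.tgt) :
    PreFlow L where
  tgt := a.tgt.subst θ
  src := b.src.subst θ
  vars_eq := by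
    have h' : a.src.subst θ = b.tgt.subst θ := h
    rw [varFinset_subst, a.vars_eq, ← varFinset_subst, h', varFinset_subst, b.vars_eq,
      ← varFinset_subst]

/-- `h` is the product `fg`: for representatives `a` of `f` and `b` of `g` without common
variables and a most general unifier `θ` of the source of `a` and the target of `b`, it is the
class of `θ(tgt a) ↼ θ(src b)`. The product is defined if there is such an `h`; it does not depend
on the representatives or on `θ`. -/
def Flow.IsProduct (f g h : Flow L) : Prop :=
  ∃ (a b : PreFlow L) (θ : ℕ → L.Term ℕ) (hθ : IsMGU θ a.src b.tgt),
    a.toFlow = f ∧ b.toFlow = g ∧ Disjoint a.src.varFinset b.tgt.varFinset ∧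
      (a.resolve b θ hθ.1).toFlow = h

variable (L) in
/-- Wirings: finite formal linear combinations of flows with complex coefficients. -/
def Wiring : Type u := Flow L →₀ ℂ

namespace Wiring

noncomputable instance : AddCommGroup (Wiring L) := inferInstanceAs (AddCommGroup (Flow L →₀ ℂ))

/-- A flow with a coefficient, as a wiring. -/
noncomputable def single (f : Flow L) (c : ℂ) : Wiring L := Finsupp.single f c

/-- The coefficient of a flow in a wiring. -/
def coeff (F : Wiring L) (f : Flow L) : ℂ := Finsupp.toFun F f

/-- The unit `x ↼ x`. -/
noncomputable instance : One (Wiring L) :=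
  ⟨single (PreFlow.toFlow ⟨Language.Term.var 0, Language.Term.var 0, rfl⟩) 1⟩

open Classical in
/-- The product of two flows as a formal sum: zero if it is not defined. -/
noncomputable def flowMul (f g : Flow L) : Flow L →₀ ℂ :=
  if h : ∃ k, Flow.IsProduct f g k then Finsupp.single h.choose 1 else 0

/-- The bilinear extension of the partial product of flows. -/
noncomputable def mul (F G : Flow L →₀ ℂ) : Flow L →₀ ℂ :=
  F.sum fun f a => G.sum fun g b => (a * b) • flowMul f g

noncomputable instance : Mul (Wiring L) := ⟨mul⟩

noncomputable instance : Pow (Wiring L) ℕ := ⟨fun F n => npowRec n F⟩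

/-- All coefficients of the flows that occur are equal to one. -/
def IsConcrete (F : Wiring L) : Prop := ∀ f : Flow L, F.coeff f ≠ 0 → F.coeff f = 1

/-- A concrete wiring is isometric if the targets of its flows are pairwise disjoint (not
matchable), and so are their sources. -/
def IsIsometric (F : Wiring L) : Prop :=
  F.IsConcrete ∧ ∀ a b : PreFlow L, F.coeff a.toFlow ≠ 0 → F.coeff b.toFlow ≠ 0 →
    a.toFlow ≠ b.toFlow → ¬ Matchable a.tgt b.tgt ∧ ¬ Matchable a.src b.src

end Wiring

end Flows

/-- The distinguished symbols: the binary symbol `dot`, the constants `⋆`, `l`, `r`, the finite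
alphabet `Σ` with `⋆ ∉ Σ`, the state constants and the (infinitely many) position constants. -/
structure Vocabulary (L : FirstOrder.Language.{u, v}) where
  dot : L.Functions 2
  star : L.Constants
  lft : L.Constants
  rgt : L.Constants
  alphabet : Finset L.Constants
  states : Set L.Constants
  positions : Set L.Constants
  lft_ne_rgt : lft ≠ rgt
  star_notMem : star ∉ alphabet
  positions_infinite : positions.Infinite

namespace Vocabulary

variable {L : FirstOrder.Language.{u, v}} (V : Vocabulary L)

/-- The term `t • s`. -/
def cons (t s : L.Term ℕ) : L.Term ℕ := V.dot.apply₂ t s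

/-- The constant `c` as a term. -/
def const (c : L.Constants) : L.Term ℕ := Language.Constants.term c

theorem varFinset_cons (t s : L.Term ℕ) :
    (V.cons t s).varFinset = t.varFinset ∪ s.varFinset := by
  ext x
  simp [cons, Language.Functions.apply₂, Language.Term.varFinset, Fin.exists_fin_two]

theorem varFinset_const (c : L.Constants) : (const c : L.Term ℕ).varFinset = ∅ := by
  ext x
  simp [const, Language.Constants.term, Language.Term.varFinset]

/-- The term `t₁ • t₂ • ⋯ • tₙ • s`, with `•` associated to the right. -/
def consList (ts : List (L.Term ℕ)) (s : L.Term ℕ) : L.Term ℕ := ts.foldr V.cons s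

theorem mem_varFinset_consList (ts : List (L.Term ℕ)) (s : L.Term ℕ) (x : ℕ) :
    x ∈ (V.consList ts s).varFinset ↔ (∃ t ∈ ts, x ∈ t.varFinset) ∨ x ∈ s.varFinset := by
  induction ts with
  | nil => simp [consList]
  | cons t ts ih =>
    have h : V.consList (t :: ts) s = V.cons t (V.consList ts s) := rfl
    rw [h, varFinset_cons, Finset.mem_union, ih]
    simp [or_assoc]

/-- `[σ] = x₁ • ⋯ • xₙ • y ↼ x_{σ(1)} • ⋯ • x_{σ(n)} • y`. -/
def perm {n : ℕ} (σ : Equiv.Perm (Fin n)) : PreFlow L where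
  tgt := V.consList (List.ofFn fun i : Fin n => Language.Term.var (i : ℕ)) (Language.Term.var n)
  src := V.consList (List.ofFn fun i : Fin n => Language.Term.var (σ i : ℕ)) (Language.Term.var n)
  vars_eq := by
    ext x
    simp only [mem_varFinset_consList, List.mem_ofFn, Language.Term.varFinset,
      Finset.mem_singleton]
    refine or_congr ⟨?_, ?_⟩ Iff.rfl
    · rintro ⟨_, ⟨i, rfl⟩, hx⟩
      exact ⟨_, ⟨σ.symm i, rfl⟩, by simpa [Language.Term.varFinset] using hx⟩
    · rintro ⟨_, ⟨i, rfl⟩, hx⟩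
      exact ⟨_, ⟨σ i, rfl⟩, hx⟩

/-- The closed term `c • d • q`. -/
def head (c d q : L.Constants) : L.Term ℕ :=
  V.cons (const c) (V.cons (const d) (const q))

/-- The flow `(c' • d' • q' ↼ c • d • q) ⊗ [σ]`. The first factor has no variables, so the
representatives below have no variable in common. -/
def obsFlow {n : ℕ} (c' d' q' c d q : L.Constants) (σ : Equiv.Perm (Fin n)) : PreFlow L where
  tgt := V.cons (V.head c' d' q') (V.perm σ).tgt
  src := V.cons (V.head c d q) (V.perm σ).src
  vars_eq := by
    simp only [head, varFinset_cons, varFinset_const, (V.perm σ).vars_eq]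

/-- `c ∈ Σ ∪ {⋆}`. -/
def IsLetter (c : L.Constants) : Prop := c ∈ V.alphabet ∨ c = V.star

/-- `d ∈ {l, r}`. -/
def IsDir (d : L.Constants) : Prop := d = V.lft ∨ d = V.rgt

/-- `φ` is a concrete (finite) sum of flows `(c' • d' • q' ↼ c • d • q) ⊗ [σ]`, with
`c, c' ∈ Σ ∪ {⋆}`, `d, d' ∈ {l, r}`, state constants `q, q'` and a permutation `σ` of a finite
set `{1, …, n}`, where `n` may differ from one flow to another. -/
def IsObservation (φ : Wiring L) : Prop :=
  φ.IsConcrete ∧ ∀ f : Flow L, φ.coeff f ≠ 0 →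
    ∃ (n : ℕ) (σ : Equiv.Perm (Fin n)) (c' d' q' c d q : L.Constants),
      V.IsLetter c' ∧ V.IsDir d' ∧ q' ∈ V.states ∧
      V.IsLetter c ∧ V.IsDir d ∧ q ∈ V.states ∧
      f = (V.obsFlow c' d' q' c d q σ).toFlow

/-- The term `(c • d • x) • (p • y)`, with distinct variables `x`, `y`. -/
def cell (c d p : L.Constants) : L.Term ℕ :=
  V.cons (V.cons (const c) (V.cons (const d) (Language.Term.var 0)))
    (V.cons (const p) (Language.Term.var 1))

/-- The flow `(c' • d' • x) • (p' • y) ↼ (c • d • x) • (p • y)`. -/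
def wordFlow (c' d' p' c d p : L.Constants) : PreFlow L where
  tgt := V.cell c' d' p'
  src := V.cell c d p
  vars_eq := by
    simp only [cell, varFinset_cons, varFinset_const]

/-- The symbol in cell `i`: `⋆` in cell `0`, and `cᵢ` in cell `i` for `1 ≤ i ≤ n`. -/
def letter (W : List V.alphabet) (i : Fin (W.length + 1)) : L.Constants :=
  Fin.cases V.star (fun j => ((W.get j : V.alphabet) : L.Constants)) i

/-- The representation `W(p₀, …, pₙ)`: the sum over all cells `i` of
`(cᵢ • r • x) • (pᵢ • y) ⇌ (cᵢ₊₁ • l • x) • (pᵢ₊₁ • y)`, with `c₀ = ⋆` and `i + 1` taken modulo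
`n + 1`. -/
noncomputable def wordRep (W : List V.alphabet) (p : Fin (W.length + 1) → L.Constants) :
    Wiring L :=
  ∑ i : Fin (W.length + 1),
    (Wiring.single (V.wordFlow (V.letter W i) V.rgt (p i)
        (V.letter W (i + 1)) V.lft (p (i + 1))).toFlow 1 +
      Wiring.single (V.wordFlow (V.letter W (i + 1)) V.lft (p (i + 1))
        (V.letter W i) V.rgt (p i)).toFlow 1)

/-- The language of `φ`: the words `W` such that `φ W(p₀, …, pₙ)` is nilpotent for any choice of
distinct position constants. -/
def language (φ : Wiring L) : _root_.Language V.alphabet :=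
  {W | ∀ p : Fin (W.length + 1) → L.Constants, Function.Injective p →
    (∀ i, p i ∈ V.positions) → IsNilpotent (φ * V.wordRep W p)}

end Vocabulary

section Machines

/-- Head moves. -/
inductive Move
  | left
  | stay
  | right

/-- Contents of an input cell: an end marker or a letter. -/
inductive InSym (A : Type w)
  | leftEnd
  | letter (a : A)
  | rightEnd

/-- A nondeterministic Turing machine with a read-only two-way input tape and `tapes` work tapes,
each infinite to the right. `trans` lists the possible actions: new state, move of the input head,
and for each work tape the symbol written and the move of its head. -/
structure TM (A : Type w) where
  State : Type
  Sym : Type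
  finite_state : Finite State
  finite_sym : Finite Sym
  tapes : ℕ
  blank : Sym
  start : State
  accept : Set State
  trans : State → InSym A → (Fin tapes → Sym) → Set (State × Move × (Fin tapes → Sym × Move))

namespace TM

variable {A : Type w} (M : TM A)

/-- A configuration: state, input head position, and contents and head positions of the work
tapes. -/
structure Cfg where
  state : M.State
  inPos : ℕ
  tape : Fin M.tapes → ℕ → M.Sym
  head : Fin M.tapes → ℕ

/-- The input tape holds the left end marker in cell `0`, the word in cells `1, …, n` and the right
end marker in cell `n + 1`. -/
def readInput (W : List A) : ℕ → InSym A
  | 0 => InSym.leftEnd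
  | i + 1 => match W[i]? with
    | some a => InSym.letter a
    | none => InSym.rightEnd

/-- Moving a head; a head that would leave its tape on the left stays where it is. -/
def _root_.UnifLog.Move.apply : Move → ℕ → ℕ
  | Move.left, i => i - 1
  | Move.stay, i => i
  | Move.right, i => i + 1

/-- The initial configuration: blank work tapes and all heads on cell `0`. -/
def init : M.Cfg where
  state := M.start
  inPos := 0
  tape := fun _ _ => M.blank
  head := fun _ => 0

/-- One step on input `W`. The input head does not move beyond the right end marker. -/
def Step (W : List A) (c c' : M.Cfg) : Prop :=
  ∃ o ∈ M.trans c.state (readInput W c.inPos) (fun j => c.tape j (c.head j)),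
    c'.state = o.1 ∧
    c'.inPos = min (o.2.1.apply c.inPos) (W.length + 1) ∧
    (∀ j, c'.tape j = Function.update (c.tape j) (c.head j) (o.2.2 j).1) ∧
    (∀ j, c'.head j = (o.2.2 j).2.apply (c.head j))

/-- `c` is reachable from the initial configuration on input `W`. -/
def Reaches (W : List A) (c : M.Cfg) : Prop := Relation.ReflTransGen (M.Step W) M.init c

/-- Every computation on input `W` is finite. -/
def Halts (W : List A) : Prop :=
  ¬ ∃ run : ℕ → M.Cfg, run 0 = M.init ∧ ∀ i, M.Step W (run i) (run (i + 1))

/-- Some computation on input `W` halts in an accepting state. -/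
def Accepts (W : List A) : Prop :=
  ∃ c, M.Reaches W c ∧ (∀ c', ¬ M.Step W c c') ∧ c.state ∈ M.accept

/-- `M` halts on every input, along every computation, and accepts exactly the words of `K`. -/
def Decides (K : _root_.Language A) : Prop :=
  ∀ W : List A, M.Halts W ∧ (M.Accepts W ↔ W ∈ K)

/-- At most one action is possible in any situation. -/
def IsDeterministic : Prop := ∀ q a s, (M.trans q a s).Subsingleton

/-- Along every computation on an input of length `n`, only the first `O(log n)` cells of each work
tape are visited. -/
def IsLogSpace : Prop :=
  ∃ C : ℕ, ∀ (W : List A) (c : M.Cfg), M.Reaches W c →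
    ∀ j, c.head j < C * (Nat.log 2 W.length + 1)

end TM

/-- Languages decided by a nondeterministic Turing machine in logarithmic space. -/
def NLogspace (A : Type w) : Set (_root_.Language A) :=
  {K | ∃ M : TM A, M.IsLogSpace ∧ M.Decides K}

/-- Languages decided by a deterministic Turing machine in logarithmic space. -/
def Logspace (A : Type w) : Set (_root_.Language A) :=
  {K | ∃ M : TM A, M.IsDeterministic ∧ M.IsLogSpace ∧ M.Decides K}

end Machines

end UnifLog

/-!
Up to renaming, the product of two flows is the composition of the relations given by their
instances, and nonnegative coefficients cannot cancel. So `φ W(p₀, …, pₙ)` is nilpotent if and only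
if the walks along its instances are of bounded length. After one step, a term on such a walk has
the target of a flow of `φ` as its head, and the flows move only a bounded number of entries of the
stack below, which matter only as positions `pᵢ`. This leaves a graph whose vertices are a flow and
a bounded number of pointers into `W`, with edges that can be read off the symbols under the
pointers and the equalities and adjacencies between them; the choice of the `pᵢ` is immaterial.

The vertices at which walks of length `t` start become fewer as `t` grows, until there are none of
them if and only if walks are bounded. A nondeterministic machine computes their number for each
`t` from the previous one by inductive counting, as in the theorem of Immerman and Szelepcsényi. If
the sources of the flows of `φ` are disjoint, every vertex has at most one successor, and a
deterministic machine can follow the walk from each vertex in turn.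
-/

namespace UnifLog

universe u v w

open FirstOrder

/-! ### Transition systems and machines -/

/-- A nondeterministic computation on configurations of type `C`, with the configurations that
accept when they halt, and those that respect the resource bound of interest. -/
structure TransitionSystem (C : Type*) where
  step : C → Set C
  accept : Set C
  safe : Set C

namespace TransitionSystem

variable {C D : Type*} {S : TransitionSystem C} {T : TransitionSystem D} {c d e : C} {r : Prop}

/-- `d` is reachable from `c`. -/
def Reaches (S : TransitionSystem C) : C → C → Prop :=
  Relation.ReflTransGen fun d e => e ∈ S.step d

/-- Some computation from `c` halts in an accepting configuration. -/
def Accepts (S : TransitionSystem C) (c : C) : Prop :=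
  ∃ d, S.Reaches c d ∧ S.step d = ∅ ∧ d ∈ S.accept

/-- Every computation from `c` is finite and safe, and one of them accepts if and only if `r`
holds. -/
structure Settles (S : TransitionSystem C) (c : C) (r : Prop) : Prop where
  halts : Acc (fun e d => e ∈ S.step d) c
  safe : ∀ d, S.Reaches c d → d ∈ S.safe
  accepts_iff : S.Accepts c ↔ r

/-- The configuration `d` is reached from `c` by safe steps without any choice. -/
def Leads (S : TransitionSystem C) : C → C → Prop :=
  Relation.ReflTransGen fun d e => d ∈ S.safe ∧ S.step d = {e}

theorem accepts_iff_of_nonempty (h : (S.step c).Nonempty) :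
    S.Accepts c ↔ ∃ d ∈ S.step c, S.Accepts d := by
  constructor
  · rintro ⟨e, hce, he, ha⟩
    rcases Relation.ReflTransGen.cases_head hce with rfl | ⟨d, hd, hde⟩
    · exact absurd he h.ne_empty
    · exact ⟨d, hd, e, hde, he, ha⟩
  · rintro ⟨d, hd, e, hde, he⟩
    exact ⟨e, .head hd hde, he⟩

theorem accepts_iff_of_halted (h : S.step c = ∅) : S.Accepts c ↔ c ∈ S.accept := by
  constructor
  · rintro ⟨d, hcd, -, ha⟩
    rcases Relation.ReflTransGen.cases_head hcd with rfl | ⟨e, he, -⟩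
    · exact ha
    · exact absurd he (h ▸ Set.notMem_empty e)
  · exact fun ha => ⟨c, .refl, h, ha⟩

theorem Leads.single (hs : c ∈ S.safe) (h : S.step c = {d}) : S.Leads c d :=
  Relation.ReflTransGen.single ⟨hs, h⟩

theorem Leads.head (hs : c ∈ S.safe) (h : S.step c = {d}) (hde : S.Leads d e) : S.Leads c e :=
  Relation.ReflTransGen.head ⟨hs, h⟩ hde

namespace Settles

theorem congr {r' : Prop} (h : S.Settles c r) (hr : r ↔ r') : S.Settles c r' :=
  ⟨h.halts, h.safe, h.accepts_iff.trans hr⟩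

theorem safe_self (h : S.Settles c r) : c ∈ S.safe := h.safe c .refl

theorem of_mem_step (h : S.Settles c r) (hd : d ∈ S.step c) : S.Settles d (S.Accepts d) :=
  ⟨h.halts.inv hd, fun e he => h.safe e (.head hd he), Iff.rfl⟩

theorem of_halted (hs : c ∈ S.safe) (h : S.step c = ∅) : S.Settles c (c ∈ S.accept) where
  halts := ⟨c, fun d hd => absurd hd (h ▸ Set.notMem_empty d)⟩
  safe d hd := by
    rcases Relation.ReflTransGen.cases_head hd with rfl | ⟨e, he, -⟩
    · exact hs
    · exact absurd he (h ▸ Set.notMem_empty e)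
  accepts_iff := accepts_iff_of_halted h

theorem of_step {ρ : C → Prop} (hs : c ∈ S.safe) (hne : (S.step c).Nonempty)
    (h : ∀ d ∈ S.step c, S.Settles d (ρ d)) : S.Settles c (∃ d ∈ S.step c, ρ d) where
  halts := ⟨c, fun d hd => (h d hd).halts⟩
  safe d hd := by
    rcases Relation.ReflTransGen.cases_head hd with rfl | ⟨e, he, hed⟩
    · exact hs
    · exact (h e he).safe d hed
  accepts_iff := (accepts_iff_of_nonempty hne).trans <|
    exists_congr fun d => and_congr_right fun hd => (h d hd).accepts_iff

theorem of_singleton (hs : c ∈ S.safe) (hc : S.step c = {d}) (h : S.Settles d r) :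
    S.Settles c r :=
  (of_step (ρ := fun _ => r) hs (by simp [hc]) (by simpa [hc] using h)).congr (by simp [hc])

theorem of_leads (hcd : S.Leads c d) (h : S.Settles d r) : S.Settles c r := by
  induction hcd using Relation.ReflTransGen.head_induction_on with
  | refl => exact h
  | head hstep _ ih => exact of_singleton hstep.1 hstep.2 ih

theorem of_image {O : Type*} {A : Set O} {f : O → C} {ρ : O → Prop} (hs : c ∈ S.safe)
    (hc : S.step c = f '' A) (hne : A.Nonempty) (h : ∀ o ∈ A, S.Settles (f o) (ρ o)) :
    S.Settles c (∃ o ∈ A, ρ o) := by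
  have hstep : ∀ d ∈ S.step c, S.Settles d (S.Accepts d) := by
    rw [hc]
    rintro _ ⟨o, ho, rfl⟩
    exact (h o ho).congr (h o ho).accepts_iff.symm
  refine (of_step hs (hc ▸ hne.image f) hstep).congr ?_
  rw [hc, Set.exists_mem_image]
  exact exists_congr fun o => and_congr_right fun ho => (h o ho).accepts_iff

theorem no_infinite_run (h : S.Settles c r) (run : ℕ → C) (h0 : run 0 = c) :
    ¬ ∀ i, run (i + 1) ∈ S.step (run i) := by
  subst h0
  exact fun hrun => (not_acc_iff_exists_descending_chain.2 ⟨run, rfl, hrun⟩) h.halts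

/-- The simulating system `T` may follow each of the choices in `A c` by a bounded number of
forced steps before it is again related to the simulated system. -/
theorem of_simulation {O : Type*} {R : C → D → Prop} {A : C → Set O} {f : C → O → C}
    (hstep : ∀ c, S.step c = f c '' A c)
    (haccept : ∀ c d, R c d → (d ∈ T.accept ↔ c ∈ S.accept))
    (hsafe : ∀ c d, R c d → c ∈ S.safe → d ∈ T.safe)
    (hsim : ∀ c d, R c d → c ∈ S.safe → ∃ g : O → D, T.step d = g '' A c ∧
      ∀ o ∈ A c, f c o ∈ S.safe → ∃ e, T.Leads (g o) e ∧ R (f c o) e)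
    {d : D} (hR : R c d) (h : S.Settles c r) : T.Settles d r := by
  suffices key : T.Settles d (S.Accepts c) from key.congr h.accepts_iff
  have hacc := h.halts
  induction hacc generalizing d r with
  | intro c _ ih =>
    have hs := h.safe_self
    obtain ⟨g, hg, hlead⟩ := hsim c d hR hs
    rcases (A c).eq_empty_or_nonempty with hA | hA
    · refine (of_halted (hsafe c d hR hs) (by simp [hg, hA])).congr ?_
      rw [accepts_iff_of_halted (by simp [hstep, hA]), haccept c d hR]
    · have hmem : ∀ o ∈ A c, f c o ∈ S.step c := fun o ho => hstep c ▸ ⟨o, ho, rfl⟩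
      refine (of_image (ρ := fun o => S.Accepts (f c o)) (hsafe c d hR hs) hg hA
        fun o ho => ?_).congr ?_
      · have hnext := h.of_mem_step (hmem o ho)
        obtain ⟨e, hge, he⟩ := hlead o ho hnext.safe_self
        exact of_leads hge (ih _ (hmem o ho) he hnext)
      · rw [accepts_iff_of_nonempty (hstep c ▸ hA.image _), hstep, Set.exists_mem_image]

end Settles

end TransitionSystem

/-- An abstract nondeterministic machine with finitely many control states, which in each step
obtains a view of its memory and chooses an action on it. -/
structure Machine (View : Type u) (Act : Type v) where
  State : Type
  finite_state : Finite State
  start : State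
  accept : Set State
  trans : State → View → Set (State × Act)

namespace Machine

variable {View : Type u} {Act : Type v} {Mem : Type w}

/-- At most one action is possible in any situation. -/
def IsDeterministic (M : Machine View Act) : Prop := ∀ s a, (M.trans s a).Subsingleton

/-- The computations of `M` on a memory of type `Mem`. -/
def system (M : Machine View Act) (view : Mem → View) (act : Act → Mem → Mem) (safe : Set Mem) :
    TransitionSystem (M.State × Mem) where
  step c := (fun o => (o.1, act o.2 c.2)) '' M.trans c.1 (view c.2)
  accept := {c | c.1 ∈ M.accept}
  safe := {c | c.2 ∈ safe}

end Machine

/-! ### Register machines in logarithmic space -/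

section Registers

/-- A right hand side of a register assignment: `none` is zero, and `some (k, b)` is the content of
register `k`, plus one if `b` holds. -/
abbrev Rhs (κ : Type) : Type := Option (κ × Bool)

/-- The value of a right hand side in the natural numbers. -/
def Rhs.eval {κ : Type} (m : κ → ℕ) : Rhs κ → ℕ
  | none => 0
  | some (k, b) => m k + b.toNat

/-- A machine with a two-way input head and finitely many registers for natural numbers, which in
each step sees the input symbol under the head and which registers are equal. -/
abbrev RegMachine (A : Type u) (κ : Type) : Type (max 1 u) :=
  Machine (InSym A × (κ → κ → Bool)) (Move × (κ → Rhs κ))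

namespace RegMachine

variable {A : Type u} {κ : Type}

/-- Which registers are equal. -/
def eqView (m : κ → ℕ) (i j : κ) : Bool := decide (m i = m j)

/-- The computations on input `W` with registers up to `B`, where the memory is the position of the
input head together with the register contents. -/
def regSystem (M : RegMachine A κ) (W : List A) (B : ℕ) :
    TransitionSystem (M.State × ℕ × (κ → ℕ)) :=
  M.system (fun m => (TM.readInput W m.1, eqView m.2))
    (fun a m => (min (a.1.apply m.1) (W.length + 1), fun k => (a.2 k).eval m.2))
    {m | m.1 ≤ W.length + 1 ∧ ∀ k, m.2 k ≤ B}

end RegMachine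

end Registers

section Binary

/-- The carry into bit `i` when `b` is added to `m`. -/
def carry (b : Bool) (m : ℕ) : ℕ → Bool
  | 0 => b
  | i + 1 => carry b m i && m.testBit i

theorem carry_succ_eq_carry_half (b : Bool) (m i : ℕ) :
    carry b m (i + 1) = carry (b && m.testBit 0) (m / 2) i := by
  induction i with
  | zero => rfl
  | succ i ih => rw [carry, ih, carry, Nat.testBit_add_one]

theorem add_toNat_div_two (b : Bool) (m : ℕ) :
    (m + b.toNat) / 2 = m / 2 + (b && m.testBit 0).toNat := by
  rcases Nat.mod_two_eq_zero_or_one m with h | h <;>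
    cases b <;> simp [Nat.testBit_zero, h] <;> omega

theorem testBit_add_toNat (b : Bool) (m i : ℕ) :
    (m + b.toNat).testBit i = (m.testBit i ^^ carry b m i) := by
  induction i generalizing m b with
  | zero =>
    rcases Nat.mod_two_eq_zero_or_one m with h | h <;>
      cases b <;> simp [carry, Nat.testBit_zero, Nat.add_mod, h]
  | succ i ih =>
    rw [Nat.testBit_add_one, add_toNat_div_two, ih, Nat.testBit_add_one, carry_succ_eq_carry_half]

end Binary

namespace RegMachine

section Columns

variable {κ : Type}

/-- The contents of a work tape cell that holds one bit of each register; the left end of the tape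
is marked. -/
inductive Column (κ : Type)
  | blank
  | leftEnd
  | bits (col : κ → Bool)

instance [Finite κ] : Finite (Column κ) :=
  Finite.of_surjective
    (fun x : Option (Option (κ → Bool)) => x.elim Column.blank fun y => y.elim .leftEnd .bits)
    fun
      | .blank => ⟨none, rfl⟩
      | .leftEnd => ⟨some none, rfl⟩
      | .bits col => ⟨some (some col), rfl⟩

/-- The bits written for the assignment `e` over a column; the flag of a right hand side is the
current carry. -/
def outBits (e : κ → Rhs κ) (col : κ → Bool) (k : κ) : Bool :=
  match e k with
  | none => false
  | some (j, b) => col j ^^ b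

/-- The assignment with the carries into the next column. -/
def nextCarry (e : κ → Rhs κ) (col : κ → Bool) (k : κ) : Rhs κ :=
  match e k with
  | none => none
  | some (j, b) => some (j, b && col j)

/-- The registers that have agreed so far and agree in the column. -/
def meetEq (E : κ → κ → Bool) (col : κ → Bool) (i j : κ) : Bool := E i j && (col i == col j)

/-- The column that holds bit `i` of all registers. -/
def bitColumn (m : κ → ℕ) (i : ℕ) : κ → Bool := fun k => (m k).testBit i

/-- The assignment `e` with the carries into column `i`. -/
def carriedRhs (e : κ → Rhs κ) (m : κ → ℕ) (i : ℕ) (k : κ) : Rhs κ :=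
  match e k with
  | none => none
  | some (j, b) => some (j, carry b (m j) i)

/-- Which registers agree on the first `i` bits. -/
def eqUpTo (m : κ → ℕ) (i : ℕ) (k l : κ) : Bool :=
  decide (∀ j < i, (m k).testBit j = (m l).testBit j)

/-- The tape in the middle of an update: the first `i` columns hold the new values `m'`, the
columns from `i` to `D` the old values `m`. -/
def sweepTape (m' m : κ → ℕ) (i D : ℕ) : ℕ → Column κ
  | 0 => .leftEnd
  | j + 1 => if j < i then .bits (bitColumn m' j)
    else if j < D then .bits (bitColumn m j) else .blank

variable {e : κ → Rhs κ} {m m' : κ → ℕ} {i D B : ℕ}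

theorem sweepTape_update :
    Function.update (sweepTape m' m i D) (i + 1) (.bits (bitColumn m' i)) =
      sweepTape m' m (i + 1) D := by
  funext j
  rcases j with _ | j
  · simp [sweepTape]
  · by_cases hj : j = i
    · simp [sweepTape, hj]
    · rw [Function.update_of_ne (by omega)]
      simp only [sweepTape]
      split_ifs <;> first | rfl | omega

theorem sweepTape_zero (m' m m'' : κ → ℕ) (D : ℕ) : sweepTape m' m 0 D = sweepTape m m'' D D := by
  funext j
  rcases j with _ | j
  · rfl
  · simp only [sweepTape]
    split_ifs <;> first | rfl | omega

theorem sweepTape_of_le (h : D ≤ i) : sweepTape m' m i D = sweepTape m' m' i i := by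
  funext j
  rcases j with _ | j
  · rfl
  · simp only [sweepTape]
    split_ifs <;> first | rfl | omega

theorem outBits_carriedRhs (e : κ → Rhs κ) (m : κ → ℕ) (i : ℕ) :
    outBits (carriedRhs e m i) (bitColumn m i) = bitColumn (fun k => (e k).eval m) i := by
  funext k
  simp only [outBits, carriedRhs, bitColumn]
  rcases e k with _ | ⟨j, b⟩
  · simp [Rhs.eval]
  · simp [Rhs.eval, testBit_add_toNat]

theorem nextCarry_carriedRhs (e : κ → Rhs κ) (m : κ → ℕ) (i : ℕ) :
    nextCarry (carriedRhs e m i) (bitColumn m i) = carriedRhs e m (i + 1) := by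
  funext k
  simp only [nextCarry, carriedRhs, bitColumn]
  rcases e k with _ | ⟨j, b⟩ <;> rfl

theorem carriedRhs_zero (e : κ → Rhs κ) (m : κ → ℕ) : carriedRhs e m 0 = e := by
  funext k
  simp only [carriedRhs]
  rcases e k with _ | ⟨j, b⟩ <;> rfl

theorem eqUpTo_zero (m : κ → ℕ) : eqUpTo m 0 = fun _ _ => true := by
  funext k l
  simp [eqUpTo]

theorem meetEq_eqUpTo (m : κ → ℕ) (i : ℕ) :
    meetEq (eqUpTo m i) (bitColumn m i) = eqUpTo m (i + 1) := by
  funext k l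
  rw [Bool.eq_iff_iff]
  simp only [meetEq, eqUpTo, bitColumn, Bool.and_eq_true, decide_eq_true_eq, beq_iff_eq]
  exact (Nat.forall_lt_succ_right (p := fun j => (m k).testBit j = (m l).testBit j)).symm

theorem bitColumn_eq_bot (hm : ∀ k, m k < 2 ^ D) (h : D ≤ i) : bitColumn m i = ⊥ :=
  funext fun k => Nat.testBit_eq_false_of_lt <|
    (hm k).trans_le (Nat.pow_le_pow_right (by norm_num) h)

theorem eqUpTo_eq_eqView (hm : ∀ k, m k < 2 ^ D) : eqUpTo m D = eqView m := by
  funext k l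
  rw [Bool.eq_iff_iff]
  simp only [eqUpTo, eqView, decide_eq_true_eq]
  refine ⟨fun h => Nat.eq_of_testBit_eq fun j => ?_, fun h j _ => by rw [h]⟩
  by_cases hj : j < D
  · exact h j hj
  · have hbot := bitColumn_eq_bot hm (not_lt.1 hj)
    exact (congrFun hbot k).trans (congrFun hbot l).symm

theorem lt_two_pow_of_bitColumn_eq_bot (hm : ∀ k, m k ≤ 2 ^ D) (h : bitColumn m D = ⊥) :
    ∀ k, m k < 2 ^ D := by
  refine fun k => (hm k).lt_of_ne fun heq => ?_
  have hbit := congrFun h k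
  simp [bitColumn, heq, Nat.testBit_two_pow_self] at hbit

theorem eval_le_two_pow (hm : ∀ k, m k < 2 ^ D) (a : Rhs κ) : a.eval m ≤ 2 ^ D := by
  rcases a with _ | ⟨l, b⟩
  · exact Nat.zero_le _
  · exact (Nat.add_le_add_left (Bool.toNat_le b) _).trans (hm l)

theorem le_log_of_bitColumn_ne_bot (hm : ∀ k, m k ≤ B) (h : bitColumn m i ≠ ⊥) :
    i ≤ Nat.log 2 B := by
  by_contra! hlt
  exact h <| bitColumn_eq_bot (D := Nat.log 2 B + 1)
    (fun k => (hm k).trans_lt (Nat.lt_pow_succ_log_self (by norm_num) B)) hlt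

end Columns

/-- Control states of the simulating Turing machine with one work tape: it returns to the left end,
remembering the equalities between the registers, and then updates the registers from the least to
the most significant bit. -/
inductive SweepState (Q κ : Type)
  | init
  | rewind (s : Q) (E : κ → κ → Bool)
  | update (s : Q) (e : κ → Rhs κ) (E : κ → κ → Bool)

instance {Q κ : Type} [Finite Q] [Finite κ] : Finite (SweepState Q κ) :=
  Finite.of_surjective
    (fun x : Option (Q × (κ → κ → Bool) ⊕ Q × (κ → Rhs κ) × (κ → κ → Bool)) =>
      x.elim SweepState.init
        (Sum.elim (fun y => .rewind y.1 y.2) fun y => .update y.1 y.2.1 y.2.2))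
    fun
      | .init => ⟨none, rfl⟩
      | .rewind s E => ⟨some (.inl (s, E)), rfl⟩
      | .update s e E => ⟨some (.inr (s, e, E)), rfl⟩

variable {A : Type u} {κ : Type} (M : RegMachine A κ)

open Classical in
/-- The actions of the simulating machine. -/
noncomputable def sweepTrans : SweepState M.State κ → InSym A → Column κ →
    Set (SweepState M.State κ × Move × Column κ × Move)
  | .init, _, _ => {(.rewind M.start fun _ _ => true, .stay, .leftEnd, .stay)}
  | .rewind s E, a, .leftEnd =>
    (fun o => (.update o.1 o.2.2 fun _ _ => true, o.2.1, .leftEnd, .right)) '' M.trans s (a, E)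
  | .rewind s E, _, x => {(.rewind s E, .stay, x, .left)}
  | .update s e E, _, .bits col => {(.update s (nextCarry e col) (meetEq E (outBits e col)),
      .stay, .bits (outBits e col), .right)}
  | .update s e E, _, .blank =>
    if outBits e ⊥ = ⊥ then {(.rewind s E, .stay, .blank, .left)}
    else {(.update s (nextCarry e ⊥) (meetEq E (outBits e ⊥)), .stay, .bits (outBits e ⊥), .right)}
  | .update _ _ _, _, .leftEnd => ∅

/-- The Turing machine that simulates a register machine on one work tape. -/
noncomputable def toTM [Finite κ] : TM A where
  State := SweepState M.State κ
  Sym := Column κ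
  finite_state := by
    have := M.finite_state
    infer_instance
  finite_sym := inferInstance
  tapes := 1
  blank := .blank
  start := .init
  accept := {q | ∃ s E, q = .rewind s E ∧ s ∈ M.accept}
  trans q a x := (fun o => (o.1, o.2.1, fun _ => o.2.2)) '' M.sweepTrans q a (x 0)

theorem toTM_isDeterministic [Finite κ] (h : M.IsDeterministic) : M.toTM.IsDeterministic := by
  intro q a x
  refine Set.Subsingleton.image ?_ _
  generalize x (0 : Fin 1) = y
  cases q <;> cases y <;> simp only [sweepTrans]
  case rewind.leftEnd => exact (h _ _).image _
  case update.blank => split_ifs <;> exact Set.subsingleton_singleton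
  all_goals first | exact Set.subsingleton_singleton | exact Set.subsingleton_empty

end RegMachine

/-- The computations of a Turing machine on input `W`. -/
def TM.system {A : Type u} (M : TM A) (W : List A) (safe : Set M.Cfg) :
    TransitionSystem M.Cfg where
  step c := {c' | M.Step W c c'}
  accept := {c | c.state ∈ M.accept}
  safe := safe

namespace RegMachine

open TransitionSystem

variable {A : Type u} {κ : Type} [Finite κ] (M : RegMachine A κ) (W : List A) (B : ℕ)

/-- The computations of the simulating machine, in space sufficient for registers up to `B`. -/
noncomputable def tapeSystem : TransitionSystem M.toTM.Cfg :=
  M.toTM.system W {c | ∀ j, c.head j ≤ Nat.log 2 B + 2}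

/-- A configuration of the simulating machine. -/
def tmCfg (q : SweepState M.State κ) (p : ℕ) (tape : ℕ → Column κ) (h : ℕ) : M.toTM.Cfg where
  state := q
  inPos := p
  tape _ := tape
  head _ := h

variable {q : SweepState M.State κ} {tape : ℕ → Column κ} {h : ℕ} {s : M.State}
  {E : κ → κ → Bool} {e : κ → Rhs κ} {p : ℕ} {m : κ → ℕ} {D i : ℕ} {W B}

theorem step_tmCfg :
    (M.tapeSystem W B).step (M.tmCfg q p tape h) =
      (fun o => M.tmCfg o.1 (min (o.2.1.apply p) (W.length + 1))
        (Function.update tape h o.2.2.1) (o.2.2.2.apply h)) ''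
        M.sweepTrans q (TM.readInput W p) (tape h) := by
  ext c
  constructor
  · rcases c with ⟨q', p', tape', h'⟩
    rintro ⟨_, ⟨o, ho, rfl⟩, hq, hp, htape, hh⟩
    obtain rfl : q' = _ := hq
    obtain rfl : p' = _ := hp
    obtain rfl : tape' = _ := funext htape
    obtain rfl : h' = _ := funext hh
    exact ⟨o, ho, rfl⟩
  · rintro ⟨o, ho, rfl⟩
    exact ⟨_, ⟨o, ho, rfl⟩, rfl, rfl, fun _ => rfl, fun _ => rfl⟩

theorem tmCfg_mem_safe (hh : h ≤ Nat.log 2 B + 2) :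
    M.tmCfg q p tape h ∈ (M.tapeSystem W B).safe := fun _ => hh

theorem leads_return (hD : D ≤ Nat.log 2 B + 1) (hp : p ≤ W.length + 1) (hi : i ≤ D + 1) :
    (M.tapeSystem W B).Leads (M.tmCfg (.rewind s E) p (sweepTape m m D D) i)
      (M.tmCfg (.rewind s E) p (sweepTape m m D D) 0) := by
  induction i with
  | zero => exact .refl
  | succ i ih =>
    have htrans : M.sweepTrans (.rewind s E) (TM.readInput W p) (sweepTape m m D D (i + 1)) =
        {(.rewind s E, .stay, sweepTape m m D D (i + 1), .left)} := by
      simp only [sweepTape]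
      split_ifs <;> rfl
    refine .head (M.tmCfg_mem_safe (by omega)) ?_ (ih (by omega))
    simp [step_tmCfg, htrans, Move.apply, hp]

theorem leads_push (hD : D ≤ Nat.log 2 B + 1) (hp : p ≤ W.length + 1) (hm : ∀ k, m k < 2 ^ D)
    (hi : i < D ∨ i = D ∧ bitColumn (fun k => (e k).eval m) i ≠ ⊥) :
    (M.tapeSystem W B).Leads
      (M.tmCfg (.update s (carriedRhs e m i) (eqUpTo (fun k => (e k).eval m) i)) p
        (sweepTape (fun k => (e k).eval m) m i D) (i + 1))
      (M.tmCfg (.update s (carriedRhs e m (i + 1)) (eqUpTo (fun k => (e k).eval m) (i + 1))) p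
        (sweepTape (fun k => (e k).eval m) m (i + 1) D) (i + 2)) := by
  have htrans : M.sweepTrans (.update s (carriedRhs e m i) (eqUpTo (fun k => (e k).eval m) i))
      (TM.readInput W p) (sweepTape (fun k => (e k).eval m) m i D (i + 1)) =
      {(.update s (carriedRhs e m (i + 1)) (eqUpTo (fun k => (e k).eval m) (i + 1)), .stay,
        .bits (bitColumn (fun k => (e k).eval m) i), .right)} := by
    rw [← meetEq_eqUpTo, ← nextCarry_carriedRhs, ← outBits_carriedRhs]
    rcases hi with hi | ⟨rfl, hne⟩
    · simp [sweepTape, hi, sweepTrans]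
    · rw [← outBits_carriedRhs, bitColumn_eq_bot hm le_rfl] at hne
      simp [sweepTape, sweepTrans, hne, bitColumn_eq_bot hm le_rfl]
  refine .single (M.tmCfg_mem_safe (by omega)) ?_
  simp [step_tmCfg, htrans, Move.apply, hp, sweepTape_update]

theorem leads_turn (hD : D ≤ i) (hi : i ≤ Nat.log 2 B + 1) (hp : p ≤ W.length + 1)
    (hm : ∀ k, m k < 2 ^ D) (hlt : ∀ k, (e k).eval m < 2 ^ i) :
    (M.tapeSystem W B).Leads
      (M.tmCfg (.update s (carriedRhs e m i) (eqUpTo (fun k => (e k).eval m) i)) p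
        (sweepTape (fun k => (e k).eval m) m i D) (i + 1))
      (M.tmCfg (.rewind s (eqView fun k => (e k).eval m)) p
        (sweepTape (fun k => (e k).eval m) (fun k => (e k).eval m) i i) i) := by
  have htape : sweepTape (fun k => (e k).eval m) m i D (i + 1) = .blank := by
    simp [sweepTape, hD]
  have hout : outBits (carriedRhs e m i) ⊥ = ⊥ := by
    rw [← bitColumn_eq_bot hm hD, outBits_carriedRhs, bitColumn_eq_bot hlt le_rfl,
      bitColumn_eq_bot hm hD]
  refine .single (M.tmCfg_mem_safe (by omega)) ?_
  rw [step_tmCfg, htape, sweepTrans, if_pos hout, Set.image_singleton, ← htape,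
    Function.update_eq_self, eqUpTo_eq_eqView hlt, sweepTape_of_le hD]
  simp [Move.apply, hp]

theorem leads_sweep (hD : D ≤ Nat.log 2 B + 1) (hp : p ≤ W.length + 1) (hm : ∀ k, m k < 2 ^ D)
    (hi : i ≤ D) :
    (M.tapeSystem W B).Leads
      (M.tmCfg (.update s e fun _ _ => true) p (sweepTape m m D D) 1)
      (M.tmCfg (.update s (carriedRhs e m i) (eqUpTo (fun k => (e k).eval m) i)) p
        (sweepTape (fun k => (e k).eval m) m i D) (i + 1)) := by
  induction i with
  | zero => rw [carriedRhs_zero, eqUpTo_zero, sweepTape_zero _ _ m]; exact .refl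
  | succ i ih => exact (ih (by omega)).trans (M.leads_push hD hp hm (.inl hi))

theorem leads_update (hD : D ≤ Nat.log 2 B + 1) (hp : p ≤ W.length + 1) (hm : ∀ k, m k < 2 ^ D)
    (hB : ∀ k, (e k).eval m ≤ B) :
    ∃ D' ≤ Nat.log 2 B + 1, (∀ k, (e k).eval m < 2 ^ D') ∧
      (M.tapeSystem W B).Leads
        (M.tmCfg (.update s e fun _ _ => true) p (sweepTape m m D D) 1)
        (M.tmCfg (.rewind s (eqView fun k => (e k).eval m)) p
          (sweepTape (fun k => (e k).eval m) (fun k => (e k).eval m) D' D') 0) := by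
  have hle : ∀ k, (e k).eval m ≤ 2 ^ D := fun k => eval_le_two_pow hm (e k)
  by_cases hbot : bitColumn (fun k => (e k).eval m) D = ⊥
  · have hlt := lt_two_pow_of_bitColumn_eq_bot hle hbot
    exact ⟨D, hD, hlt, (M.leads_sweep hD hp hm le_rfl).trans <|
      (M.leads_turn le_rfl hD hp hm hlt).trans (M.leads_return hD hp (by omega))⟩
  · have hlog : D + 1 ≤ Nat.log 2 B + 1 := by simpa using le_log_of_bitColumn_ne_bot hB hbot
    have hlt : ∀ k, (e k).eval m < 2 ^ (D + 1) := fun k =>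
      (hle k).trans_lt (Nat.pow_lt_pow_right (by norm_num) (by omega))
    exact ⟨D + 1, hlog, hlt, (M.leads_sweep hD hp hm le_rfl).trans <|
      (M.leads_push hD hp hm (.inr ⟨rfl, hbot⟩)).trans <|
      (M.leads_turn (by omega) hlog hp hm hlt).trans (M.leads_return hlog hp (by omega))⟩

/-- The tape configurations that represent a configuration of the register machine. -/
def Represents (M : RegMachine A κ) (B : ℕ) (c : M.State × ℕ × (κ → ℕ)) (d : M.toTM.Cfg) : Prop :=
  ∃ D ≤ Nat.log 2 B + 1, (∀ k, c.2.2 k < 2 ^ D) ∧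
    d = M.tmCfg (.rewind c.1 (eqView c.2.2)) c.2.1 (sweepTape c.2.2 c.2.2 D D) 0

theorem settles_toTM {c : M.State × ℕ × (κ → ℕ)} {d : M.toTM.Cfg} {r : Prop}
    (hR : Represents M B c d) (h : (M.regSystem W B).Settles c r) :
    (M.tapeSystem W B).Settles d r := by
  refine .of_simulation (fun _ => rfl) ?_ ?_ ?_ hR h
  · rintro c _ ⟨D, -, -, rfl⟩
    refine ⟨?_, fun hc => ⟨_, _, rfl, hc⟩⟩
    rintro ⟨s, E, hE, hs⟩
    cases hE
    exact hs
  · rintro c _ ⟨D, -, -, rfl⟩ -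
    exact M.tmCfg_mem_safe (Nat.zero_le _)
  · rintro ⟨s, p, m⟩ _ ⟨D, hD, hm, rfl⟩ -
    refine ⟨fun o => M.tmCfg (.update o.1 o.2.2 fun _ _ => true)
      (min (o.2.1.apply p) (W.length + 1)) (sweepTape m m D D) 1, ?_, fun o _ hsafe => ?_⟩
    · rw [step_tmCfg, show sweepTape m m D D 0 = .leftEnd from rfl, sweepTrans, Set.image_image]
      simp only [show Column.leftEnd = sweepTape m m D D 0 from rfl, Function.update_eq_self]
      rfl
    · obtain ⟨D', hD', hlt, hlead⟩ :=
        M.leads_update (W := W) (s := o.1) hD (min_le_right (o.2.1.apply p) _) hm hsafe.2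
      exact ⟨_, hlead, D', hD', hlt, rfl⟩

theorem settles_toTM_init {r : Prop}
    (h : (M.regSystem W B).Settles (M.start, 0, fun _ => 0) r) :
    (M.tapeSystem W B).Settles M.toTM.init r := by
  have hzero : sweepTape (fun _ : κ => 0) (fun _ => 0) 0 0 =
      Function.update (fun _ => .blank) 0 .leftEnd := by
    funext j
    rcases j with _ | j <;> simp [sweepTape]
  have hinit : M.toTM.init = M.tmCfg .init 0 (fun _ => .blank) 0 := rfl
  rw [hinit]
  refine .of_singleton (M.tmCfg_mem_safe (Nat.zero_le _)) ?_
    (M.settles_toTM ⟨0, Nat.zero_le _, fun _ => by simp, rfl⟩ h)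
  simp only [step_tmCfg, sweepTrans, Set.image_singleton, ← hzero]
  simp only [Move.apply, Nat.zero_le, min_eq_left]
  rfl

theorem log_add_two_le (n : ℕ) : Nat.log 2 (n + 2) ≤ Nat.log 2 n + 2 := by
  have hlog : n < 2 ^ (Nat.log 2 n + 1) := Nat.lt_pow_succ_log_self (by norm_num) n
  have hpow : 2 ^ (Nat.log 2 n + 2) = 2 ^ (Nat.log 2 n + 1) * 2 := pow_succ 2 _
  exact Nat.lt_succ_iff.1 (Nat.log_lt_of_lt_pow (by omega) (by omega))

theorem toTM_decides (K : _root_.Language A)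
    (h : ∀ W : List A,
      (M.regSystem W (W.length + 2)).Settles (M.start, 0, fun _ => 0) (W ∈ K)) :
    M.toTM.IsLogSpace ∧ M.toTM.Decides K := by
  have hsettles := fun W => M.settles_toTM_init (h W)
  refine ⟨⟨6, fun W c hc j => ?_⟩, fun W => ⟨?_, ?_⟩⟩
  · have hhead : c.head j ≤ Nat.log 2 (W.length + 2) + 2 := (hsettles W).safe c hc j
    have hlog := log_add_two_le W.length
    omega
  · rintro ⟨run, h0, hrun⟩
    exact (hsettles W).no_infinite_run run h0 hrun
  · rw [← (hsettles W).accepts_iff]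
    exact exists_congr fun c => and_congr_right fun _ => and_congr_left fun _ =>
      Set.eq_empty_iff_forall_notMem.symm

end RegMachine

/-! ### Pointers into the input -/

section Pointers

/-- The value of a right hand side in `Fin (N + 1)`, where the successor of the last element
is `0`. -/
def Rhs.cyc {ι : Type} {N : ℕ} (m : ι → Fin (N + 1)) : Rhs ι → Fin (N + 1)
  | none => 0
  | some (k, b) => if b then m k + 1 else m k

/-- What a machine sees of registers that point to cells of a cyclic input: the symbols in these
cells, which pointers are equal, which ones are adjacent, and which ones point to the last cell. -/
structure PtrView (Γ ι : Type) where
  sym : ι → Γ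
  eq : ι → ι → Bool
  adj : ι → ι → Bool
  top : ι → Bool

open Classical in
/-- The view of the pointers `m` into the cells `0, …, n` of an input word of length `n`. -/
noncomputable def ptrView {Γ ι : Type} (W : List Γ) (m : ι → Fin (W.length + 1)) :
    PtrView (InSym Γ) ι where
  sym i := TM.readInput W (m i)
  eq i j := decide (m i = m j)
  adj i j := decide (m j = m i + 1)
  top i := decide (m i = Fin.last W.length)

/-- A machine whose memory consists of finitely many pointers into a cyclic input, where the mark
of the left end counts as an input cell. -/
abbrev PtrMachine (Γ ι : Type) : Type 1 := Machine (PtrView (InSym Γ) ι) (ι → Rhs ι)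

/-- The computations on input `W`. -/
noncomputable def PtrMachine.ptrSystem {Γ ι : Type} (P : PtrMachine Γ ι) (W : List Γ) :
    TransitionSystem (P.State × (ι → Fin (W.length + 1))) :=
  P.system (ptrView W) (fun e m k => (e k).cyc m) Set.univ

end Pointers

section InputSymbols

variable {A : Type u} {B : Type v}

theorem readInput_eq_leftEnd_iff (W : List A) (i : ℕ) :
    TM.readInput W i = .leftEnd ↔ i = 0 := by
  rcases i with _ | i
  · simp [TM.readInput]
  · simp only [TM.readInput]
    rcases W[i]? with _ | a <;> simp

theorem readInput_eq_rightEnd_iff (W : List A) (i : ℕ) :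
    TM.readInput W i = .rightEnd ↔ W.length < i := by
  rcases i with _ | i
  · simp [TM.readInput]
  · rw [Nat.lt_succ_iff, ← List.getElem?_eq_none_iff]
    simp only [TM.readInput]
    rcases W[i]? with _ | a <;> simp

instance [Finite A] : Finite (InSym A) :=
  Finite.of_surjective
    (fun x : Option (Option A) => x.elim InSym.leftEnd fun y => y.elim .rightEnd .letter)
    fun
      | .leftEnd => ⟨none, rfl⟩
      | .rightEnd => ⟨some none, rfl⟩
      | .letter a => ⟨some (some a), rfl⟩

/-- The input symbols for a recoding of the letters. -/
def InSym.map (f : A → B) : InSym A → InSym B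
  | .leftEnd => .leftEnd
  | .letter a => .letter (f a)
  | .rightEnd => .rightEnd

theorem map_readInput (f : A → B) (W : List A) (i : ℕ) :
    (TM.readInput W i).map f = TM.readInput (W.map f) i := by
  rcases i with _ | i
  · rfl
  · simp only [TM.readInput, List.getElem?_map]
    rcases W[i]? with _ | a <;> rfl

/-- The machine that replaces every input letter `a` by `f a`. -/
def RegMachine.comap {κ : Type} (f : A → B) (M : RegMachine B κ) : RegMachine A κ where
  State := M.State
  finite_state := M.finite_state
  start := M.start
  accept := M.accept
  trans s x := M.trans s (x.1.map f, x.2)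

theorem RegMachine.regSystem_comap {κ : Type} (f : A → B) (M : RegMachine B κ) (W : List A)
    (n : ℕ) : (M.comap f).regSystem W n = M.regSystem (W.map f) n := by
  simp only [regSystem, Machine.system, comap, map_readInput, List.length_map]
  rfl

end InputSymbols

namespace PtrMachine

section Scanning

/-- Registers of the simulating machine: `ptr i b` holds the pointer `i`, plus one if `b` holds,
`pos` a copy of the position of the input head, `bound` the number of input cells, and `one` the
number one. -/
inductive ScanReg (ι : Type)
  | ptr (i : ι) (b : Bool)
  | pos
  | bound
  | one

instance {ι : Type} [Finite ι] : Finite (ScanReg ι) :=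
  Finite.of_surjective
    (fun x : (ι × Bool) ⊕ Fin 3 => x.elim (fun y => .ptr y.1 y.2) ![.pos, .bound, .one])
    fun
      | .ptr i b => ⟨.inl (i, b), rfl⟩
      | .pos => ⟨.inr 0, rfl⟩
      | .bound => ⟨.inr 1, rfl⟩
      | .one => ⟨.inr 2, rfl⟩

/-- States of the simulating machine: the input is measured, then for each simulated step the input
head returns to the left end and scans the input in order to find the symbols in the cells to which
the pointers point. -/
inductive ScanState (Q Γ ι : Type)
  | init
  | measure
  | rewind (s : Q)
  | scan (s : Q) (f : ι → InSym Γ)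

instance {Q Γ ι : Type} [Finite Q] [Finite Γ] [Finite ι] : Finite (ScanState Q Γ ι) :=
  Finite.of_surjective
    (fun x : Bool ⊕ Q ⊕ Q × (ι → InSym Γ) => x.elim (fun b => bif b then .init else .measure)
      (Sum.elim .rewind fun y => .scan y.1 y.2))
    fun
      | .init => ⟨.inl true, rfl⟩
      | .measure => ⟨.inl false, rfl⟩
      | .rewind s => ⟨.inr (.inl s), rfl⟩
      | .scan s f => ⟨.inr (.inr (s, f)), rfl⟩

variable {Γ ι : Type}

/-- The assignment that changes nothing. -/
def keep (k : ScanReg ι) : Rhs (ScanReg ι) := some (k, false)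

/-- The assignment that sets all pointers to `0` at the beginning. -/
def initAssign : ScanReg ι → Rhs (ScanReg ι)
  | .ptr _ b => some (.pos, b)
  | .pos => none
  | .bound => some (.pos, true)
  | .one => some (.pos, true)

/-- The assignment that increments `bound`. -/
def countCell : ScanReg ι → Rhs (ScanReg ι)
  | .bound => some (.bound, true)
  | k => keep k

/-- The assignment that increments `pos`. -/
def countPos : ScanReg ι → Rhs (ScanReg ι)
  | .pos => some (.pos, true)
  | k => keep k

/-- The assignment that resets `pos`. -/
def resetPos : ScanReg ι → Rhs (ScanReg ι)
  | .pos => none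
  | k => keep k

/-- The assignment that simulates the assignment `e`. -/
def liftAssign (E : ScanReg ι → ScanReg ι → Bool) (e : ι → Rhs ι) :
    ScanReg ι → Rhs (ScanReg ι)
  | .ptr i b =>
    match e i with
    | none => if b then some (.one, false) else none
    | some (j, false) => some (.ptr j b, false)
    | some (j, true) =>
      if E (.ptr j true) .bound then (if b then some (.one, false) else none)
      else some (.ptr j true, b)
  | k => keep k

/-- The view computed from the scanned symbols and the equality of registers. -/
def liftView (f : ι → InSym Γ) (E : ScanReg ι → ScanReg ι → Bool) : PtrView (InSym Γ) ι where
  sym := f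
  eq i j := E (.ptr i false) (.ptr j false)
  adj i j := if E (.ptr i true) .bound then E (.ptr j true) .one
    else E (.ptr i true) (.ptr j false)
  top i := E (.ptr i true) .bound

/-- The registers of the simulating machine for the pointers `m` and the head position `p`. -/
def encode {N : ℕ} (m : ι → Fin (N + 1)) (p : ℕ) : ScanReg ι → ℕ
  | .ptr i b => m i + b.toNat
  | .pos => p
  | .bound => N + 1
  | .one => 1

/-- The registers of the simulating machine when `t` input cells have been measured. -/
def measured (t : ℕ) : ScanReg ι → ℕ
  | .ptr _ b => b.toNat
  | .pos => 0
  | .bound => t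
  | .one => 1

/-- The symbols under those pointers that point to cells before cell `i`. -/
def scanned (W : List Γ) (m : ι → Fin (W.length + 1)) (i : ℕ) (k : ι) : InSym Γ :=
  if m k < i then TM.readInput W (m k) else .leftEnd

open RegMachine (eqView)

variable {N : ℕ}

theorem eval_keep (m : ScanReg ι → ℕ) : (fun k => (keep k).eval m) = m := by
  funext k
  simp [keep, Rhs.eval]

theorem eval_initAssign : (fun k => (initAssign k).eval fun _ => 0) = measured (ι := ι) 1 := by
  funext k
  cases k <;> simp [initAssign, Rhs.eval, measured]

theorem eval_countCell (t : ℕ) :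
    (fun k => (countCell k).eval (measured t)) = measured (ι := ι) (t + 1) := by
  funext k
  cases k <;> simp [countCell, keep, Rhs.eval, measured]

theorem measured_eq_encode : measured (ι := ι) (N + 1) = encode (N := N) 0 0 := by
  funext k
  cases k <;> simp [measured, encode]

theorem eval_countPos (m : ι → Fin (N + 1)) (p : ℕ) :
    (fun k => (countPos k).eval (encode m p)) = encode m (p + 1) := by
  funext k
  cases k <;> simp [countPos, keep, Rhs.eval, encode]

theorem eval_resetPos (m : ι → Fin (N + 1)) (p : ℕ) :
    (fun k => (resetPos k).eval (encode m p)) = encode m 0 := by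
  funext k
  cases k <;> simp [resetPos, keep, Rhs.eval, encode]

theorem eqView_encode_bound (m : ι → Fin (N + 1)) (p : ℕ) (i : ι) :
    eqView (encode m p) (.ptr i true) .bound = true ↔ m i = Fin.last N := by
  simp [eqView, encode, Fin.ext_iff]

theorem eval_liftAssign (m : ι → Fin (N + 1)) (p : ℕ) (e : ι → Rhs ι) :
    (fun k => (liftAssign (eqView (encode m p)) e k).eval (encode m p)) =
      encode (fun i => (e i).cyc m) p := by
  funext k
  cases k with
  | ptr i b =>
    simp only [liftAssign]
    rcases he : e i with _ | ⟨j, _ | _⟩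
    · cases b <;> simp [Rhs.eval, encode, Rhs.cyc, he]
    · simp [Rhs.eval, encode, Rhs.cyc, he]
    · simp only [eqView_encode_bound]
      by_cases hl : m j = Fin.last N
      · cases b <;> simp [Rhs.eval, encode, Rhs.cyc, he, hl]
      · simp [Rhs.eval, encode, Rhs.cyc, he, hl, Fin.val_add_one]
  | _ => simp [liftAssign, keep, Rhs.eval, encode]

theorem liftView_encode {W : List Γ} (m : ι → Fin (W.length + 1)) (p : ℕ) :
    liftView (fun i => TM.readInput W (m i)) (eqView (encode m p)) = ptrView W m := by
  simp only [liftView, ptrView, PtrView.mk.injEq, true_and]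
  refine ⟨?_, ?_, ?_⟩
  · funext i j
    simp [eqView, encode, Fin.ext_iff]
  · funext i j
    rw [Bool.eq_iff_iff]
    simp only [eqView_encode_bound]
    by_cases hl : m i = Fin.last W.length
    · simp only [hl, if_true, decide_eq_true_eq, Fin.last_add_one]
      simp [eqView, encode]
    · simp [eqView, encode, Fin.ext_iff, hl, Fin.val_add_one, eq_comm]
  · funext i
    rw [Bool.eq_iff_iff, eqView_encode_bound, decide_eq_true_eq]

theorem encode_le {m : ι → Fin (N + 1)} {p : ℕ} (hp : p ≤ N + 1) (k : ScanReg ι) :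
    encode m p k ≤ N + 2 := by
  cases k with
  | ptr i b =>
    have := (m i).isLt
    have := b.toNat_le
    simp only [encode]
    omega
  | _ => simp only [encode]; omega

theorem measured_le {t : ℕ} (ht : t ≤ N + 1) (k : ScanReg ι) :
    measured t k ≤ N + 2 := by
  cases k with
  | ptr i b =>
    have := b.toNat_le
    simp only [measured]
    omega
  | _ => simp only [measured]; omega

theorem scanned_succ {W : List Γ} (m : ι → Fin (W.length + 1)) (i : ℕ) :
    (fun k => if eqView (encode m i) (.ptr k false) .pos then TM.readInput W i
      else scanned W m i k) = scanned W m (i + 1) := by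
  funext k
  by_cases hk : (m k : ℕ) = i
  · simp [eqView, encode, scanned, hk]
  · have hlt : (m k : ℕ) < i ↔ (m k : ℕ) < i + 1 := by omega
    simp [eqView, encode, scanned, hk, hlt]

theorem scanned_top {W : List Γ} (m : ι → Fin (W.length + 1)) :
    scanned W m (W.length + 1) = fun k => TM.readInput W (m k) := by
  funext k
  exact if_pos (m k).isLt

end Scanning

variable {Γ ι : Type} (P : PtrMachine Γ ι)

open Classical in
/-- The actions of the simulating machine. -/
noncomputable def scanTrans : ScanState P.State Γ ι → InSym Γ → (ScanReg ι → ScanReg ι → Bool) →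
    Set (ScanState P.State Γ ι × Move × (ScanReg ι → Rhs (ScanReg ι)))
  | .init, _, _ => {(.measure, .right, initAssign)}
  | .measure, a, _ =>
    if a = .rightEnd then {(.rewind P.start, .stay, keep)} else {(.measure, .right, countCell)}
  | .rewind s, a, _ =>
    if a = .leftEnd then {(.scan s fun _ => .leftEnd, .stay, resetPos)}
    else {(.rewind s, .left, keep)}
  | .scan s f, a, E =>
    if a = .rightEnd then
      (fun o => (.rewind o.1, .stay, liftAssign E o.2)) '' P.trans s (liftView f E)
    else {(.scan s fun i => if E (.ptr i false) .pos then a else f i, .right, countPos)}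

/-- The register machine that simulates a machine with pointers into the input. -/
noncomputable def toRegMachine [Finite ι] [Finite Γ] : RegMachine Γ (ScanReg ι) where
  State := ScanState P.State Γ ι
  finite_state := by
    have := P.finite_state
    infer_instance
  start := .init
  accept := {q | ∃ s f, q = .scan s f ∧ s ∈ P.accept}
  trans q x := P.scanTrans q x.1 x.2

variable [Finite ι] [Finite Γ]

theorem toRegMachine_isDeterministic (h : P.IsDeterministic) :
    P.toRegMachine.IsDeterministic := by
  rintro q ⟨a, E⟩
  simp only [toRegMachine]
  cases q with
  | init => exact Set.subsingleton_singleton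
  | measure | rewind s =>
    simp only [scanTrans]
    split_ifs <;> exact Set.subsingleton_singleton
  | scan s f =>
    simp only [scanTrans]
    split_ifs
    exacts [(h _ _).image _, Set.subsingleton_singleton]

open TransitionSystem RegMachine

variable (W : List Γ)

/-- The computations of the simulating machine. -/
noncomputable abbrev scanSystem :
    TransitionSystem (ScanState P.State Γ ι × ℕ × (ScanReg ι → ℕ)) :=
  P.toRegMachine.regSystem W (W.length + 2)

variable {P W} {s : P.State} {m : ι → Fin (W.length + 1)} {p p' : ℕ}

theorem mem_safe {q : ScanState P.State Γ ι} {reg : ScanReg ι → ℕ} (hp : p ≤ W.length + 1)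
    (hreg : ∀ k, reg k ≤ W.length + 2) : (q, p, reg) ∈ (P.scanSystem W).safe :=
  ⟨hp, hreg⟩

theorem step_scanSystem {q : ScanState P.State Γ ι} {reg : ScanReg ι → ℕ} :
    (P.scanSystem W).step (q, p, reg) =
      (fun o => (o.1, min (o.2.1.apply p) (W.length + 1), fun k => (o.2.2 k).eval reg)) ''
        P.scanTrans q (TM.readInput W p) (eqView reg) :=
  rfl

theorem leads_scan (hp : p ≤ W.length + 1) :
    (P.scanSystem W).Leads (.scan s fun _ => .leftEnd, 0, encode m 0)
      (.scan s (scanned W m p), p, encode m p) := by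
  induction p with
  | zero => exact .refl
  | succ p ih =>
    refine (ih (by omega)).trans (Leads.single (mem_safe (by omega) (encode_le (by omega))) ?_)
    have hread : TM.readInput W p ≠ .rightEnd := by
      rw [Ne, readInput_eq_rightEnd_iff]
      omega
    simp [step_scanSystem, scanTrans, hread, scanned_succ, eval_countPos, Move.apply,
      show p ≤ W.length by omega]

theorem leads_rewind (hp : p ≤ W.length + 1) (hp' : p' ≤ W.length + 1) :
    (P.scanSystem W).Leads (.rewind s, p, encode m p')
      (.scan s fun i => TM.readInput W (m i), W.length + 1, encode m (W.length + 1)) := by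
  induction p with
  | zero =>
    refine .head (mem_safe hp (encode_le hp')) ?_ (scanned_top m ▸ leads_scan le_rfl)
    have hread := (readInput_eq_leftEnd_iff W 0).2 rfl
    simp [step_scanSystem, scanTrans, hread, eval_resetPos, Move.apply]
  | succ p ih =>
    refine .head (mem_safe hp (encode_le hp')) ?_ (ih (by omega))
    have hread : TM.readInput W (p + 1) ≠ .leftEnd := by
      simp [readInput_eq_leftEnd_iff]
    simp [step_scanSystem, scanTrans, hread, eval_keep, Move.apply,
      show p ≤ W.length + 1 by omega]

theorem leads_measure (hp : p ≤ W.length) :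
    (P.scanSystem W).Leads (.init, 0, fun _ => 0) (.measure, p + 1, measured (p + 1)) := by
  induction p with
  | zero =>
    refine .single (mem_safe (Nat.zero_le _) fun _ => Nat.zero_le _) ?_
    simp [step_scanSystem, scanTrans, eval_initAssign, Move.apply]
  | succ p ih =>
    refine (ih (by omega)).trans (Leads.single (mem_safe (by omega) (measured_le (by omega))) ?_)
    have hread : TM.readInput W (p + 1) ≠ .rightEnd := by
      rw [Ne, readInput_eq_rightEnd_iff]
      omega
    simp [step_scanSystem, scanTrans, hread, eval_countCell, Move.apply,
      show p < W.length by omega]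

theorem leads_init :
    (P.scanSystem W).Leads (.init, 0, fun _ => 0) (.scan P.start fun _ => .leftEnd,
      W.length + 1, encode (N := W.length) (fun _ : ι => 0) (W.length + 1)) := by
  have hread := (readInput_eq_rightEnd_iff W (W.length + 1)).2 (Nat.lt_succ_self _)
  have hstep : (P.scanSystem W).step (.measure, W.length + 1, measured (W.length + 1)) =
      {(.rewind P.start, W.length + 1, encode (N := W.length) 0 0)} := by
    simp [step_scanSystem, scanTrans, hread, eval_keep, Move.apply, measured_eq_encode]
  exact (leads_measure le_rfl).trans <| Leads.head (mem_safe le_rfl (measured_le le_rfl)) hstep <|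
    leads_rewind le_rfl (Nat.zero_le _)

theorem settles_toRegMachine {c : P.State × (ι → Fin (W.length + 1))} {r : Prop}
    (h : (P.ptrSystem W).Settles c r) :
    (P.scanSystem W).Settles (.scan c.1 fun i => TM.readInput W (c.2 i), W.length + 1,
      encode c.2 (W.length + 1)) r := by
  have hread := (readInput_eq_rightEnd_iff W (W.length + 1)).2 (Nat.lt_succ_self _)
  refine .of_simulation (R := fun c d => d = (.scan c.1 fun i => TM.readInput W (c.2 i),
    W.length + 1, encode c.2 (W.length + 1))) (fun _ => rfl) ?_ ?_ ?_ rfl h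
  · rintro c _ rfl
    refine ⟨?_, fun hc => ⟨_, _, rfl, hc⟩⟩
    rintro ⟨s, f, hq, hs⟩
    cases hq
    exact hs
  · rintro c _ rfl -
    exact mem_safe le_rfl (encode_le le_rfl)
  · rintro ⟨s, m⟩ _ rfl -
    refine ⟨fun o => (.rewind o.1, W.length + 1, encode (fun i => (o.2 i).cyc m) (W.length + 1)),
      ?_, fun o _ _ => ⟨_, leads_rewind le_rfl le_rfl, rfl⟩⟩
    simp [step_scanSystem, scanTrans, hread, liftView_encode, Set.image_image, eval_liftAssign,
      Move.apply]

theorem mem_nlogspace {A : Type u} (P : PtrMachine Γ ι) (code : A → Γ) (K : _root_.Language A)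
    (h : ∀ W : List A, (P.ptrSystem (W.map code)).Settles (P.start, fun _ => 0) (W ∈ K)) :
    K ∈ NLogspace A ∧ (P.IsDeterministic → K ∈ Logspace A) := by
  have key := (P.toRegMachine.comap code).toTM_decides K fun W => by
    rw [RegMachine.regSystem_comap, ← List.length_map (as := W) code]
    exact .of_leads leads_init (settles_toRegMachine (h W))
  exact ⟨⟨_, key⟩, fun hP => ⟨_, RegMachine.toTM_isDeterministic _ fun s x =>
    P.toRegMachine_isDeterministic hP s _, key⟩⟩

end PtrMachine

/-! ### Graphs on tuples of pointers -/

section Odometer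

/-- An identification of `T` with some `Fin (top + 1)` under which `next` is the cyclic successor
and `IsLast` singles out the last element. -/
structure CyclicEnum (T : Type) (zero : T) (next : T → T) (IsLast : T → Prop) where
  top : ℕ
  equiv : T ≃ Fin (top + 1)
  map_zero : equiv zero = 0
  map_next : ∀ t, equiv (next t) = equiv t + 1
  eq_last_iff : ∀ t, equiv t = Fin.last top ↔ IsLast t

open Classical in
/-- The successor of a number with one more digit `x.2`, the most significant one. -/
noncomputable def carryNext {T : Type} (next : T → T) (IsLast : T → Prop) {b : ℕ}
    (x : T × Fin (b + 1)) : T × Fin (b + 1) :=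
  (next x.1, if IsLast x.1 then x.2 + 1 else x.2)

open Classical in
/-- The successor of the number with digits `d`, the least significant one being `d 0`. -/
noncomputable def digitsNext {n N : ℕ} (d : Fin N → Fin (n + 1)) (p : Fin N) : Fin (n + 1) :=
  if ∀ q < p, d q = Fin.last n then d p + 1 else d p

namespace CyclicEnum

variable {T : Type} {zero : T} {next : T → T} {IsLast : T → Prop}

theorem symm_zero (E : CyclicEnum T zero next IsLast) : E.equiv.symm 0 = zero :=
  E.equiv.symm_apply_eq.2 E.map_zero.symm

theorem symm_add_one (E : CyclicEnum T zero next IsLast) (i : Fin (E.top + 1)) :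
    E.equiv.symm (i + 1) = next (E.equiv.symm i) := by
  rw [Equiv.symm_apply_eq, E.map_next, E.equiv.apply_symm_apply]

theorem eq_last_symm_iff (E : CyclicEnum T zero next IsLast) (i : Fin (E.top + 1)) :
    i = Fin.last E.top ↔ IsLast (E.equiv.symm i) := by
  rw [← E.eq_last_iff, E.equiv.apply_symm_apply]

theorem add_mul_eq_iff {M b x y : ℕ} (hx : x ≤ M) (hy : y ≤ b) :
    x + (M + 1) * y = (b + 1) * M + b ↔ x = M ∧ y = b := by
  constructor
  · intro h
    obtain rfl : y = b := by
      by_contra hne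
      have hmul : (M + 1) * (y + 1) ≤ (M + 1) * b := Nat.mul_le_mul_left _ (by omega)
      linarith
    exact ⟨by linarith, rfl⟩
  · rintro ⟨rfl, rfl⟩
    ring

/-- The enumeration of pairs, where the first component is less significant. -/
noncomputable def prod (E : CyclicEnum T zero next IsLast) (b : ℕ) :
    CyclicEnum (T × Fin (b + 1)) (zero, 0) (carryNext next IsLast)
      fun x => IsLast x.1 ∧ x.2 = Fin.last b :=
  have hcard : (b + 1) * (E.top + 1) = ((b + 1) * E.top + b) + 1 := by ring
  let e : T × Fin (b + 1) ≃ Fin (((b + 1) * E.top + b) + 1) :=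
    (((E.equiv.prodCongr (Equiv.refl _)).trans (Equiv.prodComm _ _)).trans finProdFinEquiv).trans
      (finCongr hcard)
  have hval : ∀ x, (e x : ℕ) = E.equiv x.1 + (E.top + 1) * x.2 := fun x => by simp [e]
  have hlast : ∀ x, e x = Fin.last _ ↔ IsLast x.1 ∧ x.2 = Fin.last b := fun x => by
    rw [← E.eq_last_iff, Fin.ext_iff, hval, Fin.val_last,
      add_mul_eq_iff (Fin.is_le _) (Fin.is_le _), Fin.ext_iff, Fin.ext_iff]
    rfl
  { top := (b + 1) * E.top + b
    equiv := e
    map_zero := by simp [Fin.ext_iff, hval, E.map_zero]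
    map_next := fun x => by
      classical
      rw [Fin.ext_iff, Fin.val_add_one, hval, carryNext, E.map_next, Fin.val_add_one]
      simp only [hlast, hval, E.eq_last_iff]
      by_cases hx : IsLast x.1
      · have htop := congrArg Fin.val ((E.eq_last_iff x.1).2 hx)
        by_cases hb : x.2 = Fin.last b
        · simp [hx, hb]
        · simp only [hx, hb, if_true, and_false, if_false, Fin.val_add_one, htop, Fin.val_last]
          ring
      · simp only [hx, if_false, false_and]
        ring
    eq_last_iff := hlast }

/-- The enumeration of tuples of digits. -/
noncomputable def digits (n : ℕ) : (N : ℕ) →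
    CyclicEnum (Fin N → Fin (n + 1)) (fun _ => 0) digitsNext fun d => ∀ p, d p = Fin.last n
  | 0 =>
    { top := 0
      equiv := Equiv.ofUnique (Fin 0 → Fin (n + 1)) (Fin 1)
      map_zero := rfl
      map_next := fun _ => rfl
      eq_last_iff := fun _ => ⟨fun _ p => p.elim0, fun _ => rfl⟩ }
  | N + 1 =>
    let E := (digits n N).prod n
    let split : (Fin (N + 1) → Fin (n + 1)) ≃ (Fin N → Fin (n + 1)) × Fin (n + 1) :=
      ((Fin.snocEquiv fun _ => Fin (n + 1)).symm).trans (Equiv.prodComm _ _)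
    have hsplit : ∀ d, split d = (fun p => d p.castSucc, d (Fin.last N)) := fun _ => rfl
    { top := E.top
      equiv := split.trans E.equiv
      map_zero := E.map_zero
      map_next := fun d => by
        rw [Equiv.trans_apply split, Equiv.trans_apply split, ← E.map_next, hsplit, hsplit,
          carryNext]
        simp only [digitsNext, Fin.forall_fin_succ', Fin.castSucc_lt_castSucc_iff,
          Fin.castSucc_lt_last, lt_irrefl, (Fin.castSucc_lt_last _).not_gt, false_imp_iff,
          true_imp_iff, and_true]
        rfl
      eq_last_iff := fun d => by
        rw [Equiv.trans_apply split, E.eq_last_iff, hsplit, Fin.forall_fin_succ'] }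

/-- The enumeration of tuples of digits with a label. -/
noncomputable def vertices (n N f : ℕ) :
    CyclicEnum ((Fin N → Fin (n + 1)) × Fin (f + 1)) (fun _ => 0, 0)
      (carryNext digitsNext fun d => ∀ p, d p = Fin.last n)
      fun v => (∀ p, v.1 p = Fin.last n) ∧ v.2 = Fin.last f :=
  (digits n N).prod f

end CyclicEnum

end Odometer

section Graphs

/-- What a machine sees of registers that hold vertices of a graph: which ones are equal, joined by
an edge, or equal to the last vertex. -/
structure GraphView (ρ : Type) where
  eq : ρ → ρ → Bool
  edge : ρ → ρ → Bool
  last : ρ → Bool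

open Classical in
/-- The view of the vertices `m` of a graph on `0, …, M`. -/
noncomputable def graphView {ρ : Type} {M : ℕ} (E : Fin (M + 1) → Fin (M + 1) → Prop)
    (m : ρ → Fin (M + 1)) : GraphView ρ where
  eq i j := decide (m i = m j)
  edge i j := decide (E (m i) (m j))
  last i := decide (m i = Fin.last M)

/-- A machine whose memory consists of finitely many vertices of a graph. -/
abbrev GraphMachine (ρ : Type) : Type 1 := Machine (GraphView ρ) (ρ → Rhs ρ)

/-- The computations on the graph `E`. -/
noncomputable def GraphMachine.graphSystem {ρ : Type} (P : GraphMachine ρ) {M : ℕ}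
    (E : Fin (M + 1) → Fin (M + 1) → Prop) : TransitionSystem (P.State × (ρ → Fin (M + 1))) :=
  P.system (graphView E) (fun e m k => (e k).cyc m) Set.univ

/-- The view of some of the pointers. -/
def PtrView.comap {Γ ι ι' : Type} (g : ι' → ι) (v : PtrView Γ ι) : PtrView Γ ι' where
  sym i := v.sym (g i)
  eq i j := v.eq (g i) (g j)
  adj i j := v.adj (g i) (g j)
  top i := v.top (g i)

theorem ptrView_eq_iff {Γ ι : Type} {W : List Γ} {m : ι → Fin (W.length + 1)} {i j : ι} :
    (ptrView W m).eq i j = true ↔ m i = m j :=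
  decide_eq_true_iff

theorem ptrView_top_iff {Γ ι : Type} {W : List Γ} {m : ι → Fin (W.length + 1)} {i : ι} :
    (ptrView W m).top i = true ↔ m i = Fin.last W.length :=
  decide_eq_true_iff

theorem comap_ptrView {Γ ι ι' : Type} (g : ι' → ι) (W : List Γ) (m : ι → Fin (W.length + 1)) :
    (ptrView W m).comap g = ptrView W (m ∘ g) :=
  rfl

/-- The edges of the graph with vertices `(d, x)`, where `d` is a tuple of pointers to the input
`W` and `x` a label, that are determined by the predicate `e` on labels and views. -/
def ViewEdge {Γ : Type} {N f : ℕ}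
    (e : Fin (f + 1) → Fin (f + 1) → PtrView (InSym Γ) (Bool × Fin N) → Prop) (W : List Γ)
    (u v : (Fin N → Fin (W.length + 1)) × Fin (f + 1)) : Prop :=
  e u.2 v.2 (ptrView W fun i => if i.1 then v.1 i.2 else u.1 i.2)

end Graphs

namespace GraphMachine

variable {ρ Γ : Type} {N f : ℕ}

section Tuples

variable (e : Fin (f + 1) → Fin (f + 1) → PtrView (InSym Γ) (Bool × Fin N) → Prop)

open Classical in
/-- The view of the vertices from the labels and the view of the pointers. -/
noncomputable def tupleView (x : ρ → Fin (f + 1)) (v : PtrView (InSym Γ) (ρ × Fin N)) :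
    GraphView ρ where
  eq a b := decide ((∀ p, v.eq (a, p) (b, p)) ∧ x a = x b)
  edge a b := decide (e (x a) (x b) (v.comap fun i => (if i.1 then b else a, i.2)))
  last a := decide ((∀ p, v.top (a, p)) ∧ x a = Fin.last f)

open Classical in
/-- The assignments of pointers that perform an assignment of vertices. -/
noncomputable def tupleAssign (v : PtrView (InSym Γ) (ρ × Fin N)) (a : ρ → Rhs ρ)
    (i : ρ × Fin N) : Rhs (ρ × Fin N) :=
  match a i.1 with
  | none => none
  | some (b, false) => some ((b, i.2), false)
  | some (b, true) => some ((b, i.2), decide (∀ q < i.2, v.top (b, q)))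

open Classical in
/-- The new labels after an assignment of vertices. -/
noncomputable def labelAssign (x : ρ → Fin (f + 1)) (v : PtrView (InSym Γ) (ρ × Fin N))
    (a : ρ → Rhs ρ) (i : ρ) : Fin (f + 1) :=
  match a i with
  | none => 0
  | some (b, false) => x b
  | some (b, true) => if ∀ p, v.top (b, p) then x b + 1 else x b

variable {W : List Γ}

/-- The pointers of the vertices `m`. -/
def pointers {n : ℕ} (m : ρ → (Fin N → Fin (n + 1)) × Fin (f + 1)) (i : ρ × Fin N) : Fin (n + 1) :=
  (m i.1).1 i.2

/-- The graph of `ViewEdge` on the numbers of the vertices. -/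
def numberedEdge (W : List Γ) (i j : Fin ((CyclicEnum.vertices W.length N f).top + 1)) : Prop :=
  ViewEdge e W ((CyclicEnum.vertices W.length N f).equiv.symm i)
    ((CyclicEnum.vertices W.length N f).equiv.symm j)

/-- The vertices with numbers `m`. -/
noncomputable def decode (W : List Γ) (m : ρ → Fin ((CyclicEnum.vertices W.length N f).top + 1))
    (a : ρ) : (Fin N → Fin (W.length + 1)) × Fin (f + 1) :=
  (CyclicEnum.vertices W.length N f).equiv.symm (m a)

theorem tupleView_decode (m : ρ → Fin ((CyclicEnum.vertices W.length N f).top + 1)) :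
    tupleView e (fun a => (decode W m a).2) (ptrView W (pointers (decode W m))) =
      graphView (numberedEdge e W) m := by
  simp only [tupleView, graphView, GraphView.mk.injEq]
  refine ⟨?_, ?_, ?_⟩
  · funext a b
    rw [decide_eq_decide, ← (CyclicEnum.vertices W.length N f).equiv.symm.injective.eq_iff,
      Prod.ext_iff, funext_iff]
    simp only [ptrView_eq_iff]
    rfl
  · funext a b
    have hif : (pointers (decode W m) ∘ fun i : Bool × Fin N => (if i.1 then b else a, i.2)) =
        fun i => if i.1 then (decode W m b).1 i.2 else (decode W m a).1 i.2 := by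
      funext i
      simp only [Function.comp_apply, pointers]
      split_ifs <;> rfl
    rw [decide_eq_decide, comap_ptrView, hif]
    rfl
  · funext a
    rw [decide_eq_decide, CyclicEnum.eq_last_symm_iff]
    simp only [ptrView_top_iff]
    rfl

theorem labelAssign_decode (m : ρ → Fin ((CyclicEnum.vertices W.length N f).top + 1))
    (a : ρ → Rhs ρ) :
    labelAssign (fun a => (decode W m a).2) (ptrView W (pointers (decode W m))) a =
      fun k => (decode W (fun k => (a k).cyc m) k).2 := by
  funext k
  simp only [labelAssign, ptrView_top_iff, pointers, decode]
  rcases a k with _ | ⟨b, _ | _⟩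
  · simp [Rhs.cyc, CyclicEnum.symm_zero]
  · simp [Rhs.cyc]
  · simp [Rhs.cyc, CyclicEnum.symm_add_one, carryNext]

theorem tupleAssign_decode (m : ρ → Fin ((CyclicEnum.vertices W.length N f).top + 1))
    (a : ρ → Rhs ρ) :
    (fun i => (tupleAssign (ptrView W (pointers (decode W m))) a i).cyc (pointers (decode W m))) =
      pointers (decode W fun k => (a k).cyc m) := by
  funext ⟨k, p⟩
  simp only [tupleAssign, ptrView_top_iff]
  rcases hk : a k with _ | ⟨b, _ | _⟩
  · simp [Rhs.cyc, pointers, decode, hk, CyclicEnum.symm_zero]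
  · simp [Rhs.cyc, pointers, decode, hk]
  · simp only [Rhs.cyc, pointers, decode, hk, if_true, CyclicEnum.symm_add_one, carryNext,
      digitsNext]
    exact if_congr decide_eq_true_iff rfl rfl

end Tuples

variable (P : GraphMachine ρ)
  (e : Fin (f + 1) → Fin (f + 1) → PtrView (InSym Γ) (Bool × Fin N) → Prop)

/-- The machine with pointers into the input that simulates a machine on graphs of the form
`ViewEdge e W`. -/
noncomputable def toPtrMachine [Finite ρ] : PtrMachine Γ (ρ × Fin N) where
  State := P.State × (ρ → Fin (f + 1))
  finite_state := by
    have := P.finite_state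
    infer_instance
  start := (P.start, fun _ => 0)
  accept := {s | s.1 ∈ P.accept}
  trans s v := (fun o => ((o.1, labelAssign s.2 v o.2), tupleAssign v o.2)) ''
    P.trans s.1 (tupleView e s.2 v)

variable [Finite ρ] {P}

theorem toPtrMachine_isDeterministic (h : P.IsDeterministic) :
    (P.toPtrMachine e).IsDeterministic :=
  fun _ _ => (h _ _).image _

theorem settles_toPtrMachine {W : List Γ} {r : Prop}
    (h : (P.graphSystem (numberedEdge e W)).Settles (P.start, fun _ => 0) r) :
    ((P.toPtrMachine e).ptrSystem W).Settles ((P.toPtrMachine e).start, fun _ => 0) r := by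
  refine .of_simulation (R := fun c d =>
    d = ((c.1, fun a => (decode W c.2 a).2), pointers (decode W c.2)))
    (fun _ => rfl) ?_ ?_ ?_ ?_ h
  · rintro c _ rfl
    rfl
  · exact fun _ _ _ => id
  · rintro ⟨s, m⟩ _ rfl -
    refine ⟨fun o => ((o.1, fun a => (decode W (fun k => (o.2 k).cyc m) a).2),
      pointers (decode W fun k => (o.2 k).cyc m)), ?_, fun o _ _ => ⟨_, .refl, rfl⟩⟩
    simp only [PtrMachine.ptrSystem, Machine.system, toPtrMachine, tupleView_decode,
      Set.image_image, labelAssign_decode, tupleAssign_decode]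
  · rw [show decode W (fun _ : ρ => 0) = fun _ => (fun _ => 0, 0) from
      funext fun _ => CyclicEnum.symm_zero _]
    rfl

end GraphMachine

/-! ### Walks of bounded length -/

section Walks

variable {V : Type*} (E : V → V → Prop)

/-- There is a walk with `t` edges that starts at `v`. -/
def HasWalk : ℕ → V → Prop
  | 0, _ => True
  | t + 1, v => ∃ u, E v u ∧ HasWalk t u

/-- The lengths of walks are bounded. -/
def BoundedWalks : Prop := ∃ t, ∀ v, ¬ HasWalk E t v

variable {E}

theorem HasWalk.of_succ {t : ℕ} {v : V} (h : HasWalk E (t + 1) v) : HasWalk E t v := by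
  induction t generalizing v with
  | zero => trivial
  | succ t ih =>
    obtain ⟨u, hu, h⟩ := h
    exact ⟨u, hu, ih h⟩

theorem HasWalk.mono {s t : ℕ} (hst : s ≤ t) {v : V} (h : HasWalk E t v) : HasWalk E s v := by
  induction t, hst using Nat.le_induction with
  | base => exact h
  | succ t _ ih => exact ih h.of_succ

variable {M : ℕ} {G : Fin (M + 1) → Fin (M + 1) → Prop}

/-- The last vertex is isolated. -/
def LastIsolated (G : Fin (M + 1) → Fin (M + 1) → Prop) : Prop :=
  ∀ u v, G u v → u ≠ Fin.last M ∧ v ≠ Fin.last M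

variable (G) in
open Classical in
/-- The vertices other than the last one at which a walk of length `t` starts. -/
noncomputable def walkSet (t : ℕ) : Finset (Fin (M + 1)) :=
  {v | v ≠ Fin.last M ∧ HasWalk G t v}

theorem mem_walkSet {t : ℕ} {v : Fin (M + 1)} :
    v ∈ walkSet G t ↔ v ≠ Fin.last M ∧ HasWalk G t v := by simp [walkSet]

theorem last_notMem_walkSet (t : ℕ) : Fin.last M ∉ walkSet G t :=
  fun h => (mem_walkSet.1 h).1 rfl

theorem card_le_of_last_notMem {S : Finset (Fin (M + 1))} (hS : Fin.last M ∉ S) : S.card ≤ M := by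
  have hlt := Finset.card_lt_univ_of_notMem hS
  rw [Fintype.card_fin] at hlt
  omega

theorem card_walkSet_zero : (walkSet G 0).card = M := by
  classical
  have : walkSet G 0 = Finset.univ.erase (Fin.last M) := by
    ext v
    simp [mem_walkSet, HasWalk]
  rw [this, Finset.card_erase_of_mem (Finset.mem_univ _), Finset.card_univ, Fintype.card_fin,
    Nat.add_sub_cancel]

theorem walkSet_succ_subset (t : ℕ) : walkSet G (t + 1) ⊆ walkSet G t := by
  intro v hv
  rw [mem_walkSet] at hv ⊢
  exact ⟨hv.1, hv.2.of_succ⟩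

theorem mem_walkSet_succ (hG : LastIsolated G) {t : ℕ} {v : Fin (M + 1)} :
    v ∈ walkSet G (t + 1) ↔ ∃ u ∈ walkSet G t, G v u := by
  simp only [mem_walkSet, HasWalk]
  constructor
  · rintro ⟨_, u, hvu, h⟩
    exact ⟨u, ⟨(hG _ _ hvu).2, h⟩, hvu⟩
  · rintro ⟨u, ⟨_, h⟩, hvu⟩
    exact ⟨(hG _ _ hvu).1, u, hvu, h⟩

theorem boundedWalks_of_walkSet_eq_empty (hG : LastIsolated G) {t : ℕ} (h : walkSet G t = ∅) :
    BoundedWalks G := by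
  refine ⟨t + 1, fun v hv => ?_⟩
  obtain ⟨u, hu, -⟩ := id hv
  exact Finset.notMem_empty v (h ▸ mem_walkSet.2 ⟨(hG _ _ hu).1, hv.of_succ⟩)

theorem not_boundedWalks_of_card_eq (hG : LastIsolated G) {t : ℕ}
    (h : (walkSet G (t + 1)).card = (walkSet G t).card) (h0 : (walkSet G t).card ≠ 0) :
    ¬ BoundedWalks G := by
  have heq : walkSet G (t + 1) = walkSet G t :=
    Finset.eq_of_subset_of_card_le (walkSet_succ_subset t) h.ge
  have hall : ∀ k, walkSet G (t + k) = walkSet G t := by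
    intro k
    induction k with
    | zero => rfl
    | succ k ih =>
      rw [← heq]
      ext v
      rw [← add_assoc, mem_walkSet_succ hG, mem_walkSet_succ hG, ih]
  obtain ⟨v, hv⟩ := Finset.card_ne_zero.1 h0
  rintro ⟨s, hs⟩
  rw [← hall s, mem_walkSet] at hv
  exact hs v (hv.2.mono (by omega))

theorem card_walkSet_add_le (hG : LastIsolated G) (hb : BoundedWalks G) (t : ℕ) :
    (walkSet G t).card = 0 ∨ (walkSet G t).card + t ≤ M := by
  induction t with
  | zero => exact Or.inr card_walkSet_zero.le
  | succ t ih =>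
    have hle := Finset.card_le_card (walkSet_succ_subset (G := G) t)
    by_cases h0 : (walkSet G t).card = 0
    · omega
    · have hne : (walkSet G (t + 1)).card ≠ (walkSet G t).card :=
        fun h => not_boundedWalks_of_card_eq hG h h0 hb
      omega

theorem boundedWalks_iff (hG : LastIsolated G) :
    BoundedWalks G ↔ ∀ v, v ≠ Fin.last M → ¬ HasWalk G M v := by
  constructor
  · intro hb v hv hw
    have hpos := Finset.card_pos.2 ⟨v, mem_walkSet.2 ⟨hv, hw⟩⟩
    rcases card_walkSet_add_le hG hb M with h | h <;> omega
  · intro h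
    refine boundedWalks_of_walkSet_eq_empty hG (t := M) ?_
    exact Finset.eq_empty_of_forall_notMem fun v hv =>
      h v (mem_walkSet.1 hv).1 (mem_walkSet.1 hv).2

end Walks

section Vertices

variable {M : ℕ}

theorem val_add_one_eq {a : Fin (M + 1)} (h : (a : ℕ) + 1 ≤ M) :
    ((a + 1 : Fin (M + 1)) : ℕ) = a + 1 :=
  Fin.val_add_one_of_lt (Fin.lt_def.2 h)

theorem lt_add_one_iff_of_ne_last {x y : Fin (M + 1)} (hx : x ≠ Fin.last M) :
    y < x + 1 ↔ y < x ∨ y = x := by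
  rw [← le_iff_lt_or_eq, Fin.lt_def, Fin.val_add_one_of_lt (Fin.lt_last_iff_ne_last.2 hx),
    Nat.lt_succ_iff, Fin.le_def]

theorem add_one_le_iff_of_ne_last {x y : Fin (M + 1)} (hx : x ≠ Fin.last M) :
    x + 1 ≤ y ↔ x < y := by
  rw [Fin.le_def, Fin.val_add_one_of_lt (Fin.lt_last_iff_ne_last.2 hx), Nat.succ_le_iff,
    Fin.lt_def]

theorem induction_from_last {motive : Fin (M + 1) → Prop} (last : motive (Fin.last M))
    (add_one : ∀ x, x ≠ Fin.last M → motive (x + 1) → motive x) (x : Fin (M + 1)) : motive x := by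
  induction x using Fin.reverseInduction with
  | last => exact last
  | cast i ih => exact add_one _ (Fin.castSucc_ne_last i) (Fin.coeSucc_eq_succ ▸ ih)

theorem forall_le_iff_of_ne_last {p : Fin (M + 1) → Prop} {x : Fin (M + 1)}
    (hx : x ≠ Fin.last M) : (∀ y, x ≤ y → p y) ↔ p x ∧ ∀ y, x + 1 ≤ y → p y := by
  simp only [add_one_le_iff_of_ne_last hx, le_iff_eq_or_lt, or_imp, forall_and, forall_eq']

theorem exists_le_iff_of_ne_last {p : Fin (M + 1) → Prop} {x : Fin (M + 1)}
    (hx : x ≠ Fin.last M) : (∃ y, x ≤ y ∧ p y) ↔ p x ∨ ∃ y, x + 1 ≤ y ∧ p y := by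
  simp only [add_one_le_iff_of_ne_last hx, le_iff_eq_or_lt, or_and_right, exists_or,
    exists_eq_left']

theorem forall_last_le_iff {p : Fin (M + 1) → Prop} :
    (∀ y, Fin.last M ≤ y → p y) ↔ p (Fin.last M) := by
  simp only [Fin.last_le_iff, forall_eq]

/-- The elements of `S` that are less than `x`. -/
def below (S : Finset (Fin (M + 1))) (x : Fin (M + 1)) : Finset (Fin (M + 1)) :=
  {y ∈ S | y < x}

variable {S : Finset (Fin (M + 1))} {x y : Fin (M + 1)}

theorem mem_below : y ∈ below S x ↔ y ∈ S ∧ y < x := Finset.mem_filter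

theorem below_subset : below S x ⊆ S := Finset.filter_subset _ _

theorem self_notMem_below : x ∉ below S x := fun h => lt_irrefl x (mem_below.1 h).2

theorem below_zero : below S 0 = ∅ := by simp [below]

theorem below_last (hS : Fin.last M ∉ S) : below S (Fin.last M) = S :=
  Finset.filter_true_of_mem fun _ hx => Fin.lt_last_iff_ne_last.2 (ne_of_mem_of_not_mem hx hS)

theorem below_add_one_of_mem (hx : x ≠ Fin.last M) (h : x ∈ S) :
    below S (x + 1) = insert x (below S x) := by
  ext y
  rw [Finset.mem_insert, mem_below, mem_below, lt_add_one_iff_of_ne_last hx]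
  constructor
  · tauto
  · rintro (rfl | h') <;> tauto

theorem below_add_one_of_notMem (hx : x ≠ Fin.last M) (h : x ∉ S) :
    below S (x + 1) = below S x := by
  ext y
  rw [mem_below, mem_below, lt_add_one_iff_of_ne_last hx]
  refine and_congr_right fun hy => or_iff_left ?_
  rintro rfl
  exact h hy

end Vertices

/-! ### Inductive counting -/

section Programs

/-- The memory after an assignment to the registers. -/
def exec {ρ : Type} {M : ℕ} (a : ρ → Rhs ρ) (m : ρ → Fin (M + 1)) : ρ → Fin (M + 1) :=
  fun k => (a k).cyc m

namespace GraphMachine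

open TransitionSystem

variable {ρ : Type} {P : GraphMachine ρ} {M : ℕ} {G : Fin (M + 1) → Fin (M + 1) → Prop}
  {s : P.State} {m : ρ → Fin (M + 1)}

theorem step_eq : (P.graphSystem G).step (s, m) =
    (fun o => (o.1, exec o.2 m)) '' P.trans s (graphView G m) :=
  rfl

theorem settles_of_halted (h : P.trans s (graphView G m) = ∅) :
    (P.graphSystem G).Settles (s, m) (s ∈ P.accept) :=
  Settles.of_halted trivial (by rw [step_eq, h, Set.image_empty])

theorem settles_of_assign {r : Prop} {s' : P.State} {a : ρ → Rhs ρ}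
    (h : P.trans s (graphView G m) = {(s', a)})
    (h' : (P.graphSystem G).Settles (s', exec a m) r) : (P.graphSystem G).Settles (s, m) r :=
  Settles.of_singleton trivial (by rw [step_eq, h, Set.image_singleton]) h'

theorem settles_of_choice {p₁ p₂ r₁ r₂ : Prop} {s₁ s₂ : P.State} {a₁ a₂ : ρ → Rhs ρ}
    (hs : s ∉ P.accept)
    (h : P.trans s (graphView G m) = {o | p₁ ∧ o = (s₁, a₁) ∨ p₂ ∧ o = (s₂, a₂)})
    (h₁ : p₁ → (P.graphSystem G).Settles (s₁, exec a₁ m) r₁)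
    (h₂ : p₂ → (P.graphSystem G).Settles (s₂, exec a₂ m) r₂) :
    (P.graphSystem G).Settles (s, m) (p₁ ∧ r₁ ∨ p₂ ∧ r₂) := by
  rcases (P.trans s (graphView G m)).eq_empty_or_nonempty with hA | hA
  · refine (settles_of_halted hA).congr (iff_of_false hs ?_)
    rw [h, Set.eq_empty_iff_forall_notMem] at hA
    exact fun hr => hr.elim (fun hr => hA _ (Or.inl ⟨hr.1, rfl⟩))
      fun hr => hA _ (Or.inr ⟨hr.1, rfl⟩)
  · refine (Settles.of_image (S := P.graphSystem G)
      (ρ := fun o => (P.graphSystem G).Accepts (o.1, exec o.2 m)) trivial step_eq hA ?_).congr ?_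
    · rw [h]
      rintro _ (⟨hp, rfl⟩ | ⟨hp, rfl⟩)
      · exact (h₁ hp).congr (h₁ hp).accepts_iff.symm
      · exact (h₂ hp).congr (h₂ hp).accepts_iff.symm
    · simp only [h, Set.mem_ofPred_eq, or_and_right, exists_or, and_assoc, exists_and_left,
        exists_eq_left]
      exact or_congr (and_congr_right fun hp => (h₁ hp).accepts_iff)
        (and_congr_right fun hp => (h₂ hp).accepts_iff)

end GraphMachine

/-- Registers of the programs on graphs. -/
inductive GReg
  | v | u | w | x | t | r | r' | c | i | z

instance : Finite GReg :=
  Set.finite_univ_iff.1 <| (Set.toFinite {.v, .u, .w, .x, .t, .r, .r', .c, .i, .z}).subset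
    fun k _ => by cases k <;> simp

namespace GReg

/-- No change. -/
def keep (k : GReg) : Rhs GReg := some (k, false)

/-- `r := r + 1`. -/
def incR : GReg → Rhs GReg
  | .r => some (.r, true)
  | k => some (k, false)

/-- `r := r'; t := t + 1; v := 0; r' := 0`. -/
def nextLength : GReg → Rhs GReg
  | .r => some (.r', false)
  | .t => some (.t, true)
  | .v => none
  | .r' => none
  | k => some (k, false)

/-- `u := 0; c := 0`. -/
def startScan : GReg → Rhs GReg
  | .u => none
  | .c => none
  | k => some (k, false)

/-- `v := v + 1; r' := r' + b`. -/
def endScan (b : Bool) : GReg → Rhs GReg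
  | .v => some (.v, true)
  | .r' => some (.r', b)
  | k => some (k, false)

/-- `u := u + 1`. -/
def incU : GReg → Rhs GReg
  | .u => some (.u, true)
  | k => some (k, false)

/-- `w := u; i := 0`. -/
def walkFromU : GReg → Rhs GReg
  | .w => some (.u, false)
  | .i => none
  | k => some (k, false)

/-- `c := c + 1; u := u + 1`. -/
def endWalk : GReg → Rhs GReg
  | .c => some (.c, true)
  | .u => some (.u, true)
  | k => some (k, false)

/-- `x := 0`. -/
def resetX : GReg → Rhs GReg
  | .x => none
  | k => some (k, false)

/-- `x := x + 1`. -/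
def incX : GReg → Rhs GReg
  | .x => some (.x, true)
  | k => some (k, false)

/-- `w := x; i := i + 1`. -/
def stepToX : GReg → Rhs GReg
  | .w => some (.x, false)
  | .i => some (.i, true)
  | k => some (k, false)

/-- `w := v; i := 0`. -/
def walkFromV : GReg → Rhs GReg
  | .w => some (.v, false)
  | .i => none
  | k => some (k, false)

/-- `v := v + 1`. -/
def incV : GReg → Rhs GReg
  | .v => some (.v, true)
  | k => some (k, false)

/-- The registers used to follow a walk. -/
def walkRegs : Set GReg := {.w, .x, .i}

/-- The registers used to go through the vertices `u` for a fixed vertex `v`. -/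
def scanRegs : Set GReg := {.u, .c} ∪ walkRegs

end GReg

variable {M : ℕ} {G : Fin (M + 1) → Fin (M + 1) → Prop} {m m' m₀ : GReg → Fin (M + 1)}

theorem eqOn_exec {a : GReg → Rhs GReg} {A : Set GReg} (h : ∀ k ∉ A, a k = GReg.keep k) :
    Set.EqOn (exec a m) m Aᶜ := fun k hk => by rw [exec, h k hk]; rfl

theorem eqOn_resetX : Set.EqOn (exec GReg.resetX m) m {.x}ᶜ :=
  eqOn_exec fun k hk => by cases k <;> first | rfl | simp at hk

theorem eqOn_incX : Set.EqOn (exec GReg.incX m) m {.x}ᶜ :=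
  eqOn_exec fun k hk => by cases k <;> first | rfl | simp at hk

theorem eqOn_stepToX : Set.EqOn (exec GReg.stepToX m) m GReg.walkRegsᶜ :=
  eqOn_exec fun k hk => by cases k <;> first | rfl | simp [GReg.walkRegs] at hk

theorem eqOn_walkFromU : Set.EqOn (exec GReg.walkFromU m) m GReg.walkRegsᶜ :=
  eqOn_exec fun k hk => by cases k <;> first | rfl | simp [GReg.walkRegs] at hk

theorem eqOn_endWalk : Set.EqOn (exec GReg.endWalk m) m GReg.scanRegsᶜ :=
  eqOn_exec fun k hk => by cases k <;> first | rfl | simp [GReg.scanRegs] at hk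

theorem eqOn_incU : Set.EqOn (exec GReg.incU m) m GReg.scanRegsᶜ :=
  eqOn_exec fun k hk => by cases k <;> first | rfl | simp [GReg.scanRegs] at hk

theorem eqOn_startScan : Set.EqOn (exec GReg.startScan m) m GReg.scanRegsᶜ :=
  eqOn_exec fun k hk => by cases k <;> first | rfl | simp [GReg.scanRegs] at hk

theorem val_exec_stepToX_i {k n : ℕ} (hn : n ≤ M) (h : (m .i : ℕ) + (k + 1) = n) :
    (exec GReg.stepToX m .i : ℕ) + k = n := by
  change ((m .i + 1 : Fin (M + 1)) : ℕ) + k = n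
  rw [val_add_one_eq (by omega)]
  omega

section Counting

/-- States of the counting program. -/
inductive CountState
  | load | pick | scan (b : Bool) | walk (b : Bool) | guess (b : Bool) | yes

instance : Finite CountState :=
  Set.finite_univ_iff.1 <| (Set.toFinite ({.load, .pick, .yes} ∪ Set.range .scan ∪
    Set.range .walk ∪ Set.range .guess)).subset fun s _ => by cases s <;> simp

/-- Inductive counting. When `pick` is entered with `v = 0`, register `r` holds the number of
vertices at which a walk of length `t` starts, and the loop over `v` computes in `r'` the number for
length `t + 1`. For each `v` the loop over `u` guesses which `u` are starts of walks of length `t`,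
verifies the positive guesses by guessing the walk, counts them in `c`, and remembers whether one of
them is a neighbour of `v`; the count has to be `r` in the end. -/
def countTrans : CountState → GraphView GReg → Set (CountState × (GReg → Rhs GReg))
  | .load, g => if g.last .r then {(.pick, GReg.keep)} else {(.load, GReg.incR)}
  | .pick, g =>
    if g.last .v then
      if g.eq .r' .z then {(.yes, GReg.keep)}
      else if g.eq .r' .r then ∅
      else {(.pick, GReg.nextLength)}
    else {(.scan false, GReg.startScan)}
  | .scan b, g =>
    if g.last .u then {o | g.eq .c .r ∧ o = (.pick, GReg.endScan b)}
    else {(.scan b, GReg.incU), (.walk b, GReg.walkFromU)}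
  | .walk b, g =>
    if g.eq .i .t then {(.scan (b || g.edge .v .u), GReg.endWalk)}
    else {(.guess b, GReg.resetX)}
  | .guess b, g =>
    {o | g.edge .w .x ∧ o = (.walk b, GReg.stepToX) ∨
      g.last .x = false ∧ o = (.guess b, GReg.incX)}
  | .yes, _ => ∅

/-- The counting program. -/
abbrev countMachine : GraphMachine GReg where
  State := CountState
  finite_state := inferInstance
  start := .load
  accept := {.yes}
  trans := countTrans

theorem settles_guess {b : Bool} {ρ : Fin (M + 1) → Prop}
    (h : ∀ m', Set.EqOn m' m₀ {.x}ᶜ → G (m' .w) (m' .x) →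
      (countMachine.graphSystem G).Settles (.walk b, exec GReg.stepToX m') (ρ (m' .x)))
    (x : Fin (M + 1)) (hx : m .x = x) (hm : Set.EqOn m m₀ {.x}ᶜ) :
    (countMachine.graphSystem G).Settles (.guess b, m)
      (∃ y, x ≤ y ∧ G (m .w) y ∧ ρ y) := by
  induction x using induction_from_last generalizing m with
  | last =>
    refine (GraphMachine.settles_of_choice (P := countMachine) (p₁ := G (m .w) (m .x))
      (p₂ := False) (r₂ := False) (s₂ := .yes) (a₂ := GReg.keep) (by simp) ?_ (h m hm)
      False.elim).congr ?_
    · simp [countTrans, graphView, hx]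
    · simp [hx, Fin.last_le_iff]
  | add_one x hlast ih =>
    refine (GraphMachine.settles_of_choice (P := countMachine) (p₁ := G (m .w) (m .x))
      (p₂ := True) (by simp) ?_
      (h m hm) fun _ => ih (congrArg (· + 1) hx) (eqOn_incX.trans hm)).congr ?_
    · simp [countTrans, graphView, hx, hlast]
    · rw [exists_le_iff_of_ne_last hlast, true_and, hx]
      rfl

theorem settles_walk {b : Bool} {K : Prop} (k : ℕ) (hi : (m .i : ℕ) + k = m .t)
    (h : HasWalk G k (m .w) → ∀ m', Set.EqOn m' m GReg.walkRegsᶜ → m' .i = m' .t →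
      (countMachine.graphSystem G).Settles (.walk b, m') K) :
    (countMachine.graphSystem G).Settles (.walk b, m) (HasWalk G k (m .w) ∧ K) := by
  induction k generalizing m with
  | zero => exact (h trivial m (Set.eqOn_refl _ _) (Fin.ext hi)).congr (by simp [HasWalk])
  | succ k ih =>
    have hne : m .i ≠ m .t := fun h' => by
      rw [h'] at hi
      omega
    refine GraphMachine.settles_of_assign (s' := .guess b) (a := GReg.resetX)
      (by simp [countTrans, graphView, hne]) ?_
    refine (settles_guess (m₀ := m) (ρ := fun y => HasWalk G k y ∧ K) ?_ 0 rfl eqOn_resetX).congr ?_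
    · intro m' hm' hG
      have hw : m' .w = m .w := hm' (by simp)
      have hsub : GReg.walkRegsᶜ ⊆ {GReg.x}ᶜ :=
        Set.compl_subset_compl.2 (by simp [GReg.walkRegs])
      refine ih ?_ fun hwalk m'' hm'' => h ⟨m' .x, hw ▸ hG, hwalk⟩ m''
        (hm''.trans (eqOn_stepToX.trans (hm'.mono hsub)))
      have hi' : (m' .i : ℕ) + (k + 1) = m' .t := by
        rwa [hm' (by simp : GReg.i ∈ {GReg.x}ᶜ), hm' (by simp : GReg.t ∈ {GReg.x}ᶜ)]
      exact val_exec_stepToX_i (m' .t).is_le hi'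
    · change (∃ y, 0 ≤ y ∧ G (m .w) y ∧ HasWalk G k y ∧ K) ↔ _
      simp only [Fin.zero_le, true_and, HasWalk, ← exists_and_right, and_assoc]

/-- The invariant of the loop over `u`: the vertices counted so far are those of `T`, and `b` says
whether one of them is a neighbour of `v`. -/
structure ScanInvariant (G : Fin (M + 1) → Fin (M + 1) → Prop) (S : Finset (Fin (M + 1)))
    (m₀ m : GReg → Fin (M + 1)) (b : Bool) (T : Finset (Fin (M + 1))) : Prop where
  eqOn : Set.EqOn m m₀ GReg.scanRegsᶜ
  subset : T ⊆ below S (m .u)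
  card : (m .c : ℕ) = T.card
  flag : b = true ↔ ∃ x ∈ T, G (m₀ .v) x

namespace ScanInvariant

variable {S T : Finset (Fin (M + 1))} {b : Bool}

theorem start : ScanInvariant G S m₀ (exec GReg.startScan m₀) false ∅ where
  eqOn := eqOn_startScan
  subset := Finset.empty_subset _
  card := rfl
  flag := by simp

theorem of_eqOn (h : ScanInvariant G S m₀ m b T) (hm : Set.EqOn m' m GReg.walkRegsᶜ) :
    ScanInvariant G S m₀ m' b T where
  eqOn := (hm.mono (Set.compl_subset_compl.2 Set.subset_union_right)).trans h.eqOn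
  subset := (hm (by simp [GReg.walkRegs]) : m' .u = m .u) ▸ h.subset
  card := (hm (by simp [GReg.walkRegs]) : m' .c = m .c) ▸ h.card
  flag := h.flag

theorem skip (h : ScanInvariant G S m₀ m b T) (hu : m .u ≠ Fin.last M) :
    ScanInvariant G S m₀ (exec GReg.incU m) b T where
  eqOn := eqOn_incU.trans h.eqOn
  subset x hx := by
    obtain ⟨hxS, hxu⟩ := mem_below.1 (h.subset hx)
    exact mem_below.2 ⟨hxS, (lt_add_one_iff_of_ne_last hu).2 (Or.inl hxu)⟩
  card := h.card
  flag := h.flag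

theorem count (h : ScanInvariant G S m₀ m b T) (hu : m .u ∈ S) (hS : Fin.last M ∉ S) :
    ScanInvariant G S m₀ (exec GReg.endWalk m) (b || (graphView G m).edge .v .u)
      (insert (m .u) T) := by
  have hlast : m .u ≠ Fin.last M := ne_of_mem_of_not_mem hu hS
  have hsub : insert (m .u) T ⊆ below S (m .u + 1) :=
    below_add_one_of_mem hlast hu ▸ Finset.insert_subset_insert _ h.subset
  have hcard : (insert (m .u) T).card = m .c + 1 := by
    rw [Finset.card_insert_of_notMem fun hT => self_notMem_below (h.subset hT), h.card]
  have hle : (insert (m .u) T).card ≤ M :=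
    (Finset.card_le_card (hsub.trans below_subset)).trans (card_le_of_last_notMem hS)
  have hv : m .v = m₀ .v := h.eqOn (by simp [GReg.scanRegs, GReg.walkRegs])
  refine ⟨eqOn_endWalk.trans h.eqOn, hsub, ?_, ?_⟩
  · exact (val_add_one_eq (hcard ▸ hle)).trans hcard.symm
  · rw [Bool.or_eq_true, h.flag, Finset.exists_mem_insert, or_comm, ← hv]
    simp [graphView]

end ScanInvariant

theorem settles_scan_last (hG : LastIsolated G) {t : ℕ} {Q : Prop} {b : Bool}
    {T : Finset (Fin (M + 1))} (hr : (m₀ .r : ℕ) = (walkSet G t).card)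
    (hpick : ∀ m b, Set.EqOn m m₀ GReg.scanRegsᶜ → (b = true ↔ m₀ .v ∈ walkSet G (t + 1)) →
      (countMachine.graphSystem G).Settles (.pick, exec (GReg.endScan b) m) Q)
    (hu : m .u = Fin.last M) (h : ScanInvariant G (walkSet G t) m₀ m b T) :
    (countMachine.graphSystem G).Settles (.scan b, m) (T = walkSet G t ∧ Q) := by
  have hsub : T ⊆ walkSet G t := h.subset.trans below_subset
  have hcount : m .c = m .r ↔ T = walkSet G t := by
    rw [h.eqOn (by simp [GReg.scanRegs, GReg.walkRegs] : GReg.r ∈ GReg.scanRegsᶜ), Fin.ext_iff,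
      h.card, hr]
    exact ⟨fun hc => Finset.eq_of_subset_of_card_le hsub hc.ge, congrArg Finset.card⟩
  refine (GraphMachine.settles_of_choice (P := countMachine) (p₁ := m .c = m .r)
    (p₂ := False) (r₂ := False) (s₂ := .yes) (a₂ := GReg.keep) (by simp) ?_
    (fun hc => hpick m b h.eqOn ?_) False.elim).congr ?_
  · simp [countTrans, graphView, hu]
  · rw [h.flag, mem_walkSet_succ hG, hcount.1 hc]
  · rw [hcount, false_and, or_false]

theorem eq_below_add_one_or_iff {S T : Finset (Fin (M + 1))} {x : Fin (M + 1)}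
    (hx : x ≠ Fin.last M) (hT : T ⊆ below S x) :
    T = below S (x + 1) ∨ (x ∈ S ∧ insert x T = below S (x + 1)) ↔ T = below S x := by
  have hxT : x ∉ T := fun h => self_notMem_below (hT h)
  by_cases hxS : x ∈ S
  · rw [below_add_one_of_mem hx hxS, and_iff_right hxS,
      or_iff_right fun h : T = _ => hxT (h ▸ Finset.mem_insert_self x _)]
    exact ⟨fun h => by rw [← Finset.erase_insert hxT, h, Finset.erase_insert self_notMem_below],
      fun h => by rw [h]⟩
  · rw [below_add_one_of_notMem hx hxS]
    exact or_iff_left fun h => hxS h.1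

theorem settles_scan (hG : LastIsolated G) {t : ℕ} {Q : Prop} {b : Bool}
    {T : Finset (Fin (M + 1))} (ht : (m₀ .t : ℕ) = t) (hr : (m₀ .r : ℕ) = (walkSet G t).card)
    (hpick : ∀ m b, Set.EqOn m m₀ GReg.scanRegsᶜ → (b = true ↔ m₀ .v ∈ walkSet G (t + 1)) →
      (countMachine.graphSystem G).Settles (.pick, exec (GReg.endScan b) m) Q)
    (x : Fin (M + 1)) (hx : m .u = x) (h : ScanInvariant G (walkSet G t) m₀ m b T) :
    (countMachine.graphSystem G).Settles (.scan b, m) (T = below (walkSet G t) x ∧ Q) := by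
  induction x using induction_from_last generalizing m b T with
  | last =>
    rw [below_last (last_notMem_walkSet t)]
    exact settles_scan_last hG hr hpick hx h
  | add_one x hlast ih =>
    subst hx
    have hmem : HasWalk G t (m .u) ↔ m .u ∈ walkSet G t := by
      rw [mem_walkSet, and_iff_right hlast]
    have hwalk := settles_walk (G := G) (m := exec GReg.walkFromU m) (b := b)
      (K := insert (m .u) T = below (walkSet G t) (m .u + 1) ∧ Q) t ?_ ?_
    · refine (GraphMachine.settles_of_choice (P := countMachine) (p₁ := True) (p₂ := True)
        (by simp) ?_ (fun _ => ih rfl (h.skip hlast)) fun _ => hwalk).congr ?_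
      · ext o
        simp [countTrans, graphView, hlast]
      · change True ∧ _ ∨ True ∧ HasWalk G t (m .u) ∧ _ ↔ _
        rw [true_and, true_and, hmem, ← and_assoc, ← or_and_right,
          eq_below_add_one_or_iff hlast h.subset]
    · have htime : m .t = m₀ .t := h.eqOn (by simp [GReg.scanRegs, GReg.walkRegs])
      change ((0 : Fin (M + 1)) : ℕ) + t = m .t
      rw [htime, ht, Fin.val_zero, zero_add]
    · intro hw m' hm' hi
      have hm := hm'.trans eqOn_walkFromU
      have hu : m' .u = m .u := hm (by simp [GReg.walkRegs])
      refine GraphMachine.settles_of_assign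
        (s' := .scan (b || (graphView G m').edge .v .u)) (a := GReg.endWalk) ?_ ?_
      · simp [countTrans, graphView, hi]
      · have hnext := ih (congrArg (· + 1) hu)
          ((h.of_eqOn hm).count (hu ▸ hmem.1 hw) (last_notMem_walkSet t))
        rwa [hu] at hnext

/-- The invariant of the loop over `v`. -/
structure PickInvariant (G : Fin (M + 1) → Fin (M + 1) → Prop) (t : ℕ)
    (m : GReg → Fin (M + 1)) : Prop where
  length : (m .t : ℕ) = t
  zero : m .z = 0
  count : (m .r : ℕ) = (walkSet G t).card
  count_succ : (m .r' : ℕ) = (below (walkSet G (t + 1)) (m .v)).card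

theorem PickInvariant.endScan {t : ℕ} {b : Bool} (h : PickInvariant G t m₀)
    (hm : Set.EqOn m m₀ GReg.scanRegsᶜ) (hlast : m₀ .v ≠ Fin.last M)
    (hb : b = true ↔ m₀ .v ∈ walkSet G (t + 1)) :
    PickInvariant G t (exec (GReg.endScan b) m) := by
  have hv : m .v = m₀ .v := hm (by simp [GReg.scanRegs, GReg.walkRegs])
  have ht : m .t = m₀ .t := hm (by simp [GReg.scanRegs, GReg.walkRegs])
  have hz : m .z = m₀ .z := hm (by simp [GReg.scanRegs, GReg.walkRegs])
  have hr : m .r = m₀ .r := hm (by simp [GReg.scanRegs, GReg.walkRegs])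
  have hr' : m .r' = m₀ .r' := hm (by simp [GReg.scanRegs, GReg.walkRegs])
  refine ⟨(congrArg Fin.val ht).trans h.length, hz.trans h.zero,
    (congrArg Fin.val hr).trans h.count, ?_⟩
  change (Rhs.cyc m (some (GReg.r', b)) : ℕ) =
    (below (walkSet G (t + 1)) (m .v + 1)).card
  rw [hv]
  cases b with
  | false =>
    rw [below_add_one_of_notMem hlast fun hmem => Bool.false_ne_true (hb.2 hmem), ← h.count_succ,
      ← hr']
    rfl
  | true =>
    have hsub := (below_subset (S := walkSet G (t + 1)) (x := m₀ .v + 1))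
    have hle := (Finset.card_le_card hsub).trans (card_le_of_last_notMem (last_notMem_walkSet _))
    rw [below_add_one_of_mem hlast (hb.1 rfl), Finset.card_insert_of_notMem self_notMem_below,
      ← h.count_succ, ← hr'] at hle ⊢
    exact val_add_one_eq hle

theorem PickInvariant.nextLength {t : ℕ} (h : PickInvariant G t m) (ht : t + 1 ≤ M)
    (hv : m .v = Fin.last M) : PickInvariant G (t + 1) (exec GReg.nextLength m) where
  length := (val_add_one_eq (h.length ▸ ht)).trans (congrArg (· + 1) h.length)
  zero := h.zero
  count := h.count_succ.trans (by rw [hv, below_last (last_notMem_walkSet _)])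
  count_succ := by
    change ((0 : Fin (M + 1)) : ℕ) = (below _ 0).card
    rw [below_zero, Fin.val_zero, Finset.card_empty]

theorem settles_pick_of_last (hG : LastIsolated G) {t : ℕ} {Q : Prop}
    (hpick : ∀ m, m .v = Fin.last M → PickInvariant G t m →
      (countMachine.graphSystem G).Settles (.pick, m) Q)
    (x : Fin (M + 1)) (hx : m .v = x) (h : PickInvariant G t m) :
    (countMachine.graphSystem G).Settles (.pick, m) Q := by
  induction x using induction_from_last generalizing m with
  | last => exact hpick m hx h
  | add_one x hlast ih =>
    subst hx
    refine (GraphMachine.settles_of_assign (P := countMachine) (s' := .scan false)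
      (a := GReg.startScan) ?_ (settles_scan (Q := Q) hG h.length h.count ?_ 0 rfl .start)).congr ?_
    · simp [countTrans, graphView, hlast]
    · intro m' b hm' hb
      have hv : m' .v = m .v := hm' (by simp [GReg.scanRegs, GReg.walkRegs])
      exact ih (congrArg (· + 1) hv) (h.endScan hm' hlast hb)
    · rw [below_zero, and_iff_right rfl]

theorem settles_pick (hG : LastIsolated G) {n t : ℕ} (hn : (walkSet G t).card = n)
    (hnt : n + t ≤ M) (h : PickInvariant G t m) :
    (countMachine.graphSystem G).Settles (.pick, m) (BoundedWalks G) := by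
  induction n using Nat.strong_induction_on generalizing t m with
  | _ n ihn =>
    refine settles_pick_of_last hG (fun m hv h => ?_) _ rfl h
    have hcount : (m .r' : ℕ) = (walkSet G (t + 1)).card := by
      rw [h.count_succ, hv, below_last (last_notMem_walkSet _)]
    by_cases h0 : m .r' = m .z
    · refine (GraphMachine.settles_of_assign (P := countMachine) (s' := .yes) (a := GReg.keep)
        (by simp [countTrans, graphView, hv, h0])
        (GraphMachine.settles_of_halted (P := countMachine) rfl)).congr ?_
      rw [h0, h.zero, Fin.val_zero, eq_comm, Finset.card_eq_zero] at hcount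
      exact iff_of_true rfl (boundedWalks_of_walkSet_eq_empty hG hcount)
    have hpos : (walkSet G (t + 1)).card ≠ 0 := fun hc =>
      h0 (Fin.ext (by rw [hcount, hc, h.zero, Fin.val_zero]))
    have hle := Finset.card_le_card (walkSet_succ_subset (G := G) t)
    by_cases h1 : m .r' = m .r
    · refine (GraphMachine.settles_of_halted (P := countMachine)
        (by simp [countTrans, graphView, hv, h0, ← h1])).congr (iff_of_false (by simp) ?_)
      have hcard : (walkSet G (t + 1)).card = (walkSet G t).card := by rw [← hcount, h1, h.count]
      exact not_boundedWalks_of_card_eq hG hcard (hcard ▸ hpos)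
    · have hlt : (walkSet G (t + 1)).card < n := by
        have hne : (m .r' : ℕ) ≠ m .r := fun heq => h1 (Fin.ext heq)
        rw [hcount, h.count] at hne
        omega
      exact GraphMachine.settles_of_assign (s' := .pick) (a := GReg.nextLength)
        (by simp [countTrans, graphView, hv, h0, h1])
        (ihn _ hlt rfl (by omega) (h.nextLength (by omega) hv))

theorem settles_load (hG : LastIsolated G) (x : Fin (M + 1)) (hr : m .r = x) (hv : m .v = 0)
    (ht : m .t = 0) (hz : m .z = 0) (hr' : m .r' = 0) :
    (countMachine.graphSystem G).Settles (.load, m) (BoundedWalks G) := by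
  induction x using induction_from_last generalizing m with
  | last =>
    refine GraphMachine.settles_of_assign (s' := .pick) (a := GReg.keep)
      (by simp [countTrans, graphView, hr]) (settles_pick hG card_walkSet_zero le_rfl ?_)
    refine ⟨congrArg Fin.val ht, hz, (congrArg Fin.val hr).trans card_walkSet_zero.symm, ?_⟩
    change (m .r' : ℕ) = (below _ (m .v)).card
    rw [hr', hv, below_zero, Fin.val_zero, Finset.card_empty]
  | add_one x hlast ih =>
    subst hr
    exact GraphMachine.settles_of_assign (s' := .load) (a := GReg.incR)
      (by simp [countTrans, graphView, hlast]) (ih rfl hv ht hz hr')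

theorem settles_countMachine (hG : LastIsolated G) :
    (countMachine.graphSystem G).Settles (countMachine.start, fun _ => 0) (BoundedWalks G) :=
  settles_load hG 0 rfl rfl rfl rfl rfl

end Counting

/-! ### Graphs with unique successors -/

section Tracing

/-- States of the tracing program. -/
inductive TraceState
  | pick | walk | search | yes

instance : Finite TraceState :=
  Set.finite_univ_iff.1 <| (Set.toFinite {.pick, .walk, .search, .yes}).subset
    fun s _ => by cases s <;> simp

/-- For graphs with at most one edge out of each vertex: follow the walk from each vertex `v`, and
reject if one of them has as many edges as there are vertices other than the last one. -/
def traceTrans : TraceState → GraphView GReg → Set (TraceState × (GReg → Rhs GReg))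
  | .pick, g => if g.last .v then {(.yes, GReg.keep)} else {(.walk, GReg.walkFromV)}
  | .walk, g => if g.last .i then ∅ else {(.search, GReg.resetX)}
  | .search, g =>
    if g.edge .w .x then {(.walk, GReg.stepToX)}
    else if g.last .x then {(.pick, GReg.incV)}
    else {(.search, GReg.incX)}
  | .yes, _ => ∅

/-- The tracing program. -/
abbrev traceMachine : GraphMachine GReg where
  State := TraceState
  finite_state := inferInstance
  start := .pick
  accept := {.yes}
  trans := traceTrans

theorem traceMachine_isDeterministic : traceMachine.IsDeterministic := by
  rintro (_ | _ | _ | _) g <;> simp only [traceMachine, traceTrans] <;> (try split_ifs) <;> simp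

theorem settles_search_of_edge {ρ : Fin (M + 1) → Prop} {Q : Prop}
    (hfun : ∀ a b c, G a b → G a c → b = c) (hE : G (m .w) (m .x))
    (hwalk : (traceMachine.graphSystem G).Settles (.walk, exec GReg.stepToX m) (ρ (m .x) ∧ Q)) :
    (traceMachine.graphSystem G).Settles (.search, m)
      ((∀ y, m .x ≤ y → G (m .w) y → ρ y) ∧ Q) := by
  refine (GraphMachine.settles_of_assign (P := traceMachine) (s' := .walk) (a := GReg.stepToX)
    (by simp [traceTrans, graphView, hE]) hwalk).congr (and_congr_left fun _ => ?_)
  exact ⟨fun h y _ hy => hfun _ _ _ hE hy ▸ h, fun h => h _ le_rfl hE⟩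

theorem settles_search {ρ : Fin (M + 1) → Prop} {Q : Prop}
    (hfun : ∀ a b c, G a b → G a c → b = c)
    (hwalk : ∀ m', Set.EqOn m' m₀ {.x}ᶜ → G (m' .w) (m' .x) →
      (traceMachine.graphSystem G).Settles (.walk, exec GReg.stepToX m') (ρ (m' .x) ∧ Q))
    (hpick : ∀ m', Set.EqOn m' m₀ {.x}ᶜ →
      (traceMachine.graphSystem G).Settles (.pick, exec GReg.incV m') Q)
    (x : Fin (M + 1)) (hx : m .x = x) (hm : Set.EqOn m m₀ {.x}ᶜ) :
    (traceMachine.graphSystem G).Settles (.search, m)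
      ((∀ y, x ≤ y → G (m .w) y → ρ y) ∧ Q) := by
  induction x using induction_from_last generalizing m with
  | last =>
    by_cases hE : G (m .w) (m .x)
    · exact hx ▸ settles_search_of_edge hfun hE (hwalk m hm hE)
    rw [hx] at hE
    refine (GraphMachine.settles_of_assign (P := traceMachine) (s' := .pick) (a := GReg.incV)
      (by simp [traceTrans, graphView, hx, hE]) (hpick m hm)).congr ?_
    rw [forall_last_le_iff, and_iff_right fun h => absurd h hE]
  | add_one x hlast ih =>
    by_cases hE : G (m .w) (m .x)
    · exact hx ▸ settles_search_of_edge hfun hE (hwalk m hm hE)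
    rw [hx] at hE
    refine (GraphMachine.settles_of_assign (P := traceMachine) (s' := .search) (a := GReg.incX)
      (by simp [traceTrans, graphView, hx, hE, hlast])
      (ih (congrArg (· + 1) hx) (eqOn_incX.trans hm))).congr ?_
    rw [forall_le_iff_of_ne_last hlast, and_iff_right fun h => absurd h hE]
    rfl

theorem settles_trace_walk {Q : Prop} (hfun : ∀ a b c, G a b → G a c → b = c)
    (hpick : ∀ m, m .v = m₀ .v + 1 → (traceMachine.graphSystem G).Settles (.pick, m) Q)
    (k : ℕ) (hi : (m .i : ℕ) + k = M) (hv : m .v = m₀ .v) :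
    (traceMachine.graphSystem G).Settles (.walk, m) (¬ HasWalk G k (m .w) ∧ Q) := by
  induction k generalizing m with
  | zero =>
    have hlast : m .i = Fin.last M := Fin.ext hi
    exact (GraphMachine.settles_of_halted (P := traceMachine)
      (by simp [traceTrans, graphView, hlast])).congr (by simp [HasWalk])
  | succ k ih =>
    have hlast : m .i ≠ Fin.last M := fun h => by
      rw [h, Fin.val_last] at hi
      omega
    refine GraphMachine.settles_of_assign (P := traceMachine) (s' := .search) (a := GReg.resetX)
      (by simp [traceTrans, graphView, hlast]) ?_
    refine (settles_search (m₀ := m) (ρ := fun y => ¬ HasWalk G k y) (Q := Q) hfun ?_ ?_ 0 rfl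
      eqOn_resetX).congr ?_
    · intro m' hm' _
      refine ih (val_exec_stepToX_i le_rfl ?_) ((hm' (by simp) : m' .v = m .v).trans hv)
      rwa [hm' (by simp : GReg.i ∈ {GReg.x}ᶜ)]
    · intro m' hm'
      exact hpick _ (congrArg (· + 1) ((hm' (by simp) : m' .v = m .v).trans hv))
    · change (∀ y, 0 ≤ y → G (m .w) y → ¬ HasWalk G k y) ∧ Q ↔ _
      simp [HasWalk]

theorem settles_trace_pick (hfun : ∀ a b c, G a b → G a c → b = c) (x : Fin (M + 1))
    (hx : m .v = x) :
    (traceMachine.graphSystem G).Settles (.pick, m)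
      (∀ y, x ≤ y → y ≠ Fin.last M → ¬ HasWalk G M y) := by
  induction x using induction_from_last generalizing m with
  | last =>
    refine GraphMachine.settles_of_assign (P := traceMachine) (s' := .yes) (a := GReg.keep)
      (by simp [traceTrans, graphView, hx])
      ((GraphMachine.settles_of_halted (P := traceMachine) rfl).congr ?_)
    simp
  | add_one x hlast ih =>
    subst hx
    refine (GraphMachine.settles_of_assign (P := traceMachine) (s' := .walk)
      (a := GReg.walkFromV) (by simp [traceTrans, graphView, hlast])
      (settles_trace_walk (m₀ := m) hfun (fun m' hm' => ih hm') M ?_ rfl)).congr ?_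
    · exact (congrArg (· + M) (Fin.val_zero _)).trans (zero_add M)
    · rw [forall_le_iff_of_ne_last hlast, imp_iff_right hlast]
      rfl

theorem settles_traceMachine (hG : LastIsolated G) (hfun : ∀ a b c, G a b → G a c → b = c) :
    (traceMachine.graphSystem G).Settles (traceMachine.start, fun _ => 0) (BoundedWalks G) :=
  (settles_trace_pick hfun 0 rfl).congr <| by simp [boundedWalks_iff hG]

end Tracing

end Programs

/-! ### Unification -/

section Substitution

variable {L : FirstOrder.Language.{u, v}} {α β γ : Type*}

theorem subst_subst (t : L.Term α) (θ : α → L.Term β) (σ : β → L.Term γ) :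
    (t.subst θ).subst σ = t.subst fun x => (θ x).subst σ := by
  induction t with
  | var x => rfl
  | func f ts ih => simp only [Language.Term.subst, ih]

theorem relabel_subst (t : L.Term α) (g : α → β) (σ : β → L.Term γ) :
    (t.relabel g).subst σ = t.subst fun x => σ (g x) := by
  induction t with
  | var x => rfl
  | func f ts ih => simp only [Language.Term.subst, Language.Term.relabel, ih]

theorem subst_var (t : L.Term α) : t.subst Language.Term.var = t := by
  induction t with
  | var x => rfl
  | func f ts ih => simp only [Language.Term.subst, ih]

theorem subst_congr [DecidableEq α] {t : L.Term α} {θ σ : α → L.Term β}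
    (h : ∀ x ∈ t.varFinset, θ x = σ x) : t.subst θ = t.subst σ := by
  induction t with
  | var x => exact h x (Finset.mem_singleton_self x)
  | func f ts ih =>
    refine congrArg (Language.Term.func f) (funext fun i => ih i fun x hx => h x ?_)
    exact Finset.mem_biUnion.2 ⟨i, Finset.mem_univ i, hx⟩

theorem varFinset_relabel [DecidableEq α] [DecidableEq β] (t : L.Term α) (g : α → β) :
    (t.relabel g).varFinset = t.varFinset.image g := by
  induction t with
  | var x => exact (Finset.image_singleton g x).symm
  | func f ts ih => simp only [Language.Term.relabel, Language.Term.varFinset, ih,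
      Finset.biUnion_image]

/-- The number of occurrences of symbols and variables in a term. -/
def termSize : L.Term α → ℕ
  | .var _ => 1
  | .func _ ts => 1 + ∑ i, termSize (ts i)

theorem termSize_pos (t : L.Term α) : 0 < termSize t := by
  cases t <;> simp [termSize]

theorem termSize_subst_arg_lt {n : ℕ} (f : L.Functions n) (ts : Fin n → L.Term α) (i : Fin n)
    (θ : α → L.Term β) :
    termSize ((ts i).subst θ) < termSize ((Language.Term.func f ts).subst θ) := by
  have hle : termSize ((ts i).subst θ) ≤ ∑ j, termSize ((ts j).subst θ) :=
    Finset.single_le_sum (f := fun j => termSize ((ts j).subst θ)) (fun _ _ => Nat.zero_le _)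
      (Finset.mem_univ i)
  rw [Language.Term.subst, termSize]
  omega

theorem termSize_le_subst [DecidableEq α] {t : L.Term α} {x : α} (h : x ∈ t.varFinset)
    (θ : α → L.Term β) : termSize (θ x) ≤ termSize (t.subst θ) := by
  induction t with
  | var y => rw [Finset.mem_singleton.1 h, Language.Term.subst]
  | func f ts ih =>
    obtain ⟨i, -, hi⟩ := Finset.mem_biUnion.1 h
    exact (ih i hi).trans (termSize_subst_arg_lt f ts i θ).le

theorem termSize_lt_subst [DecidableEq α] {t : L.Term α} {x : α} (h : x ∈ t.varFinset)
    (ht : t ≠ .var x) (θ : α → L.Term β) : termSize (θ x) < termSize (t.subst θ) := by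
  cases t with
  | var y => exact absurd (congrArg Language.Term.var (Finset.mem_singleton.1 h).symm) ht
  | func f ts =>
    obtain ⟨i, -, hi⟩ := Finset.mem_biUnion.1 h
    exact (termSize_le_subst hi θ).trans_lt (termSize_subst_arg_lt f ts i θ)

theorem notMem_varFinset_of_eq_subst [DecidableEq α] {s : L.Term α} {x : α} {ψ : α → L.Term β}
    (hs : s ≠ .var x) (h : ψ x = s.subst ψ) : x ∉ s.varFinset :=
  fun hx => (termSize_lt_subst hx hs ψ).ne (congrArg termSize h)

variable [DecidableEq α] {x : α} {s : L.Term α}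

theorem update_var_subst {ψ : α → L.Term β} (h : ψ x = s.subst ψ) :
    (fun y => (Function.update Language.Term.var x s y).subst ψ) = ψ := by
  funext y
  obtain rfl | hy := eq_or_ne y x
  · rw [Function.update_self, h]
  · rw [Function.update_of_ne hy, Language.Term.subst]

theorem subst_update_var (hx : x ∉ s.varFinset) :
    s.subst (Function.update Language.Term.var x s) = s := by
  conv_rhs => rw [← subst_var s]
  exact subst_congr fun y hy => Function.update_of_ne (ne_of_mem_of_not_mem hy hx) _ _

end Substitution

section Unification

variable {L : FirstOrder.Language.{u, v}} {θ ψ : ℕ → L.Term ℕ} {l l' : List (L.Term ℕ × L.Term ℕ)}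

/-- `θ` unifies all pairs in the list. -/
def UnifiesAll (θ : ℕ → L.Term ℕ) (l : List (L.Term ℕ × L.Term ℕ)) : Prop :=
  ∀ e ∈ l, IsUnifier θ e.1 e.2

/-- `θ` is a most general unifier of all pairs in the list. -/
def IsMGUAll (θ : ℕ → L.Term ℕ) (l : List (L.Term ℕ × L.Term ℕ)) : Prop :=
  UnifiesAll θ l ∧ ∀ ψ, UnifiesAll ψ l → ∃ σ : ℕ → L.Term ℕ, ∀ x, ψ x = (θ x).subst σ

theorem unifiesAll_cons {e : L.Term ℕ × L.Term ℕ} :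
    UnifiesAll θ (e :: l) ↔ IsUnifier θ e.1 e.2 ∧ UnifiesAll θ l :=
  List.forall_mem_cons

theorem unifiesAll_singleton {t s : L.Term ℕ} : UnifiesAll θ [(t, s)] ↔ IsUnifier θ t s :=
  List.forall_mem_singleton

theorem unifiesAll_append : UnifiesAll θ (l ++ l') ↔ UnifiesAll θ l ∧ UnifiesAll θ l' :=
  List.forall_mem_append

theorem unifiesAll_map_subst {τ : ℕ → L.Term ℕ} :
    UnifiesAll θ (l.map fun e => (e.1.subst τ, e.2.subst τ)) ↔
      UnifiesAll (fun x => (τ x).subst θ) l := by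
  simp only [UnifiesAll, IsUnifier, List.forall_mem_map, subst_subst]

theorem unifiesAll_args {n : ℕ} {f : L.Functions n} {ts ss : Fin n → L.Term ℕ} :
    UnifiesAll θ (List.ofFn (fun i => (ts i, ss i)) ++ l) ↔
      UnifiesAll θ ((.func f ts, .func f ss) :: l) := by
  rw [unifiesAll_append, unifiesAll_cons]
  refine and_congr_left fun _ => ?_
  simp [UnifiesAll, IsUnifier, Language.Term.subst, funext_iff]

theorem IsMGUAll.congr (h : ∀ ψ, UnifiesAll ψ l ↔ UnifiesAll ψ l') (hθ : IsMGUAll θ l) :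
    IsMGUAll θ l' :=
  ⟨(h θ).1 hθ.1, fun ψ hψ => hθ.2 ψ ((h ψ).2 hψ)⟩

theorem IsMGUAll.cons_var {x : ℕ} {s : L.Term ℕ} (hx : x ∉ s.varFinset)
    (hθ : IsMGUAll θ (l.map fun e => (e.1.subst (Function.update Language.Term.var x s),
      e.2.subst (Function.update Language.Term.var x s)))) :
    IsMGUAll (fun y => (Function.update Language.Term.var x s y).subst θ)
      ((.var x, s) :: l) := by
  refine ⟨unifiesAll_cons.2 ⟨?_, unifiesAll_map_subst.1 hθ.1⟩, fun ψ hψ => ?_⟩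
  · change (Function.update Language.Term.var x s x).subst θ = s.subst _
    rw [Function.update_self, ← subst_subst, subst_update_var hx]
  · obtain ⟨hψx, hψl⟩ := unifiesAll_cons.1 hψ
    have hψ' := update_var_subst (ψ := ψ) hψx
    obtain ⟨σ, hσ⟩ := hθ.2 ψ (unifiesAll_map_subst.2 (hψ'.symm ▸ hψl))
    refine ⟨σ, fun y => ?_⟩
    rw [subst_subst, ← funext hσ]
    exact (congrFun hψ' y).symm

/-- The total size of the left hand sides after a substitution. -/
def sizeUnder (ψ : ℕ → L.Term ℕ) (l : List (L.Term ℕ × L.Term ℕ)) : ℕ :=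
  (l.map fun e => termSize (e.1.subst ψ)).sum

theorem sizeUnder_lt_cons (e : L.Term ℕ × L.Term ℕ) : sizeUnder ψ l < sizeUnder ψ (e :: l) := by
  have hpos := termSize_pos (e.1.subst ψ)
  simp only [sizeUnder, List.map_cons, List.sum_cons]
  omega

theorem sizeUnder_args_lt {n : ℕ} {f : L.Functions n} {ts ss : Fin n → L.Term ℕ} {s : L.Term ℕ} :
    sizeUnder ψ (List.ofFn (fun i => (ts i, ss i)) ++ l) <
      sizeUnder ψ ((.func f ts, s) :: l) := by
  simp only [sizeUnder, List.map_append, List.sum_append, List.map_cons, List.sum_cons,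
    List.map_ofFn, Function.comp_def, List.sum_ofFn, Language.Term.subst, termSize]
  omega

theorem exists_isMGUAll_cons_var {x : ℕ} {s : L.Term ℕ}
    (ih : ∀ l', UnifiesAll ψ l' → sizeUnder ψ l' ≤ sizeUnder ψ l → ∃ θ, IsMGUAll θ l')
    (hψ : UnifiesAll ψ ((.var x, s) :: l)) : ∃ θ, IsMGUAll θ ((.var x, s) :: l) := by
  obtain ⟨hx, hl⟩ := unifiesAll_cons.1 hψ
  by_cases hs : s = .var x
  · obtain ⟨θ, hθ⟩ := ih l hl le_rfl
    exact ⟨θ, hθ.congr fun ψ' => by rw [unifiesAll_cons, hs]; exact (and_iff_right rfl).symm⟩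
  · have hψ' := update_var_subst (ψ := ψ) hx
    obtain ⟨θ, hθ⟩ := ih (l.map fun e => (e.1.subst (Function.update Language.Term.var x s),
        e.2.subst (Function.update Language.Term.var x s)))
      (unifiesAll_map_subst.2 (hψ'.symm ▸ hl))
      (by simp [sizeUnder, subst_subst, hψ', Function.comp_def])
    exact ⟨_, hθ.cons_var (notMem_varFinset_of_eq_subst hs hx)⟩

theorem exists_isMGUAll (h : UnifiesAll ψ l) : ∃ θ, IsMGUAll θ l := by
  induction hn : sizeUnder ψ l using Nat.strong_induction_on generalizing l with
  | _ n ih =>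
    subst hn
    rcases l with _ | ⟨⟨t, s⟩, l⟩
    · exact ⟨Language.Term.var, List.forall_mem_nil _, fun ψ' _ => ⟨ψ', fun _ => rfl⟩⟩
    have ih_le : ∀ l', UnifiesAll ψ l' → sizeUnder ψ l' ≤ sizeUnder ψ l → ∃ θ, IsMGUAll θ l' :=
      fun l' hl' hle => ih _ (hle.trans_lt (sizeUnder_lt_cons _)) hl' rfl
    rcases t with x | @⟨n, f, ts⟩
    · exact exists_isMGUAll_cons_var ih_le h
    rcases s with x | @⟨n', g, ss⟩
    · have hswap : ∀ ψ' : ℕ → L.Term ℕ, UnifiesAll ψ' ((.var x, .func f ts) :: l) ↔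
          UnifiesAll ψ' ((.func f ts, .var x) :: l) := fun ψ' => by
        rw [unifiesAll_cons, unifiesAll_cons, IsUnifier, IsUnifier, eq_comm]
      obtain ⟨θ, hθ⟩ := exists_isMGUAll_cons_var ih_le ((hswap ψ).2 h)
      exact ⟨θ, hθ.congr hswap⟩
    · have hhead := (unifiesAll_cons.1 h).1
      simp only [IsUnifier, Language.Term.subst, Language.Term.func.injEq] at hhead
      obtain ⟨rfl, hfg, -⟩ := hhead
      obtain rfl := eq_of_heq hfg
      obtain ⟨θ, hθ⟩ := ih _ sizeUnder_args_lt (unifiesAll_args.2 h) rfl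
      exact ⟨θ, hθ.congr fun _ => unifiesAll_args⟩

theorem exists_isMGU {t s : L.Term ℕ} (h : IsUnifier ψ t s) : ∃ θ, IsMGU θ t s := by
  simpa only [IsMGUAll, IsMGU, unifiesAll_singleton] using
    exists_isMGUAll (unifiesAll_singleton.2 h)

theorem exists_perm_disjoint {α : Type*} [Infinite α] [DecidableEq α] (s t : Finset α) :
    ∃ π : Equiv.Perm α, Disjoint s (t.image π) := by
  obtain ⟨t', ht's, hcard⟩ := s.finite_toSet.infinite_compl.exists_subset_card_eq t.card
  obtain ⟨π, hπ⟩ := Equiv.Perm.exists_extending_pair (fun x : t => (x : α))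
    (fun x => (t.equivOfCardEq hcard.symm x : α)) Subtype.val_injective
    (Subtype.val_injective.comp (Equiv.injective _))
  refine ⟨π, Finset.disjoint_right.2 fun x hx => ?_⟩
  obtain ⟨y, hy, rfl⟩ := Finset.mem_image.1 hx
  exact hπ ⟨y, hy⟩ ▸ ht's (Subtype.prop _)

theorem exists_isUnifier_of_disjoint {t s : L.Term ℕ} (hd : Disjoint t.varFinset s.varFinset)
    {ψ₁ ψ₂ : ℕ → L.Term ℕ} (h : t.subst ψ₁ = s.subst ψ₂) :
    ∃ ψ, IsUnifier ψ t s ∧ (∀ x ∈ t.varFinset, ψ x = ψ₁ x) ∧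
      ∀ x ∈ s.varFinset, ψ x = ψ₂ x := by
  have h₁ : ∀ x ∈ t.varFinset, t.varFinset.piecewise ψ₁ ψ₂ x = ψ₁ x :=
    fun x hx => Finset.piecewise_eq_of_mem _ _ _ hx
  have h₂ : ∀ x ∈ s.varFinset, t.varFinset.piecewise ψ₁ ψ₂ x = ψ₂ x :=
    fun x hx => Finset.piecewise_eq_of_notMem _ _ _ (Finset.disjoint_right.1 hd hx)
  refine ⟨t.varFinset.piecewise ψ₁ ψ₂, ?_, h₁, h₂⟩
  rw [IsUnifier, subst_congr h₁, subst_congr h₂, h]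

theorem exists_isUnifier_relabel {t s : L.Term ℕ} {β : Equiv.Perm ℕ}
    (hd : Disjoint t.varFinset (s.relabel β).varFinset) {ψ₁ ψ₂ : ℕ → L.Term ℕ}
    (h : t.subst ψ₁ = s.subst ψ₂) : ∃ ψ, IsUnifier ψ t (s.relabel β) := by
  obtain ⟨ψ, hψ, -⟩ := exists_isUnifier_of_disjoint hd
    (ψ₁ := ψ₁) (ψ₂ := fun x => ψ₂ (β.symm x)) (by simpa only [relabel_subst, β.symm_apply_apply])
  exact ⟨ψ, hψ⟩

theorem matchable_of_subst_eq {t s : L.Term ℕ} {ψ₁ ψ₂ : ℕ → L.Term ℕ}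
    (h : t.subst ψ₁ = s.subst ψ₂) : Matchable t s := by
  obtain ⟨β, hβ⟩ := exists_perm_disjoint t.varFinset s.varFinset
  rw [← varFinset_relabel] at hβ
  exact ⟨Equiv.refl ℕ, β, by simpa using hβ, by simpa using exists_isUnifier_relabel hβ h⟩

end Unification

/-! ### Wirings as relations -/

section FlowRelations

variable {L : FirstOrder.Language.{u, v}}

/-- The relation between the instances of the target and of the source of a representative. -/
def PreFlow.Rel (a : PreFlow L) (s t : L.Term ℕ) : Prop :=
  ∃ θ : ℕ → L.Term ℕ, s = a.tgt.subst θ ∧ t = a.src.subst θ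

/-- The relation given by the instances of a flow; it determines which products are defined. -/
def Flow.Rel (f : Flow L) (s t : L.Term ℕ) : Prop := ∃ a : PreFlow L, a.toFlow = f ∧ a.Rel s t

theorem PreFlow.Rel.of_relabel {a b : PreFlow L} {α : Equiv.Perm ℕ}
    (htgt : a.tgt.relabel α = b.tgt) (hsrc : a.src.relabel α = b.src) {s t : L.Term ℕ}
    (h : a.Rel s t) : b.Rel s t := by
  obtain ⟨θ, rfl, rfl⟩ := h
  refine ⟨θ ∘ α.symm, ?_, ?_⟩
  · simp [← htgt, relabel_subst]
  · simp [← hsrc, relabel_subst]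

theorem PreFlow.rel_toFlow (a : PreFlow L) (s t : L.Term ℕ) : a.toFlow.Rel s t ↔ a.Rel s t := by
  refine ⟨?_, fun h => ⟨a, rfl, h⟩⟩
  rintro ⟨b, hb, h⟩
  obtain ⟨α, htgt, hsrc⟩ := Quotient.exact hb
  exact h.of_relabel htgt hsrc

theorem Flow.exists_rel (f : Flow L) : ∃ s t, f.Rel s t := by
  obtain ⟨a, rfl⟩ := Quotient.exists_rep f
  exact ⟨_, _, a, rfl, Language.Term.var, rfl, rfl⟩

theorem Flow.IsProduct.rel_iff {f g h : Flow L} (hp : Flow.IsProduct f g h) (s t : L.Term ℕ) :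
    h.Rel s t ↔ ∃ z, f.Rel s z ∧ g.Rel z t := by
  obtain ⟨a, b, θ, hθ, rfl, rfl, hd, rfl⟩ := hp
  have hunif : a.src.subst θ = b.tgt.subst θ := hθ.1
  simp only [PreFlow.rel_toFlow]
  constructor
  · rintro ⟨η, rfl, rfl⟩
    refine ⟨_, ⟨fun x => (θ x).subst η, subst_subst _ _ _, rfl⟩,
      fun x => (θ x).subst η, ?_, subst_subst _ _ _⟩
    rw [← subst_subst, ← subst_subst, hunif]
  · rintro ⟨z, ⟨ψ₁, rfl, rfl⟩, ψ₂, hz, rfl⟩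
    obtain ⟨ψ, hψ, h₁, h₂⟩ := exists_isUnifier_of_disjoint hd hz
    obtain ⟨σ, hσ⟩ := hθ.2 ψ hψ
    refine ⟨σ, ?_, ?_⟩ <;> simp only [PreFlow.resolve, subst_subst] <;>
      refine subst_congr fun x hx => ?_
    · rw [← hσ, h₁ x (a.vars_eq ▸ hx)]
    · rw [← hσ, h₂ x (b.vars_eq ▸ hx)]

theorem Flow.exists_isProduct {f g : Flow L} {s z t : L.Term ℕ} (hf : f.Rel s z)
    (hg : g.Rel z t) : ∃ h, Flow.IsProduct f g h := by
  obtain ⟨a, rfl, ψ₁, rfl, rfl⟩ := hf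
  obtain ⟨b, rfl, ψ₂, hz, rfl⟩ := hg
  obtain ⟨β, hβ⟩ := exists_perm_disjoint a.src.varFinset b.tgt.varFinset
  rw [← varFinset_relabel] at hβ
  let b' : PreFlow L := ⟨b.tgt.relabel β, b.src.relabel β, by
    rw [varFinset_relabel, varFinset_relabel, b.vars_eq]⟩
  have hb' : b.toFlow = b'.toFlow := Quotient.sound ⟨β, rfl, rfl⟩
  obtain ⟨ψ, hψ⟩ := exists_isUnifier_relabel hβ hz
  obtain ⟨θ, hθ⟩ := exists_isMGU hψ
  exact ⟨_, a, b', θ, hθ, rfl, hb'.symm, hβ, rfl⟩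

namespace Wiring

open scoped ComplexOrder

/-- All coefficients are nonnegative reals, so that no cancellation occurs in sums and products. -/
def IsNonneg (F : Wiring L) : Prop := ∀ f, 0 ≤ F.coeff f

/-- The relation given by the instances of the flows that occur in a wiring. -/
def Rel (F : Wiring L) (s t : L.Term ℕ) : Prop := ∃ f, F.coeff f ≠ 0 ∧ f.Rel s t

theorem coeff_add (F G : Wiring L) (f : Flow L) : (F + G).coeff f = F.coeff f + G.coeff f := rfl

theorem coeff_sum {ι : Type*} (S : Finset ι) (F : ι → Wiring L) (f : Flow L) :
    (∑ i ∈ S, F i).coeff f = ∑ i ∈ S, (F i).coeff f :=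
  Finsupp.finsetSum_apply S F f

theorem coeff_single (f g : Flow L) (c : ℂ) [Decidable (f = g)] :
    (single f c).coeff g = if f = g then c else 0 :=
  Finsupp.single_apply

theorem coeff_mul (F G : Wiring L) (h : Flow L) : (F * G).coeff h =
    ∑ f ∈ Finsupp.support F, ∑ g ∈ Finsupp.support G, F.coeff f * G.coeff g * flowMul f g h := by
  change mul F G h = _
  simp only [mul, Finsupp.sum, Finsupp.finsetSum_apply, Finsupp.smul_apply, smul_eq_mul]
  rfl

theorem IsConcrete.isNonneg {F : Wiring L} (h : F.IsConcrete) : F.IsNonneg := fun f => by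
  by_cases hf : F.coeff f = 0
  · exact hf.ge
  · exact (h f hf).symm ▸ zero_le_one

theorem isNonneg_single_one (f : Flow L) : (single f 1).IsNonneg := fun g => by
  classical
  rw [coeff_single]
  split_ifs
  exacts [zero_le_one, le_rfl]

theorem IsNonneg.add {F G : Wiring L} (hF : F.IsNonneg) (hG : G.IsNonneg) : (F + G).IsNonneg :=
  fun f => add_nonneg (hF f) (hG f)

theorem IsNonneg.sum {ι : Type*} {S : Finset ι} {F : ι → Wiring L} (h : ∀ i, (F i).IsNonneg) :
    (∑ i ∈ S, F i).IsNonneg := fun f =>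
  (Finset.sum_nonneg fun i _ => h i f).trans_eq (coeff_sum S F f).symm

theorem rel_single_one (f : Flow L) (s t : L.Term ℕ) : (single f 1).Rel s t ↔ f.Rel s t := by
  classical
  simp [Rel, coeff_single]

theorem rel_one (s t : L.Term ℕ) : (1 : Wiring L).Rel s t ↔ s = t := by
  refine (rel_single_one _ s t).trans ((PreFlow.rel_toFlow _ s t).trans ⟨?_, ?_⟩)
  · rintro ⟨θ, rfl, rfl⟩
    rfl
  · rintro rfl
    exact ⟨fun _ => s, rfl, rfl⟩

theorem rel_add {F G : Wiring L} (hF : F.IsNonneg) (hG : G.IsNonneg) (s t : L.Term ℕ) :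
    (F + G).Rel s t ↔ F.Rel s t ∨ G.Rel s t := by
  simp only [Rel, coeff_add, Ne, add_eq_zero_iff_of_nonneg (hF _) (hG _), not_and_or,
    or_and_right, exists_or]

theorem rel_sum {ι : Type*} {S : Finset ι} {F : ι → Wiring L} (h : ∀ i, (F i).IsNonneg)
    (s t : L.Term ℕ) : (∑ i ∈ S, F i).Rel s t ↔ ∃ i ∈ S, (F i).Rel s t := by
  simp only [Rel, coeff_sum, Ne, Finset.sum_eq_zero_iff_of_nonneg fun i _ => h i _, not_forall]
  grind

theorem flowMul_nonneg (f g h : Flow L) : 0 ≤ flowMul f g h := by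
  classical
  unfold flowMul
  split_ifs
  · rw [Finsupp.single_apply]
    split_ifs
    exacts [zero_le_one, le_rfl]
  · exact le_rfl

theorem isProduct_of_flowMul_ne_zero {f g h : Flow L} (hne : flowMul f g h ≠ 0) :
    Flow.IsProduct f g h := by
  unfold flowMul at hne
  split_ifs at hne with hex
  · obtain rfl : h = hex.choose := by
      by_contra hh
      exact hne (Finsupp.single_eq_of_ne hh)
    exact hex.choose_spec
  · exact (hne rfl).elim

theorem exists_flowMul_ne_zero {f g : Flow L} (hex : ∃ h, Flow.IsProduct f g h) :
    ∃ h, flowMul f g h ≠ 0 := by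
  refine ⟨hex.choose, ?_⟩
  rw [flowMul, dif_pos hex, Finsupp.single_eq_same]
  exact one_ne_zero

theorem IsNonneg.mul {F G : Wiring L} (hF : F.IsNonneg) (hG : G.IsNonneg) : (F * G).IsNonneg :=
  fun h => (Finset.sum_nonneg fun f _ => Finset.sum_nonneg fun g _ =>
    mul_nonneg (mul_nonneg (hF f) (hG g)) (flowMul_nonneg f g h)).trans_eq (coeff_mul F G h).symm

theorem coeff_mul_ne_zero_iff {F G : Wiring L} (hF : F.IsNonneg) (hG : G.IsNonneg)
    (h : Flow L) : (F * G).coeff h ≠ 0 ↔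
      ∃ f g, F.coeff f ≠ 0 ∧ G.coeff g ≠ 0 ∧ flowMul f g h ≠ 0 := by
  have hterm : ∀ f g, 0 ≤ F.coeff f * G.coeff g * flowMul f g h := fun f g =>
    mul_nonneg (mul_nonneg (hF f) (hG g)) (flowMul_nonneg f g h)
  have hmem : ∀ (H : Wiring L) f, f ∈ Finsupp.support H ↔ H.coeff f ≠ 0 :=
    fun H f => Finsupp.mem_support_iff
  rw [coeff_mul, Ne, Finset.sum_eq_zero_iff_of_nonneg
    fun f _ => Finset.sum_nonneg fun g _ => hterm f g]
  simp only [Finset.sum_eq_zero_iff_of_nonneg fun g _ => hterm _ g, hmem, mul_eq_zero]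
  grind

theorem rel_mul {F G : Wiring L} (hF : F.IsNonneg) (hG : G.IsNonneg) (s t : L.Term ℕ) :
    (F * G).Rel s t ↔ ∃ z, F.Rel s z ∧ G.Rel z t := by
  constructor
  · rintro ⟨h, hh, hst⟩
    obtain ⟨f, g, hf, hg, hfg⟩ := (coeff_mul_ne_zero_iff hF hG h).1 hh
    obtain ⟨z, hz₁, hz₂⟩ := ((isProduct_of_flowMul_ne_zero hfg).rel_iff s t).1 hst
    exact ⟨z, ⟨f, hf, hz₁⟩, g, hg, hz₂⟩
  · rintro ⟨z, ⟨f, hf, hz₁⟩, g, hg, hz₂⟩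
    obtain ⟨h, hfg⟩ := exists_flowMul_ne_zero (Flow.exists_isProduct hz₁ hz₂)
    exact ⟨h, (coeff_mul_ne_zero_iff hF hG h).2 ⟨f, g, hf, hg, hfg⟩,
      ((isProduct_of_flowMul_ne_zero hfg).rel_iff s t).2 ⟨z, hz₁, hz₂⟩⟩

theorem IsNonneg.pow {F : Wiring L} (hF : F.IsNonneg) (k : ℕ) : (F ^ k).IsNonneg := by
  induction k with
  | zero => exact isNonneg_single_one _
  | succ k ih => exact ih.mul hF

theorem exists_rel_pow_iff {F : Wiring L} (hF : F.IsNonneg) (k : ℕ) (t : L.Term ℕ) :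
    (∃ s, (F ^ k).Rel s t) ↔ HasWalk (fun t s => F.Rel s t) k t := by
  induction k generalizing t with
  | zero => exact ⟨fun _ => trivial, fun _ => ⟨t, (rel_one t t).2 rfl⟩⟩
  | succ k ih =>
    calc (∃ s, (F ^ k * F).Rel s t)
      _ ↔ ∃ z, F.Rel z t ∧ ∃ s, (F ^ k).Rel s z := by
          simp only [rel_mul (hF.pow k) hF]
          grind
      _ ↔ HasWalk (fun t s => F.Rel s t) (k + 1) t :=
          exists_congr fun z => and_congr_right fun _ => ih z

theorem eq_zero_iff (F : Wiring L) : F = 0 ↔ ∀ s t, ¬ F.Rel s t := by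
  constructor
  · rintro rfl s t ⟨f, hf, -⟩
    exact hf rfl
  · intro h
    refine Finsupp.ext fun f => ?_
    by_contra hf
    obtain ⟨s, t, hst⟩ := f.exists_rel
    exact h s t ⟨f, hf, hst⟩

theorem isNilpotent_iff {F : Wiring L} (hF : F.IsNonneg) :
    IsNilpotent F ↔ BoundedWalks fun t s => F.Rel s t := by
  refine exists_congr fun k => ?_
  rw [eq_zero_iff, forall_comm]
  exact forall_congr' fun t => by rw [← exists_rel_pow_iff hF, not_exists]

end Wiring

end FlowRelations

/-! ### Observations on words -/

section Stacks

variable {L : FirstOrder.Language.{u, v}}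

/-- The first argument of a binary symbol; other terms are left unchanged. -/
def fstArg : L.Term ℕ → L.Term ℕ
  | @Language.Term.func _ _ 2 _ ts => ts 0
  | t => t

/-- The second argument of a binary symbol; other terms are left unchanged. -/
def sndArg : L.Term ℕ → L.Term ℕ
  | @Language.Term.func _ _ 2 _ ts => ts 1
  | t => t

/-- The term `tₐ` of the stack `t₀ • t₁ • ⋯ • tₐ • s`. -/
def stackElem (a : ℕ) (t : L.Term ℕ) : L.Term ℕ := fstArg (sndArg^[a] t)

/-- The extension of a permutation of the first `n` of `n + k` elements by the identity. -/
def padPerm {n : ℕ} (σ : Equiv.Perm (Fin n)) (k : ℕ) : Equiv.Perm (Fin (n + k)) :=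
  finSumFinEquiv.permCongr (Equiv.sumCongr σ (Equiv.refl (Fin k)))

theorem padPerm_castAdd {n : ℕ} (σ : Equiv.Perm (Fin n)) (k : ℕ) (i : Fin n) :
    padPerm σ k (Fin.castAdd k i) = Fin.castAdd k (σ i) := by
  simp [padPerm, Equiv.permCongr_apply]

theorem padPerm_natAdd {n : ℕ} (σ : Equiv.Perm (Fin n)) (k : ℕ) (i : Fin k) :
    padPerm σ k (Fin.natAdd n i) = Fin.natAdd n i := by
  simp [padPerm, Equiv.permCongr_apply]

namespace Vocabulary

variable (V : Vocabulary L)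

theorem cons_inj {a b a' b' : L.Term ℕ} : V.cons a b = V.cons a' b' ↔ a = a' ∧ b = b' := by
  refine ⟨fun h => ⟨congrArg fstArg h, congrArg sndArg h⟩, ?_⟩
  rintro ⟨rfl, rfl⟩
  rfl

theorem const_injective : Function.Injective (const : L.Constants → L.Term ℕ) := fun c c' h => by
  simp only [const, Language.Constants.term, Language.Term.func.injEq, heq_eq_eq] at h
  exact h.2.1

theorem subst_cons (a b : L.Term ℕ) (θ : ℕ → L.Term ℕ) :
    (V.cons a b).subst θ = V.cons (a.subst θ) (b.subst θ) := by
  simp only [cons, Language.Functions.apply₂, Language.Term.subst]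
  congr 1
  funext i
  fin_cases i <;> rfl

theorem subst_const (c : L.Constants) (θ : ℕ → L.Term ℕ) :
    (const c : L.Term ℕ).subst θ = const c := by
  simp only [const, Language.Constants.term, Language.Term.subst]
  congr 1
  funext i
  exact i.elim0

theorem subst_head (c d q : L.Constants) (θ : ℕ → L.Term ℕ) :
    (V.head c d q).subst θ = V.head c d q := by
  simp only [head, subst_cons, subst_const]

/-- The stack `x₀ • ⋯ • xₙ₋₁ • z`. -/
def stack {n : ℕ} (x : Fin n → L.Term ℕ) (z : L.Term ℕ) : L.Term ℕ :=
  V.consList (List.ofFn x) z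

theorem stack_succ {n : ℕ} (x : Fin (n + 1) → L.Term ℕ) (z : L.Term ℕ) :
    V.stack x z = V.cons (x 0) (V.stack (Fin.tail x) z) := by
  rw [stack, List.ofFn_succ]
  rfl

theorem stack_append {n k : ℕ} (x : Fin n → L.Term ℕ) (y : Fin k → L.Term ℕ) (z : L.Term ℕ) :
    V.stack (Fin.append x y) z = V.stack x (V.stack y z) := by
  rw [stack, List.ofFn_fin_append]
  exact List.foldr_append

theorem subst_stack {n : ℕ} (x : Fin n → L.Term ℕ) (z : L.Term ℕ) (θ : ℕ → L.Term ℕ) :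
    (V.stack x z).subst θ = V.stack (fun i => (x i).subst θ) (z.subst θ) := by
  induction n with
  | zero => rfl
  | succ n ih => rw [stack_succ, subst_cons, ih, stack_succ]; rfl

theorem sndArg_iterate_stack {n : ℕ} (x : Fin n → L.Term ℕ) (z : L.Term ℕ) :
    sndArg^[n] (V.stack x z) = z := by
  induction n with
  | zero => rfl
  | succ n ih => exact (congrArg sndArg^[n + 1] (V.stack_succ x z)).trans (ih _)

theorem stackElem_stack_add {n : ℕ} (x : Fin n → L.Term ℕ) (z : L.Term ℕ) (a : ℕ) :
    stackElem (n + a) (V.stack x z) = stackElem a z := by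
  rw [stackElem, Nat.add_comm, Function.iterate_add_apply, sndArg_iterate_stack]
  rfl

theorem stackElem_stack {n : ℕ} (x : Fin n → L.Term ℕ) (z : L.Term ℕ) (i : Fin n) :
    stackElem i (V.stack x z) = x i := by
  induction n with
  | zero => exact i.elim0
  | succ n ih =>
    rw [stack_succ]
    refine Fin.cases rfl (fun i => ih (Fin.tail x) i) i

theorem rel_obsFlow {n : ℕ} (c' d' q' c d q : L.Constants) (σ : Equiv.Perm (Fin n))
    (s t : L.Term ℕ) : (V.obsFlow c' d' q' c d q σ).Rel s t ↔
      ∃ (x : Fin n → L.Term ℕ) (z : L.Term ℕ), s = V.cons (V.head c' d' q') (V.stack x z) ∧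
        t = V.cons (V.head c d q) (V.stack (x ∘ σ) z) := by
  have htgt : ∀ θ, (V.obsFlow c' d' q' c d q σ).tgt.subst θ =
      V.cons (V.head c' d' q') (V.stack (fun i => θ i) (θ n)) := fun θ => by
    rw [obsFlow, subst_cons, subst_head]
    exact congrArg _ (V.subst_stack _ _ θ)
  have hsrc : ∀ θ, (V.obsFlow c' d' q' c d q σ).src.subst θ =
      V.cons (V.head c d q) (V.stack (fun i => θ (σ i)) (θ n)) := fun θ => by
    rw [obsFlow, subst_cons, subst_head]
    exact congrArg _ (V.subst_stack _ _ θ)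
  simp only [PreFlow.Rel, htgt, hsrc]
  constructor
  · rintro ⟨θ, rfl, rfl⟩
    exact ⟨fun i => θ i, θ n, rfl, rfl⟩
  · rintro ⟨x, z, rfl, rfl⟩
    refine ⟨fun a => if h : a < n then x ⟨a, h⟩ else z, ?_, ?_⟩ <;> simp [Function.comp_def]

theorem subst_cell (c d p : L.Constants) (θ : ℕ → L.Term ℕ) : (V.cell c d p).subst θ =
    V.cons (V.cons (const c) (V.cons (const d) (θ 0))) (V.cons (const p) (θ 1)) := by
  simp only [cell, subst_cons, subst_const, Language.Term.subst]

theorem rel_wordFlow (c' d' p' c d p : L.Constants) (s t : L.Term ℕ) :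
    (V.wordFlow c' d' p' c d p).Rel s t ↔ ∃ x y : L.Term ℕ,
      s = V.cons (V.cons (const c') (V.cons (const d') x)) (V.cons (const p') y) ∧
      t = V.cons (V.cons (const c) (V.cons (const d) x)) (V.cons (const p) y) := by
  simp only [PreFlow.Rel, wordFlow, subst_cell]
  refine ⟨fun ⟨θ, hs, ht⟩ => ⟨θ 0, θ 1, hs, ht⟩, ?_⟩
  rintro ⟨x, y, rfl, rfl⟩
  exact ⟨fun a => if a = 0 then x else y, rfl, rfl⟩

end Vocabulary

end Stacks

namespace Vocabulary

section Words

variable {L : FirstOrder.Language.{u, v}} (V : Vocabulary L)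

/-- The sides `(d, i)` and `(d', i')` of two cells of a cyclic word face each other. -/
def Adjacent {n : ℕ} (d : L.Constants) (i : Fin (n + 1)) (d' : L.Constants) (i' : Fin (n + 1)) :
    Prop :=
  d = V.rgt ∧ d' = V.lft ∧ i' = i + 1 ∨ d = V.lft ∧ d' = V.rgt ∧ i = i' + 1

theorem Adjacent.symm {V : Vocabulary L} {n : ℕ} {d d' : L.Constants} {i i' : Fin (n + 1)}
    (h : V.Adjacent d i d' i') : V.Adjacent d' i' d i :=
  Or.symm (h.imp (fun h => ⟨h.2.1, h.1, h.2.2⟩) fun h => ⟨h.2.1, h.1, h.2.2⟩)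

theorem Adjacent.unique {V : Vocabulary L} {n : ℕ} {d d₁ d₂ : L.Constants}
    {i i₁ i₂ : Fin (n + 1)} (h₁ : V.Adjacent d i d₁ i₁) (h₂ : V.Adjacent d i d₂ i₂) :
    d₁ = d₂ ∧ i₁ = i₂ := by
  obtain ⟨rfl, rfl, rfl⟩ | ⟨rfl, rfl, rfl⟩ := h₁ <;> obtain ⟨h, rfl, hi⟩ | ⟨h, rfl, hi⟩ := h₂
  · exact ⟨rfl, hi.symm⟩
  · exact absurd h.symm V.lft_ne_rgt
  · exact absurd h V.lft_ne_rgt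
  · exact ⟨rfl, add_right_cancel hi⟩

/-- The constant for an input symbol: `⋆` for the end markers. -/
def symbol : InSym V.alphabet → L.Constants
  | .letter a => a
  | _ => V.star

theorem symbol_readInput (W : List V.alphabet) (i : Fin (W.length + 1)) :
    V.symbol (TM.readInput W i) = V.letter W i := by
  induction i using Fin.cases with
  | zero => rfl
  | succ i => simp [TM.readInput, symbol, letter]

theorem isNonneg_wordRep (W : List V.alphabet) (p : Fin (W.length + 1) → L.Constants) :
    (V.wordRep W p).IsNonneg :=
  .sum fun _ => .add (Wiring.isNonneg_single_one _) (Wiring.isNonneg_single_one _)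

theorem rel_wordRep (W : List V.alphabet) (p : Fin (W.length + 1) → L.Constants)
    (s t : L.Term ℕ) : (V.wordRep W p).Rel s t ↔ ∃ d i d' i', V.Adjacent d i d' i' ∧
      (V.wordFlow (V.letter W i) d (p i) (V.letter W i') d' (p i')).Rel s t := by
  have hnonneg : ∀ f : Flow L, (Wiring.single f 1).IsNonneg := Wiring.isNonneg_single_one
  rw [wordRep, Wiring.rel_sum fun i => (hnonneg _).add (hnonneg _)]
  simp only [Wiring.rel_add (hnonneg _) (hnonneg _), Wiring.rel_single_one, PreFlow.rel_toFlow,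
    Finset.mem_univ, true_and]
  constructor
  · rintro ⟨i, h | h⟩
    · exact ⟨_, i, _, _, .inl ⟨rfl, rfl, rfl⟩, h⟩
    · exact ⟨_, _, _, i, .inr ⟨rfl, rfl, rfl⟩, h⟩
  · rintro ⟨d, i, d', i', ⟨rfl, rfl, rfl⟩ | ⟨rfl, rfl, rfl⟩, h⟩
    · exact ⟨i, .inl h⟩
    · exact ⟨i', .inr h⟩

theorem rel_wordFlow_cons_head (c' d' p' c d p a' b' q' a b q : L.Constants) (S T : L.Term ℕ) :
    (V.wordFlow c' d' p' c d p).Rel (V.cons (V.head a' b' q') S) (V.cons (V.head a b q) T) ↔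
      a' = c' ∧ b' = d' ∧ a = c ∧ b = d ∧ q' = q ∧
        ∃ y, S = V.cons (const p') y ∧ T = V.cons (const p) y := by
  simp only [rel_wordFlow, head, cons_inj, const_injective.eq_iff]
  constructor
  · rintro ⟨_, y, ⟨⟨rfl, rfl, rfl⟩, rfl⟩, ⟨rfl, rfl, hq⟩, rfl⟩
    exact ⟨rfl, rfl, rfl, rfl, (const_injective hq).symm, y, rfl, rfl⟩
  · rintro ⟨rfl, rfl, rfl, rfl, rfl, y, rfl, rfl⟩
    exact ⟨_, y, ⟨⟨rfl, rfl, rfl⟩, rfl⟩, ⟨rfl, rfl, rfl⟩, rfl⟩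

theorem rel_wordRep_cons_head (W : List V.alphabet) (p : Fin (W.length + 1) → L.Constants)
    (c' d' q' c d q : L.Constants) (S T : L.Term ℕ) :
    (V.wordRep W p).Rel (V.cons (V.head c' d' q') S) (V.cons (V.head c d q) T) ↔
      q' = q ∧ ∃ i i', c' = V.letter W i ∧ c = V.letter W i' ∧ V.Adjacent d' i d i' ∧
        ∃ y, S = V.cons (const (p i)) y ∧ T = V.cons (const (p i')) y := by
  simp only [rel_wordRep, rel_wordFlow_cons_head]
  constructor
  · rintro ⟨_, i, _, i', hadj, rfl, rfl, rfl, rfl, rfl, h⟩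
    exact ⟨rfl, i, i', rfl, rfl, hadj, h⟩
  · rintro ⟨rfl, i, i', rfl, rfl, hadj, h⟩
    exact ⟨_, i, _, i', hadj, rfl, rfl, rfl, rfl, rfl, h⟩

end Words

end Vocabulary

section Instructions

variable {L : FirstOrder.Language.{u, v}}

variable (L) in
/-- The heads `c' • d' • q'` and `c • d • q` of the target and the source of a flow, and what it
does to the first `N` entries of the stacks below them. -/
structure Instruction (N : ℕ) where
  c' : L.Constants
  d' : L.Constants
  q' : L.Constants
  c : L.Constants
  d : L.Constants
  q : L.Constants
  perm : Equiv.Perm (Fin N)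

namespace Instruction

variable {N : ℕ} (o : Instruction L N) (V : Vocabulary L)

/-- The head `c' • d' • q'`. -/
def tgtHead : L.Term ℕ := V.head o.c' o.d' o.q'

/-- The head `c • d • q`. -/
def srcHead : L.Term ℕ := V.head o.c o.d o.q

/-- The flow `f` relates terms with the heads and the stacks given by `o`, and all such terms with
stacks of `N` entries. -/
structure Describes (f : Flow L) : Prop where
  exists_of_rel : ∀ s t, f.Rel s t → ∃ S T, s = V.cons (o.tgtHead V) S ∧
    t = V.cons (o.srcHead V) T ∧ ∀ i : Fin N, stackElem i T = stackElem (o.perm i) S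
  rel_stack : ∀ (x : Fin N → L.Term ℕ) (z : L.Term ℕ), f.Rel
    (V.cons (o.tgtHead V) (V.stack x z)) (V.cons (o.srcHead V) (V.stack (x ∘ o.perm) z))

end Instruction

theorem describes_obsFlow (V : Vocabulary L) {n : ℕ} (c' d' q' c d q : L.Constants)
    (σ : Equiv.Perm (Fin n)) (k : ℕ) :
    (Instruction.mk c' d' q' c d q (padPerm σ k)).Describes V
      (V.obsFlow c' d' q' c d q σ).toFlow where
  exists_of_rel s t h := by
    obtain ⟨x, z, rfl, rfl⟩ := (V.rel_obsFlow ..).1 ((PreFlow.rel_toFlow _ _ _).1 h)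
    refine ⟨_, _, rfl, rfl, fun i => ?_⟩
    induction i using Fin.addCases with
    | left i =>
      rw [padPerm_castAdd, Fin.val_castAdd, Fin.val_castAdd, V.stackElem_stack, V.stackElem_stack]
      rfl
    | right i =>
      rw [padPerm_natAdd, Fin.val_natAdd, V.stackElem_stack_add, V.stackElem_stack_add]
  rel_stack x z := by
    have hx : x = Fin.append (fun i => x (Fin.castAdd k i)) (fun i => x (Fin.natAdd n i)) :=
      (Fin.append_castAdd_natAdd ..).symm
    have hperm : x ∘ padPerm σ k =
        Fin.append ((fun i => x (Fin.castAdd k i)) ∘ σ) (fun i => x (Fin.natAdd n i)) := by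
      funext i
      induction i using Fin.addCases with
      | left i => simp [padPerm_castAdd]
      | right i => simp [padPerm_natAdd]
    rw [PreFlow.rel_toFlow, V.rel_obsFlow, hperm, hx]
    simp only [Vocabulary.stack_append, Fin.append_left, Fin.append_right]
    exact ⟨_, _, rfl, rfl⟩

end Instructions

section Simulation

variable {α β : Type*} {E : α → α → Prop} {E' : β → β → Prop}

theorem BoundedWalks.of_simulation {R : α → β → Prop}
    (hstart : ∀ a a', E a a' → ∃ b', R a' b')
    (hstep : ∀ a a' b, R a b → E a a' → ∃ b', E' b b' ∧ R a' b') (h : BoundedWalks E') :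
    BoundedWalks E := by
  have hwalk : ∀ t a b, R a b → HasWalk E t a → HasWalk E' t b := by
    intro t
    induction t with
    | zero => exact fun _ _ _ _ => trivial
    | succ t ih =>
      rintro a b hab ⟨a', haa', ha'⟩
      obtain ⟨b', hbb', hab'⟩ := hstep a a' b hab haa'
      exact ⟨b', hbb', ih a' b' hab' ha'⟩
  obtain ⟨t, ht⟩ := h
  refine ⟨t + 1, fun a ⟨a', haa', ha'⟩ => ?_⟩
  obtain ⟨b', hb'⟩ := hstart a a' haa'
  exact ht b' (hwalk t a' b' hb' ha')

theorem boundedWalks_comap (g : α ≃ β) :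
    (BoundedWalks fun a b => E' (g a) (g b)) ↔ BoundedWalks E' := by
  refine ⟨.of_simulation (R := fun b a => b = g a) (fun _ b _ => ?_) ?_,
    .of_simulation (R := fun a b => b = g a) (fun _ a _ => ⟨g a, rfl⟩) ?_⟩
  · exact ⟨g.symm b, (g.apply_symm_apply b).symm⟩
  · rintro _ b a rfl h
    exact ⟨g.symm b, by rwa [g.apply_symm_apply], (g.apply_symm_apply b).symm⟩
  · rintro a a' _ rfl h
    exact ⟨g a', h, rfl⟩

end Simulation

section ObservationGraphs

variable {L : FirstOrder.Language.{u, v}} (V : Vocabulary L) {f K n : ℕ}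
  (o : Fin f → Instruction L (K + 1))

/-- The target of the last instruction applied and the positions in the stack below its head; the
label `f` stands for no instruction. -/
abbrev ObsVertex (f K n : ℕ) : Type := (Fin (K + 1) → Fin (n + 1)) × Fin (f + 1)

/-- The second vertex arises from the first one by a step between neighbouring cells of the word
with letters `ℓ`, followed by an instruction of `o`. -/
def ObsEdge (ℓ : ℕ → L.Constants) (u v : ObsVertex f K n) : Prop :=
  ∃ j k : Fin f, u.2 = j.castSucc ∧ v.2 = k.castSucc ∧
    (o j).q' = (o k).q ∧ (o j).c' = ℓ (u.1 0) ∧ (o k).c = ℓ (v.1 ((o k).perm 0)) ∧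
    V.Adjacent (o j).d' (u.1 0) (o k).d (v.1 ((o k).perm 0)) ∧
    ∀ i ≠ 0, u.1 i = v.1 ((o k).perm i)

variable {V o} {ℓ : ℕ → L.Constants}

theorem ObsEdge.ne_last {u v : ObsVertex f K n} (h : ObsEdge V o ℓ u v) :
    u.2 ≠ Fin.last f ∧ v.2 ≠ Fin.last f := by
  obtain ⟨j, k, hu, hv, -⟩ := h
  rw [hu, hv]
  exact ⟨Fin.castSucc_ne_last j, Fin.castSucc_ne_last k⟩

theorem ObsEdge.unique
    (hsrc : ∀ j k, (o j).c = (o k).c → (o j).d = (o k).d → (o j).q = (o k).q → j = k)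
    {u v w : ObsVertex f K n} (hv : ObsEdge V o ℓ u v) (hw : ObsEdge V o ℓ u w) : v = w := by
  obtain ⟨j, k, hj, hk, hq, -, hc, hadj, heq⟩ := hv
  obtain ⟨j', k', hj', hk', hq', -, hc', hadj', heq'⟩ := hw
  obtain rfl : j = j' := Fin.castSucc_injective f (hj.symm.trans hj')
  obtain ⟨hd, hpos⟩ := hadj.unique hadj'
  obtain rfl : k = k' := hsrc k k' (by rw [hc, hc', hpos]) hd (hq.symm.trans hq')
  refine Prod.ext (funext fun a => ?_) (hk.trans hk'.symm)
  obtain ⟨i, rfl⟩ := (o k).perm.surjective a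
  by_cases hi : i = 0
  · rw [hi, hpos]
  · rw [← heq i hi, heq' i hi]

end ObservationGraphs

section ObservationWalks

variable {L : FirstOrder.Language.{u, v}} {V : Vocabulary L} {φ : Wiring L} {f K : ℕ}
  {o : Fin f → Instruction L (K + 1)} {e : Fin f ≃ {g : Flow L // φ.coeff g ≠ 0}}
  {W : List V.alphabet} {p : Fin (W.length + 1) → L.Constants}

theorem rel_mul_wordRep (hφ : φ.IsNonneg) (s t : L.Term ℕ) :
    (φ * V.wordRep W p).Rel s t ↔ ∃ j z, (e j : Flow L).Rel s z ∧ (V.wordRep W p).Rel z t := by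
  rw [Wiring.rel_mul hφ (V.isNonneg_wordRep W p)]
  constructor
  · rintro ⟨z, ⟨g, hg, hsz⟩, hzt⟩
    exact ⟨e.symm ⟨g, hg⟩, z, by rwa [e.apply_symm_apply], hzt⟩
  · rintro ⟨j, z, hsz, hzt⟩
    exact ⟨z, ⟨e j, (e j).2, hsz⟩, hzt⟩

/-- The index of a position constant; a junk value for terms that are not one of the positions. -/
noncomputable def posIndex (p : Fin (W.length + 1) → L.Constants) (t : L.Term ℕ) :
    Fin (W.length + 1) :=
  Function.invFun (fun i => Vocabulary.const (p i)) t

theorem posIndex_const (hp : Function.Injective p) (i : Fin (W.length + 1)) :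
    posIndex p (Vocabulary.const (p i)) = i :=
  Function.leftInverse_invFun (Vocabulary.const_injective.comp hp) i

/-- The positions in the stack `S` below the head of instruction `j`. -/
noncomputable def stackVertex (K : ℕ) (p : Fin (W.length + 1) → L.Constants) (j : Fin f)
    (S : L.Term ℕ) : ObsVertex f K W.length :=
  (fun i => posIndex p (stackElem i S), j.castSucc)

theorem obsEdge_stackVertex (hp : Function.Injective p) {j k : Fin f} {S T S' : L.Term ℕ}
    (hstep : (V.wordRep W p).Rel (V.cons ((o k).srcHead V) T) (V.cons ((o j).tgtHead V) S))
    (hperm : ∀ i : Fin (K + 1), stackElem i T = stackElem ((o k).perm i) S') :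
    ObsEdge V o (V.symbol ∘ TM.readInput W) (stackVertex K p j S)
      (stackVertex K p k S') := by
  obtain ⟨hq, i, i', hc, hc', hadj, y, rfl, rfl⟩ := (V.rel_wordRep_cons_head ..).1 hstep
  have hsrc : (stackVertex K p k S').1 ((o k).perm 0) = i :=
    (congrArg (posIndex p) (hperm 0).symm).trans (posIndex_const hp i)
  have htgt : (stackVertex K p j (V.cons (Vocabulary.const (p i')) y)).1 0 = i' :=
    posIndex_const hp i'
  refine ⟨j, k, rfl, rfl, hq.symm, ?_, ?_, ?_, fun a ha => ?_⟩
  · rw [htgt, Function.comp_apply, V.symbol_readInput, hc']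
  · rw [hsrc, Function.comp_apply, V.symbol_readInput, hc]
  · rw [htgt, hsrc]
    exact hadj.symm
  · obtain ⟨a, rfl⟩ := Fin.exists_succ_eq.2 ha
    exact congrArg (posIndex p) (hperm a.succ)

theorem boundedWalks_mul_wordRep_of_obsEdge (hφ : φ.IsNonneg)
    (h : ∀ j, (o j).Describes V (e j)) (hp : Function.Injective p)
    (hb : BoundedWalks (ObsEdge V o (V.symbol ∘ TM.readInput W) :
      ObsVertex f K W.length → ObsVertex f K W.length → Prop)) :
    BoundedWalks fun t s => (φ * V.wordRep W p).Rel s t := by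
  refine hb.of_simulation (R := fun s u =>
    ∃ j S, s = V.cons ((o j).tgtHead V) S ∧ u = stackVertex K p j S) ?_ ?_
  · intro t s hst
    obtain ⟨j, z, hsz, -⟩ := (rel_mul_wordRep (e := e) hφ s t).1 hst
    obtain ⟨S, -, rfl, -, -⟩ := (h j).exists_of_rel s z hsz
    exact ⟨_, j, S, rfl, rfl⟩
  · rintro _ s _ ⟨j, S, rfl, rfl⟩ hst
    obtain ⟨k, z, hsz, hzt⟩ := (rel_mul_wordRep (e := e) hφ s _).1 hst
    obtain ⟨S', T, rfl, rfl, hperm⟩ := (h k).exists_of_rel s z hsz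
    exact ⟨_, obsEdge_stackVertex hp hzt hperm, k, S', rfl, rfl⟩

theorem rel_wordRep_stack {j k : Fin f} {u v : ObsVertex f K W.length} (hj : u.2 = j.castSucc)
    (hk : v.2 = k.castSucc) (h : ObsEdge V o (V.symbol ∘ TM.readInput W) u v)
    (z : L.Term ℕ) : (V.wordRep W p).Rel
      (V.cons ((o k).srcHead V)
        (V.stack ((fun i => Vocabulary.const (p (v.1 i))) ∘ (o k).perm) z))
      (V.cons ((o j).tgtHead V) (V.stack (fun i => Vocabulary.const (p (u.1 i))) z)) := by
  obtain ⟨j', k', hj', hk', hq, hc', hc, hadj, htail⟩ := h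
  obtain rfl : j' = j := Fin.castSucc_injective f (hj'.symm.trans hj)
  obtain rfl : k' = k := Fin.castSucc_injective f (hk'.symm.trans hk)
  refine (V.rel_wordRep_cons_head ..).2 ⟨hq.symm, _, _, hc.trans (V.symbol_readInput W _),
    hc'.trans (V.symbol_readInput W _), hadj.symm, _, ?_, V.stack_succ _ z⟩
  rw [V.stack_succ]
  congr 2
  funext i
  exact congrArg (fun x => Vocabulary.const (p x)) (htail i.succ i.succ_ne_zero).symm

theorem boundedWalks_obsEdge_of_mul_wordRep (hφ : φ.IsNonneg)
    (h : ∀ j, (o j).Describes V (e j))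
    (hb : BoundedWalks fun t s => (φ * V.wordRep W p).Rel s t) :
    BoundedWalks (ObsEdge V o (V.symbol ∘ TM.readInput W) :
      ObsVertex f K W.length → ObsVertex f K W.length → Prop) := by
  refine hb.of_simulation (R := fun u s => ∃ j, u.2 = Fin.castSucc j ∧ s = V.cons
    ((o j).tgtHead V) (V.stack (fun i => Vocabulary.const (p (u.1 i))) (.var 0))) ?_ ?_
  · rintro u v ⟨-, k, -, hk, -⟩
    exact ⟨_, k, hk, rfl⟩
  · rintro u v _ ⟨j, hj, rfl⟩ huv
    obtain ⟨-, k, -, hk, -⟩ := id huv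
    exact ⟨_, (rel_mul_wordRep (e := e) hφ _ _).2
      ⟨k, _, (h k).rel_stack _ _, rel_wordRep_stack hj hk huv _⟩, k, hk, rfl⟩

theorem Vocabulary.mem_language_iff (hφ : φ.IsNonneg) (h : ∀ j, (o j).Describes V (e j))
    (W : List V.alphabet) : W ∈ V.language φ ↔
      BoundedWalks (ObsEdge V o (V.symbol ∘ TM.readInput W) :
        ObsVertex f K W.length → ObsVertex f K W.length → Prop) := by
  have hnil : ∀ p, IsNilpotent (φ * V.wordRep W p) ↔
      BoundedWalks fun t s => (φ * V.wordRep W p).Rel s t := fun p =>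
    Wiring.isNilpotent_iff (hφ.mul (V.isNonneg_wordRep W p))
  constructor
  · intro hW
    let position := V.positions_infinite.natEmbedding
    refine boundedWalks_obsEdge_of_mul_wordRep hφ h
      ((hnil fun i => position i).1 (hW _ (fun i j hij => ?_) fun i => (position i).2))
    exact Fin.ext (position.injective (Subtype.ext hij))
  · exact fun hb p hp _ => (hnil p).2 (boundedWalks_mul_wordRep_of_obsEdge hφ h hp hb)

end ObservationWalks

section Decision

variable {L : FirstOrder.Language.{u, v}} (V : Vocabulary L) {f K m : ℕ}
  (o : Fin f → Instruction L (K + 1))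

/-- The condition of `ObsEdge` in terms of a view of the pointers of both vertices, for a coding of
the letters by numbers. -/
def obsViewEdge (dec : Fin m → V.alphabet) (x y : Fin (f + 1))
    (w : PtrView (InSym (Fin m)) (Bool × Fin (K + 1))) : Prop :=
  ∃ j k : Fin f, x = j.castSucc ∧ y = k.castSucc ∧ (o j).q' = (o k).q ∧
    (o j).c' = V.symbol ((w.sym (false, 0)).map dec) ∧
    (o k).c = V.symbol ((w.sym (true, (o k).perm 0)).map dec) ∧
    ((o j).d' = V.rgt ∧ (o k).d = V.lft ∧ w.adj (false, 0) (true, (o k).perm 0) = true ∨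
      (o j).d' = V.lft ∧ (o k).d = V.rgt ∧ w.adj (true, (o k).perm 0) (false, 0) = true) ∧
    ∀ i ≠ 0, w.eq (false, i) (true, (o k).perm i) = true

variable {V o}

theorem viewEdge_obsViewEdge (dec : Fin m → V.alphabet) (W : List (Fin m))
    (u v : ObsVertex f K W.length) : ViewEdge (obsViewEdge V o dec) W u v ↔
      ObsEdge V o (V.symbol ∘ TM.readInput (W.map dec)) u v := by
  simp [ViewEdge, obsViewEdge, ObsEdge, ptrView, Vocabulary.Adjacent, map_readInput]

theorem numberedEdge_obsViewEdge (dec : Fin m → V.alphabet) (W : List (Fin m)) :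
    GraphMachine.numberedEdge (obsViewEdge V o dec) W = fun i j =>
      ObsEdge V o (V.symbol ∘ TM.readInput (W.map dec))
        ((CyclicEnum.vertices W.length (K + 1) f).equiv.symm i)
        ((CyclicEnum.vertices W.length (K + 1) f).equiv.symm j) := by
  funext i j
  exact propext (viewEdge_obsViewEdge dec W _ _)

theorem lastIsolated_numberedEdge (dec : Fin m → V.alphabet) (W : List (Fin m)) :
    LastIsolated (GraphMachine.numberedEdge (obsViewEdge V o dec) W) := by
  rw [numberedEdge_obsViewEdge]
  intro i j hij
  simp only [Ne, CyclicEnum.eq_last_symm_iff]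
  exact ⟨fun h => hij.ne_last.1 h.2, fun h => hij.ne_last.2 h.2⟩

theorem numberedEdge_unique
    (hsrc : ∀ j k, (o j).c = (o k).c → (o j).d = (o k).d → (o j).q = (o k).q → j = k)
    (dec : Fin m → V.alphabet) (W : List (Fin m)) (i a b)
    (ha : GraphMachine.numberedEdge (obsViewEdge V o dec) W i a)
    (hb : GraphMachine.numberedEdge (obsViewEdge V o dec) W i b) : a = b := by
  rw [numberedEdge_obsViewEdge] at ha hb
  exact (CyclicEnum.vertices W.length (K + 1) f).equiv.symm.injective (ha.unique hsrc hb)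

variable {φ : Wiring L} {e : Fin f ≃ {g : Flow L // φ.coeff g ≠ 0}}

theorem boundedWalks_numberedEdge_iff (hφ : φ.IsNonneg) (h : ∀ j, (o j).Describes V (e j))
    (code : V.alphabet ≃ Fin m) (W : List V.alphabet) :
    BoundedWalks (GraphMachine.numberedEdge (obsViewEdge V o code.symm) (W.map code)) ↔
      W ∈ V.language φ := by
  have hdec : (W.map code).map code.symm = W := by simp
  rw [numberedEdge_obsViewEdge, hdec,
    boundedWalks_comap (CyclicEnum.vertices (W.map code).length (K + 1) f).equiv.symm,
    List.length_map, V.mem_language_iff hφ h]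

theorem mem_nlogspace_of_graphMachine {ρ : Type} [Finite ρ] {P : GraphMachine ρ}
    (hφ : φ.IsNonneg) (h : ∀ j, (o j).Describes V (e j))
    (hP : ∀ W : List (Fin V.alphabet.card),
      let G := GraphMachine.numberedEdge (obsViewEdge V o V.alphabet.equivFin.symm) W
      (P.graphSystem G).Settles (P.start, fun _ => 0) (BoundedWalks G)) :
    V.language φ ∈ NLogspace V.alphabet ∧
      (P.IsDeterministic → V.language φ ∈ Logspace V.alphabet) := by
  have key := (P.toPtrMachine (obsViewEdge V o V.alphabet.equivFin.symm)).mem_nlogspace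
    V.alphabet.equivFin (V.language φ) fun W =>
      (GraphMachine.settles_toPtrMachine _ (hP _)).congr (boundedWalks_numberedEdge_iff hφ h _ W)
  exact ⟨key.1, fun hdet => key.2 (GraphMachine.toPtrMachine_isDeterministic _ hdet)⟩

end Decision

section Observations

variable {L : FirstOrder.Language.{u, v}} {V : Vocabulary L} {φ : Wiring L}

/-- The sources of the flows that occur in a wiring are pairwise disjoint: this is the half of
`Wiring.IsIsometric` that bounds the number of successors. -/
def Wiring.IsDeterministic (φ : Wiring L) : Prop :=
  ∀ a b : PreFlow L, φ.coeff a.toFlow ≠ 0 → φ.coeff b.toFlow ≠ 0 →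
    a.toFlow ≠ b.toFlow → ¬ Matchable a.src b.src

theorem Wiring.IsDeterministic.unique (hφ : φ.IsDeterministic) {g g' : Flow L}
    (hg : φ.coeff g ≠ 0) (hg' : φ.coeff g' ≠ 0) {s s' t : L.Term ℕ} (h : g.Rel s t)
    (h' : g'.Rel s' t) : g = g' := by
  obtain ⟨a, rfl, θ, -, rfl⟩ := h
  obtain ⟨b, rfl, θ', -, ht⟩ := h'
  by_contra hne
  exact hφ a b hg hg' hne (matchable_of_subst_eq ht)

theorem Wiring.exists_describes
    (hflow : ∀ g, φ.coeff g ≠ 0 → ∃ (n : ℕ) (σ : Equiv.Perm (Fin n))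
      (c' d' q' c d q : L.Constants), g = (V.obsFlow c' d' q' c d q σ).toFlow) :
    ∃ (f K : ℕ) (e : Fin f ≃ {g : Flow L // φ.coeff g ≠ 0}) (o : Fin f → Instruction L (K + 1)),
      ∀ j, (o j).Describes V (e j) := by
  have hfin : Finite {g : Flow L // φ.coeff g ≠ 0} := (Finsupp.hasFiniteSupport φ).to_subtype
  obtain ⟨f, ⟨e⟩⟩ := Finite.exists_equiv_fin {g : Flow L // φ.coeff g ≠ 0}
  choose n σ c' d' q' c d q hσ using fun j => hflow (e.symm j) (e.symm j).2
  let K := ∑ j, n j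
  have hinstr : ∀ j, ∃ o : Instruction L (K + 1), o.Describes V (e.symm j) := fun j => by
    have hle : n j ≤ K + 1 :=
      (Finset.single_le_sum (fun i _ => Nat.zero_le (n i)) (Finset.mem_univ j)).trans K.le_succ
    obtain ⟨k, hk⟩ := Nat.exists_eq_add_of_le hle
    rw [hk, hσ j]
    exact ⟨_, describes_obsFlow V _ _ _ _ _ _ (σ j) k⟩
  choose o ho using hinstr
  exact ⟨f, K, e.symm, o, ho⟩

theorem Wiring.IsDeterministic.instruction_unique (hφ : φ.IsDeterministic) {f K : ℕ}
    {e : Fin f ≃ {g : Flow L // φ.coeff g ≠ 0}} {o : Fin f → Instruction L (K + 1)}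
    (h : ∀ j, (o j).Describes V (e j)) (j k : Fin f) (hc : (o j).c = (o k).c)
    (hd : (o j).d = (o k).d) (hq : (o j).q = (o k).q) : j = k := by
  have hhead : (o j).srcHead V = (o k).srcHead V := by
    rw [Instruction.srcHead, hc, hd, hq, Instruction.srcHead]
  have hj := (h j).rel_stack (fun _ => .var 0) (.var 0)
  rw [hhead] at hj
  exact e.injective (Subtype.ext (hφ.unique (e j).2 (e k).2 hj
    ((h k).rel_stack (fun _ => .var 0) (.var 0))))

end Observations

end UnifLog

theorem theorem3p2_general {L : FirstOrder.Language} (V : UnifLog.Vocabulary L)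
    (φ : UnifLog.Wiring L) (hφ : φ.IsNonneg)
    (hflow : ∀ g, φ.coeff g ≠ 0 → ∃ (n : ℕ) (σ : Equiv.Perm (Fin n))
      (c' d' q' c d q : L.Constants), g = (V.obsFlow c' d' q' c d q σ).toFlow) :
    V.language φ ∈ UnifLog.NLogspace V.alphabet ∧
      (φ.IsDeterministic → V.language φ ∈ UnifLog.Logspace V.alphabet) := by
  obtain ⟨f, K, e, o, h⟩ := UnifLog.Wiring.exists_describes hflow
  constructor
  · exact (UnifLog.mem_nlogspace_of_graphMachine hφ h fun W =>
      UnifLog.settles_countMachine (UnifLog.lastIsolated_numberedEdge _ W)).1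
  · intro hdet
    have hsrc := hdet.instruction_unique h
    exact (UnifLog.mem_nlogspace_of_graphMachine hφ h fun W =>
      UnifLog.settles_traceMachine (UnifLog.lastIsolated_numberedEdge _ W)
        (UnifLog.numberedEdge_unique hsrc _ W)).2 UnifLog.traceMachine_isDeterministic

theorem theorem3p2 {L : FirstOrder.Language} (V : UnifLog.Vocabulary L)
    (φ : UnifLog.Wiring L) (hφ : V.IsObservation φ) :
    V.language φ ∈ UnifLog.NLogspace V.alphabet ∧
      (φ.IsIsometric → V.language φ ∈ UnifLog.Logspace V.alphabet) := by
  have key := theorem3p2_general V φ hφ.1.isNonneg fun g hg => by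
    obtain ⟨n, σ, c', d', q', c, d, q, -, -, -, -, -, -, h⟩ := hφ.2 g hg
    exact ⟨n, σ, c', d', q', c, d, q, h⟩
  exact ⟨key.1, fun hiso => key.2 fun a b ha hb hab => (hiso.2 a b ha hb hab).2⟩
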